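/- Let $\mathcal X$ be an oriented smooth manifold of dimension $n\ge 1$ (without boundary, Hausdorff, $\sigma$-compact; in particular $\mathcal X$ may be compact), let $W\to\mathcal X$ be a smooth real vector bundle of finite rank, and let $k\ge1$. All sections below are smooth. A *body hyper-force field* is a section $\mathbf b$ of $L(J^{k-1}W,\bigwedge^nT^*\mathcal X)$, a *traction hyper-stress field* is a section $\sigma$ of $L(J^{k-1}W,\bigwedge^{n-1}T^*\mathcal X)$, and a *non-holonomic stress field* is a section $P$ of $L(J^1(J^{k-1}W),\bigwedge^nT^*\mathcal X)$. The *exterior jet* $\mathfrak d\sigma$ is the non-holonomic stress field determined by $\mathfrak d\sigma\cdot j^1A=d(\sigma\cdot A)$ for every section $A$ of $J^{k-1}W$. The traction hyper-stress $p_\sigma(P)$ of $P$ is obtained by restricting $P$ to the vertical subbundle $VJ^1(J^{k-1}W)\cong T^*\mathcal X\otimes J^{k-1}W$ and composing with the isomorphism $T\mathcal X\otimes\bigwedge^nT^*\mathcal X\cong\bigwedge^{n-1}T^*\mathcal X$, $v\otimes\theta\mapsto v\lrcorner\theta$. A *subbody* $\mathcal R$ is a compact $n$-dimensional submanifold of $\mathcal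 X$ with boundary (corners are allowed). A *hyper-force system* $(\mathbf b,\{\mathbf t_{\mathcal R}\})$ with traction hyper-stress $\sigma$ consists of a body hyper-force field $\mathbf b$ and, for each subbody $\mathcal R$, a section $\mathbf t_{\mathcal R}$ of $L(J^{k-1}W|_{\partial\mathcal R},\bigwedge^{n-1}T^*\partial\mathcal R)$ that is given by the Cauchy formula $\mathbf t_{\mathcal R}=\iota_{\partial\mathcal R}^{\sharp}\sigma$, that is, $\mathbf t_{\mathcal R}\cdot u$ is the restriction of $\sigma\cdot u$ to vectors tangent to $\partial\mathcal R$. A non-holonomic stress $P$ *represents* $(\mathbf b,\{\mathbf t_{\mathcal R}\})$ if for every subbody $\mathcal R$ and every (not necessarily holonomic) section $A$ of $J^{k-1}W$ $$\int_{\mathcal R}P\cdot j^1A=\int_{\mathcal R}\mathbf b\cdot A+\int_{\partial\mathcal R}\mathbf t_{\mathcal R}\cdot A .$$ In particular, for $A=j^{k-1}w$ both sides are the power expended on a section $w$ of $W$. **Proposition.** (i) For each non-holonomic stress field $P$, the section $p_\sigma(P)$ is smooth and $\mathfrak d(p_\sigma(P))-P$ factors through the projection $J^1(J^{k-1}W)\to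 J^{k-1}W$ as a smooth section $\operatorname{div}P$ of $L(J^{k-1}W,\bigwedge^nT^*\mathcal X)$; thus there is a unique linear operator $\operatorname{div}$ from non-holonomic stress fields to body hyper-force fields with $$\operatorname{div}P=\mathfrak d(p_\sigma(P))-P .$$ It is a differential operator of the first order, i.e. $(\operatorname{div}P)(x)$ is a linear function of the jet $j^1_xP$ for each $x\in\mathcal X$; and it is natural, i.e. it commutes with the pullback of non-holonomic stress fields and of body hyper-force fields under every isomorphism of vector bundles $W\to W'$ over a diffeomorphism $\mathcal X\to\mathcal X'$. (ii) Let $(\mathbf b,\{\mathbf t_{\mathcal R}\})$ be a hyper-force system with traction hyper-stress $\sigma$. A non-holonomic stress field $P$ represents $(\mathbf b,\{\mathbf t_{\mathcal R}\})$ if and only if $$p_\sigma(P)=\sigma\quad\text{and}\quad\operatorname{div}P+\mathbf b=0 .$$ -/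

import Mathlib

open scoped Manifold ContDiff Bundle Topology
open Set Filter MeasureTheory

noncomputable section
namespace HyperStress

/-- The model space of an `(n + 1)`-dimensional manifold. The dimension is written `n + 1`, so that
fluxes are `n`-forms and densities are `(n + 1)`-forms. -/
abbrev Model (n : ℕ) : Type := EuclideanSpace ℝ (Fin (n + 1))

/-- The ring of smooth real functions on `X`. -/
abbrev SmoothFun (n : ℕ) (X : Type*) [TopologicalSpace X] [ChartedSpace (Model n) X] :=
  C^∞⟮𝓘(ℝ, Model n), X; ℝ⟯

section Forms

variable (n : ℕ) {X : Type*} [TopologicalSpace X] [ChartedSpace (Model n) X]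

/-- Alternating `m`-forms on the tangent space at `x`. -/
abbrev FormFiber (m : ℕ) (x : X) : Type :=
  (TangentSpace 𝓘(ℝ, Model n) x) [⋀^Fin m]→L[ℝ] ℝ

/-- The coordinate expression of a form in the preferred chart at `x₀`, that is, its pullback under
the inverse of the chart. -/
def formInChart {m : ℕ} (θ : ∀ x : X, FormFiber n m x) (x₀ : X) (y : Model n) :
    (Model n) [⋀^Fin m]→L[ℝ] ℝ :=
  (θ ((extChartAt 𝓘(ℝ, Model n) x₀).symm y)).compContinuousLinearMap
    (mfderiv 𝓘(ℝ, Model n) 𝓘(ℝ, Model n) (extChartAt 𝓘(ℝ, Model n) x₀).symm y)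

variable (X) in
/-- Smooth differential `m`-forms on `X`. -/
def smoothForms (m : ℕ) : Submodule ℝ (∀ x : X, FormFiber n m x) where
  carrier := {θ | ∀ x₀ : X,
    ContDiffOn ℝ ∞ (formInChart n θ x₀) (extChartAt 𝓘(ℝ, Model n) x₀).target}
  add_mem' h₁ h₂ x₀ := (h₁ x₀).add (h₂ x₀)
  zero_mem' _ := contDiffOn_const (c := 0)
  smul_mem' c _ h x₀ := (h x₀).const_smul c

/-- The exterior derivative, computed at each point in the preferred chart at that point. -/
def dForm {m : ℕ} (θ : ∀ x : X, FormFiber n m x) (x : X) : FormFiber n (m + 1) x :=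
  (extDeriv (formInChart n θ x) (extChartAt 𝓘(ℝ, Model n) x x)).compContinuousLinearMap
    (mfderiv 𝓘(ℝ, Model n) 𝓘(ℝ, Model n) (extChartAt 𝓘(ℝ, Model n) x) x)

theorem dForm_add {m : ℕ} {θ η : ∀ x : X, FormFiber n m x} (hθ : θ ∈ smoothForms n X m)
    (hη : η ∈ smoothForms n X m) (x : X) : dForm n (θ + η) x = dForm n θ x + dForm n η x := by
  have h : ∀ ζ ∈ smoothForms n X m, DifferentiableAt ℝ (formInChart n ζ x)
      (extChartAt 𝓘(ℝ, Model n) x x) := fun ζ hζ =>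
    ((hζ x).contDiffAt (extChartAt_target_mem_nhds x)).differentiableAt (by simp)
  have := extDeriv_add (h θ hθ) (h η hη)
  rw [dForm, show formInChart n (θ + η) x = formInChart n θ x + formInChart n η x from rfl, this]
  rfl

theorem dForm_smul {m : ℕ} (c : ℝ) (θ : ∀ x : X, FormFiber n m x) (x : X) :
    dForm n (c • θ) x = c • dForm n θ x := by
  rw [dForm, show formInChart n (c • θ) x = c • formInChart n θ x from rfl, extDeriv_smul]
  rfl

theorem smul_mem_smoothForms [IsManifold 𝓘(ℝ, Model n) ∞ X] {m : ℕ} (f : SmoothFun n X)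
    {θ : ∀ x : X, FormFiber n m x} (h : θ ∈ smoothForms n X m) :
    (fun x => f x • θ x) ∈ smoothForms n X m := by
  intro x₀
  have hf : ContDiffOn ℝ ∞ (fun y => f ((extChartAt 𝓘(ℝ, Model n) x₀).symm y))
      (extChartAt 𝓘(ℝ, Model n) x₀).target := by
    rw [← contMDiffOn_iff_contDiffOn]
    exact f.contMDiff.comp_contMDiffOn (contMDiffOn_extChartAt_symm x₀)
  exact hf.smul (h x₀)

/-- The contraction `v ⌟ θ = θ (v, ·, …, ·)`. -/
def contract {V : Type*} [AddCommGroup V] [Module ℝ V] [TopologicalSpace V] {m : ℕ} (v : V) :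
    (V [⋀^Fin (m + 1)]→L[ℝ] ℝ) →ₗ[ℝ] (V [⋀^Fin m]→L[ℝ] ℝ) where
  toFun θ :=
    { θ.toAlternatingMap.curryLeft v with
      cont := θ.cont.comp (continuous_const.matrixVecCons continuous_id) }
  map_add' _ _ := rfl
  map_smul' _ _ := rfl

end Forms

section Jets

variable (n : ℕ) {X : Type*} [TopologicalSpace X] [ChartedSpace (Model n) X]
variable (M : Type*) [AddCommGroup M] [Module (SmoothFun n X) M] [Module ℝ M]
  [IsScalarTower ℝ (SmoothFun n X) M] (r : ℕ)

/-- The ideal of smooth functions that vanish at `x`. -/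
def vanishingIdeal (x : X) : Ideal (SmoothFun n X) :=
  RingHom.ker (ContMDiffMap.evalRingHom (I := 𝓘(ℝ, Model n)) (I' := 𝓘(ℝ)) (n := ∞) (R := ℝ) x)

/-- For the module `M` of smooth sections of a vector bundle, the submodule of the sections that
vanish at `x` to order `r` (that is, together with all their derivatives of order at most `r`): it
is `𝔪 ^ (r + 1) • M`, where `𝔪` is the ideal of smooth functions that vanish at `x`. -/
def vanishing (x : X) : Submodule (SmoothFun n X) M :=
  (vanishingIdeal n x) ^ (r + 1) • (⊤ : Submodule (SmoothFun n X) M)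

/-- The fibre at `x` of the `r`-th jet bundle of the vector bundle with module of smooth sections
`M`: sections modulo those that vanish at `x` to order `r`. -/
def Jet (x : X) : Type _ := M ⧸ (vanishing n M r x).restrictScalars ℝ

instance (x : X) : AddCommGroup (Jet n M r x) :=
  inferInstanceAs (AddCommGroup (M ⧸ (vanishing n M r x).restrictScalars ℝ))

instance (x : X) : Module ℝ (Jet n M r x) :=
  inferInstanceAs (Module ℝ (M ⧸ (vanishing n M r x).restrictScalars ℝ))

variable {M}

/-- The `r`-jet at `x` of a section. -/
def jet (x : X) : M →ₗ[ℝ] Jet n M r x :=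
  ((vanishing n M r x).restrictScalars ℝ).mkQ

theorem jet_eq_zero_iff (x : X) (s : M) : jet n r x s = 0 ↔ s ∈ vanishing n M r x :=
  Submodule.Quotient.mk_eq_zero ((vanishing n M r x).restrictScalars ℝ)

theorem jet_smul_sub (x : X) (f : SmoothFun n X) (hf : f ∈ vanishingIdeal n x ^ (r + 1)) (s : M) :
    jet n r x (f • s) = 0 := by
  rw [jet_eq_zero_iff, vanishing]
  exact Submodule.smul_mem_smul hf trivial

variable (M)

/-- The smooth sections of the `r`-th jet bundle. The bundle structure of the jet bundle is the one
in which the prolongations `x ↦ jet r x s` are smooth and span; hence a section is smooth if and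
only if it is locally a combination of prolongations with smooth coefficients. -/
def jetSections : Submodule ℝ (∀ x : X, Jet n M r x) where
  carrier := {A | ∀ x₀ : X, ∃ (N : ℕ) (f : Fin N → SmoothFun n X) (s : Fin N → M),
    ∀ᶠ x in 𝓝 x₀, A x = ∑ i, f i x • jet n r x (s i)}
  add_mem' := by
    intro A B hA hB x₀
    obtain ⟨N, f, s, h⟩ := hA x₀
    obtain ⟨N', f', s', h'⟩ := hB x₀
    refine ⟨N + N', Fin.append f f', Fin.append s s', ?_⟩
    filter_upwards [h, h'] with x hx hx'
    simp [Fin.sum_univ_add, hx, hx']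
  zero_mem' := fun _ => ⟨0, Fin.elim0, Fin.elim0, by simp⟩
  smul_mem' := by
    intro c A hA x₀
    obtain ⟨N, f, s, h⟩ := hA x₀
    refine ⟨N, fun i => c • f i, s, ?_⟩
    filter_upwards [h] with x hx
    simp [hx, Finset.smul_sum, smul_smul]

instance : SMul (SmoothFun n X) (jetSections n M r (X := X)) where
  smul f A := ⟨fun x => f x • A.1 x, by
    intro x₀
    obtain ⟨N, g, s, h⟩ := A.2 x₀
    refine ⟨N, fun i => f * g i, s, ?_⟩
    filter_upwards [h] with x hx
    simp [hx, Finset.smul_sum, smul_smul]⟩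

variable {M r}

@[simp] theorem jetSections_smul_apply (f : SmoothFun n X) (A : jetSections n M r (X := X)) (x : X) :
    (f • A).1 x = f x • A.1 x := rfl

variable (M r)

instance : Module (SmoothFun n X) (jetSections n M r (X := X)) where
  one_smul A := by ext x; simp
  mul_smul f g A := by ext x; simp [mul_smul]
  smul_zero f := by ext x; simp
  smul_add f A B := by ext x; simp
  add_smul f g A := by ext x; simp [add_smul]
  zero_smul A := by ext x; simp

instance : IsScalarTower ℝ (SmoothFun n X) (jetSections n M r (X := X)) where
  smul_assoc c f A := by ext x; simp [mul_smul]

variable {M}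

/-- The jet prolongation `s ↦ j^r s`. -/
def prolong : M →ₗ[ℝ] jetSections n M r (X := X) where
  toFun s := ⟨fun x => jet n r x s, fun _ => ⟨1, fun _ => 1, fun _ => s, by simp⟩⟩
  map_add' s s' := by ext x; simp
  map_smul' c s := by ext x; simp

@[simp] theorem prolong_apply (s : M) (x : X) : (prolong n r s).1 x = jet n r x s := rfl

theorem mem_vanishingIdeal {x : X} {f : SmoothFun n X} : f ∈ vanishingIdeal n x ↔ f x = 0 :=
  Iff.rfl

theorem eval_eq_zero_of_mem {x : X} {A : jetSections n M r (X := X)}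
    (hA : A ∈ (vanishingIdeal n x • ⊤ : Submodule (SmoothFun n X) (jetSections n M r (X := X)))) :
    A.1 x = 0 := by
  induction hA using Submodule.smul_induction_on' with
  | smul f hf B _ => simp [(mem_vanishingIdeal n).1 hf]
  | add B _ C _ hB hC => simp [hB, hC]

variable (M)

/-- The projection `J¹(J^r) → J^r` that takes the 1-jet at `x` of a section `A` to `A x`. -/
def value (x : X) : Jet n (jetSections n M r (X := X)) 1 x →ₗ[ℝ] Jet n M r x :=
  ((vanishing n (jetSections n M r (X := X)) 1 x).restrictScalars ℝ).liftQ
    ((LinearMap.proj x).comp (jetSections n M r (X := X)).subtype) fun _ hA =>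
      eval_eq_zero_of_mem n r (Submodule.smul_mono_left (Ideal.pow_le_self two_ne_zero) hA)

variable {M}

/-- Iterated commutators of the jet prolongation with multiplication operators, an auxiliary device. -/
def prolongComm : List (SmoothFun n X) → M → jetSections n M r (X := X)
  | [], s => prolong n r s
  | g :: l, s => prolongComm l (g • s) - g • prolongComm l s

theorem prolongComm_apply (l : List (SmoothFun n X)) (s : M) (y : X) :
    (prolongComm n r l s).1 y =
      jet n r y ((l.map fun g => g - algebraMap ℝ (SmoothFun n X) (g y)).prod • s) := by
  induction l generalizing s with
  | nil => simp [prolongComm]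
  | cons g l ih =>
    simp only [prolongComm, Submodule.coe_sub, Pi.sub_apply, jetSections_smul_apply, ih,
      List.map_cons, List.prod_cons]
    rw [← map_smul, ← map_sub]
    congr 1
    rw [← algebraMap_smul (SmoothFun n X) (g y), smul_smul, smul_smul, ← sub_smul]
    congr 1
    ring

theorem prolongComm_sub_mem (x : X) (l : List (SmoothFun n X)) (hl : ∀ g ∈ l, g ∈ vanishingIdeal n x)
    (s : M) : prolong n r (l.prod • s) - prolongComm n r l s ∈
      (vanishingIdeal n x • ⊤ : Submodule (SmoothFun n X) (jetSections n M r (X := X))) := by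
  induction l generalizing s with
  | nil => simp [prolongComm]
  | cons g l ih =>
    have h1 := ih (fun g hg => hl g (by simp [hg])) (g • s)
    have h2 : g • prolongComm n r l s ∈
        (vanishingIdeal n x • ⊤ : Submodule (SmoothFun n X) (jetSections n M r (X := X))) :=
      Submodule.smul_mem_smul (hl g (by simp)) Submodule.mem_top
    have := add_mem h1 h2
    rw [smul_smul, mul_comm] at this
    simp only [List.prod_cons, prolongComm]
    convert this using 1
    abel

theorem prolong_mem {x : X} {s : M} (hs : s ∈ vanishing n M r x) :
    prolong n r s ∈
      (vanishingIdeal n x • ⊤ : Submodule (SmoothFun n X) (jetSections n M r (X := X))) := by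
  have key : ∀ (k : ℕ) (f : SmoothFun n X), f ∈ vanishingIdeal n x ^ k →
      ∀ (l : List (SmoothFun n X)), (∀ g ∈ l, g ∈ vanishingIdeal n x) → l.length + k = r + 1 →
      ∀ s : M, prolong n r ((f * l.prod) • s) ∈
      (vanishingIdeal n x • ⊤ : Submodule (SmoothFun n X) (jetSections n M r (X := X))) := by
    intro k
    induction k with
    | zero =>
      intro f _ l hl hlen s
      have h := prolongComm_sub_mem n r x l hl (f • s)
      have h0 : prolongComm n r l (f • s) = 0 := by
        ext y
        rw [prolongComm_apply]
        refine jet_smul_sub n r y _ ?_ _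
        rw [add_zero] at hlen
        rw [← hlen]
        clear hlen h hl
        induction l with
        | nil => simp
        | cons g l ih =>
          rw [List.map_cons, List.prod_cons, List.length_cons, pow_succ']
          refine Ideal.mul_mem_mul ?_ ih
          rw [mem_vanishingIdeal]
          exact sub_self (g y)
      rw [h0, sub_zero, smul_smul, mul_comm] at h
      exact h
    | succ k ih =>
      intro f hf l hl hlen s
      rw [pow_succ] at hf
      induction hf using Submodule.mul_induction_on' with
      | mem_mul_mem a ha b hb =>
        have := ih a ha (b :: l) (by simpa [hb] using hl) (by simp; omega) s
        simpa [mul_assoc] using this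
      | add a _ b _ ha hb =>
        rw [add_mul, add_smul, map_add]
        exact add_mem ha hb
  induction hs using Submodule.smul_induction_on' with
  | smul f hf s _ => simpa using key (r + 1) f hf [] (by simp) (by simp) s
  | add a _ b _ ha hb => rw [map_add]; exact add_mem ha hb

end Jets

section Operators

variable (n : ℕ) {X : Type*} [TopologicalSpace X] [ChartedSpace (Model n) X]
  [IsManifold 𝓘(ℝ, Model n) ∞ X]

theorem exists_smoothFun_mfderiv_eq [T2Space X] (x : X)
    (α : TangentSpace 𝓘(ℝ, Model n) x →L[ℝ] ℝ) :
    ∃ f : SmoothFun n X, f x = 0 ∧ mfderiv 𝓘(ℝ, Model n) 𝓘(ℝ) f x = α := by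
  let b : SmoothBumpFunction 𝓘(ℝ, Model n) x := Classical.choice inferInstance
  let a : Model n →L[ℝ] ℝ := α
  let g : X → ℝ := fun y => a (extChartAt 𝓘(ℝ, Model n) x y - extChartAt 𝓘(ℝ, Model n) x x)
  have hφ : ContMDiffOn 𝓘(ℝ, Model n) 𝓘(ℝ, Model n) ∞ (extChartAt 𝓘(ℝ, Model n) x)
      (chartAt (Model n) x).source := contMDiffOn_extChartAt
  have hg : ContMDiffOn 𝓘(ℝ, Model n) 𝓘(ℝ) ∞ g (chartAt (Model n) x).source := by
    have ha : ContMDiff 𝓘(ℝ, Model n) 𝓘(ℝ) ∞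
        (fun z : Model n => a (z - extChartAt 𝓘(ℝ, Model n) x x)) :=
      (a.contDiff.comp (contDiff_id.sub contDiff_const)).contMDiff
    exact ha.comp_contMDiffOn hφ
  refine ⟨⟨fun y => b y • g y, b.contMDiff_smul hg⟩, ?_, ?_⟩
  · change b x • g x = 0
    simp [g]
  · have h1 : (fun y => b y • g y) =ᶠ[𝓝 x] g := by
      filter_upwards [b.eventuallyEq_one] with y hy
      simp [hy]
    change mfderiv 𝓘(ℝ, Model n) 𝓘(ℝ) (fun y => b y • g y) x = α
    rw [h1.mfderiv_eq]
    have h2 : HasMFDerivAt 𝓘(ℝ, Model n) 𝓘(ℝ) g x a := by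
      refine ⟨?_, ?_⟩
      · exact (hg.continuousOn.continuousAt (chart_source_mem_nhds _ x))
      · have : HasFDerivAt (fun z : Model n => a (z - extChartAt 𝓘(ℝ, Model n) x x)) a
            (extChartAt 𝓘(ℝ, Model n) x x) :=
          a.hasFDerivAt.comp _ ((hasFDerivAt_id _).sub_const _)
        refine (this.hasFDerivWithinAt).congr_of_eventuallyEq ?_ ?_
        · have h3 : (extChartAt 𝓘(ℝ, Model n) x).target ∈
              𝓝[range 𝓘(ℝ, Model n)] (extChartAt 𝓘(ℝ, Model n) x x) :=
            extChartAt_target_mem_nhdsWithin x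
          filter_upwards [h3] with z hz
          simp only [writtenInExtChartAt, Function.comp, g, extChartAt_model_space_eq_id,
            PartialEquiv.refl_coe, id]
          rw [(extChartAt 𝓘(ℝ, Model n) x).right_inv hz]
        · simp [writtenInExtChartAt, g, chartAt_self_eq]
    exact h2.mfderiv

theorem dForm_smul_eq_zero {m : ℕ} {x : X} {h : SmoothFun n X}
    (hh : h ∈ vanishingIdeal n x ^ 2) {θ : ∀ x : X, FormFiber n m x}
    (hθ : θ ∈ smoothForms n X m) : dForm n (fun y => h y • θ y) x = 0 := by
  have hs : ∀ f : SmoothFun n X, DifferentiableAt ℝ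
      (fun y => f ((extChartAt 𝓘(ℝ, Model n) x).symm y)) (extChartAt 𝓘(ℝ, Model n) x x) := by
    intro f
    have hf : ContDiffOn ℝ ∞ (fun y => f ((extChartAt 𝓘(ℝ, Model n) x).symm y))
        (extChartAt 𝓘(ℝ, Model n) x).target := by
      rw [← contMDiffOn_iff_contDiffOn]
      exact f.contMDiff.comp_contMDiffOn (contMDiffOn_extChartAt_symm x)
    exact (hf.contDiffAt (extChartAt_target_mem_nhds x)).differentiableAt (by simp)
  have hF : DifferentiableAt ℝ (formInChart n θ x) (extChartAt 𝓘(ℝ, Model n) x x) :=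
    ((hθ x).contDiffAt (extChartAt_target_mem_nhds x)).differentiableAt (by simp)
  have h0 : h x = 0 ∧ HasFDerivAt (fun y => h ((extChartAt 𝓘(ℝ, Model n) x).symm y))
      (0 : Model n →L[ℝ] ℝ) (extChartAt 𝓘(ℝ, Model n) x x) := by
    rw [pow_two] at hh
    induction hh using Submodule.mul_induction_on' with
    | mem_mul_mem f hf g hg =>
      have hf0 : f x = 0 := hf
      have hg0 : g x = 0 := hg
      refine ⟨by simp [hf0], ?_⟩
      have := (hs f).hasFDerivAt.fun_mul (hs g).hasFDerivAt
      simp only [extChartAt_to_inv, hf0, hg0, zero_smul, add_zero] at this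
      exact this
    | add f _ g _ hf hg =>
      refine ⟨by simp [hf.1, hg.1], ?_⟩
      have := hf.2.fun_add hg.2
      rw [add_zero] at this
      exact this
  have h1 : HasFDerivAt (formInChart n (fun y => h y • θ y) x)
      (0 : Model n →L[ℝ] (Model n [⋀^Fin m]→L[ℝ] ℝ)) (extChartAt 𝓘(ℝ, Model n) x x) := by
    have := HasFDerivAt.fun_smul (𝕜 := ℝ) (𝕜' := ℝ) h0.2 hF.hasFDerivAt
    rw [extChartAt_to_inv, h0.1, zero_smul, zero_add] at this
    have e : ContinuousLinearMap.smulRight (0 : Model n →L[ℝ] ℝ)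
        (formInChart n θ x (extChartAt 𝓘(ℝ, Model n) x x)) = 0 := by
      ext; simp
    rw [e] at this
    exact this
  rw [dForm, extDeriv, h1.fderiv]
  have e : ContinuousAlternatingMap.alternatizeUncurryFin
      (0 : Model n →L[ℝ] (Model n [⋀^Fin m]→L[ℝ] ℝ)) = 0 := by
    ext v
    simp [ContinuousAlternatingMap.alternatizeUncurryFin_apply]
  rw [e]
  rfl

variable (M : Type*) [AddCommGroup M] [Module (SmoothFun n X) M] [Module ℝ M]
  [IsScalarTower ℝ (SmoothFun n X) M] (r m : ℕ)

/-- Smooth sections of `L(J^r, ⋀^m T*X)`: families of linear maps that take smooth sections of the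
jet bundle to smooth forms. -/
def jetHom : Submodule ℝ (∀ x : X, Jet n M r x →ₗ[ℝ] FormFiber n m x) where
  carrier := {Φ | ∀ A ∈ jetSections n M r, (fun x => Φ x (A x)) ∈ smoothForms n X m}
  add_mem' h₁ h₂ A hA := add_mem (h₁ A hA) (h₂ A hA)
  zero_mem' _ _ := zero_mem _
  smul_mem' c _ h A hA := Submodule.smul_mem _ c (h A hA)

instance : AddCommGroup (jetHom (X := X) n M r m) :=
  Submodule.addCommGroup (R := ℝ) (M := ∀ x : X, Jet n M r x →ₗ[ℝ] FormFiber n m x)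
    (jetHom (X := X) n M r m)

instance : Module ℝ (jetHom (X := X) n M r m) :=
  Submodule.module (R := ℝ) (M := ∀ x : X, Jet n M r x →ₗ[ℝ] FormFiber n m x)
    (jetHom (X := X) n M r m)

instance : SMul (SmoothFun n X) (jetHom (X := X) n M r m) where
  smul f Φ := ⟨fun x => f x • Φ.1 x, fun A hA => smul_mem_smoothForms n f (Φ.2 A hA)⟩

variable {M r m}

theorem jetHom_smul_apply (f : SmoothFun n X) (Φ : jetHom (X := X) n M r m) (x : X) :
    (f • Φ).1 x = f x • Φ.1 x := rfl

variable (M r m)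

instance : Module (SmoothFun n X) (jetHom (X := X) n M r m) where
  one_smul A := by ext x : 2; simp [jetHom_smul_apply]
  mul_smul f g A := by ext x : 2; simp [jetHom_smul_apply, mul_smul]
  smul_zero f := by ext x : 2; simp [jetHom_smul_apply]
  smul_add f A B := by ext x : 2; simp [jetHom_smul_apply]
  add_smul f g A := by ext x : 2; simp [jetHom_smul_apply, add_smul]
  zero_smul A := by ext x : 2; simp [jetHom_smul_apply]

instance : IsScalarTower ℝ (SmoothFun n X) (jetHom (X := X) n M r m) where
  smul_assoc c f A := by ext x : 2; simp [jetHom_smul_apply, mul_smul]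

variable {M r m}

/-- The map `A ↦ d(σ · A) x`. -/
def dPairing (σ : jetHom (X := X) n M r m) (x : X) :
    jetSections (X := X) n M r →ₗ[ℝ] FormFiber n (m + 1) x where
  toFun A := dForm n (fun y => σ.1 y (A.1 y)) x
  map_add' A B := by
    rw [← dForm_add n (σ.2 _ A.2) (σ.2 _ B.2)]
    congr 1; ext y : 1; simp
  map_smul' c A := by
    rw [RingHom.id_apply, ← dForm_smul]
    congr 1; ext y : 1; simp

/-- The exterior jet of `σ`, determined by `𝔡σ · j¹A = d(σ · A)` for every section `A` of the jet
bundle. -/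
def exteriorJet (σ : jetHom (X := X) n M r m) (x : X) :
    Jet n (jetSections (X := X) n M r) 1 x →ₗ[ℝ] FormFiber n (m + 1) x :=
  ((vanishing n (jetSections (X := X) n M r) 1 x).restrictScalars ℝ).liftQ (dPairing n σ x) <| by
    intro A hA
    rw [LinearMap.mem_ker]
    rw [Submodule.restrictScalars_mem, vanishing] at hA
    induction hA using Submodule.smul_induction_on' with
    | smul h hh B _ =>
      rw [← dForm_smul_eq_zero n hh (σ.2 _ B.2)]
      change dForm n _ x = _
      congr 1; ext y : 1
      rw [jetSections_smul_apply, map_smul]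
    | add A _ B _ hA hB => rw [map_add, hA, hB, add_zero]

variable [T2Space X]

/-- A smooth function that vanishes at `x` and has differential `α` there. -/
def smoothFunOfCovector (x : X) (α : TangentSpace 𝓘(ℝ, Model n) x →L[ℝ] ℝ) : SmoothFun n X :=
  (exists_smoothFun_mfderiv_eq n x α).choose

variable (M r)

/-- The inclusion of the vertical subbundle, `α ⊗ u ↦ j¹(f A) x` where `f x = 0`, `df x = α` and
`A x = u`. It identifies `T*X ⊗ J^r` with the kernel of the projection `value`. -/
def vertical (x : X) (α : TangentSpace 𝓘(ℝ, Model n) x →L[ℝ] ℝ) :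
    Jet n M r x →ₗ[ℝ] Jet n (jetSections (X := X) n M r) 1 x :=
  ((vanishing n M r x).restrictScalars ℝ).liftQ
    ((jet n 1 x).comp
      (((Module.toModuleEnd ℝ (S := SmoothFun n X) (jetSections (X := X) n M r))
        (smoothFunOfCovector n x α)).comp (prolong n r))) <| by
    intro s hs
    rw [LinearMap.mem_ker]
    refine (jet_eq_zero_iff n 1 x _).2 ?_
    rw [vanishing, pow_succ, pow_one, ← smul_eq_mul, Submodule.smul_assoc]
    exact Submodule.smul_mem_smul (exists_smoothFun_mfderiv_eq n x α).choose_spec.1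
      (prolong_mem n r hs)

/-- The traction hyper-stress `p_σ(P)` of a non-holonomic stress: the restriction of `P` to vertical
elements is a section of `L(T*X ⊗ J^r, ⋀^(m+1) T*X) = (J^r)* ⊗ TX ⊗ ⋀^(m+1) T*X`, which is followed by
the contraction `v ⊗ θ ↦ v ⌟ θ`. Written in a basis `e i` of the tangent space with dual basis `ε i`,
it is `u ↦ ∑ i, e i ⌟ P (ε i ⊗ u)`. -/
def tractionPart (P : ∀ x : X, Jet n (jetSections (X := X) n M r) 1 x →ₗ[ℝ] FormFiber n (m + 1) x)
    (x : X) : Jet n M r x →ₗ[ℝ] FormFiber n m x :=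
  ∑ i : Fin (n + 1), contract (V := TangentSpace 𝓘(ℝ, Model n) x) (EuclideanSpace.single i (1 : ℝ) : Model n) ∘ₗ P x ∘ₗ
    vertical n M r x (EuclideanSpace.proj i : Model n →L[ℝ] ℝ)

end Operators

section Bodies

variable (n : ℕ) {X : Type*} [TopologicalSpace X] [ChartedSpace (Model n) X]

/-- A chart of `X` in which `R` is given by the inequalities `0 ≤ y i` for `i ∈ faces`. -/
structure CornerChart (R : Set X) where
  chart : OpenPartialHomeomorph X (Model n)
  mem_maximalAtlas : chart ∈ IsManifold.maximalAtlas 𝓘(ℝ, Model n) ∞ X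
  faces : Finset (Fin (n + 1))
  mem_iff : ∀ x ∈ chart.source, x ∈ R ↔ ∀ i ∈ faces, 0 ≤ chart x i

variable (X) in
/-- A subbody: a compact `(n + 1)`-dimensional submanifold of `X` with boundary, where corners are
allowed (so that embedded simplices and cubes are subbodies). -/
structure Subbody where
  carrier : Set X
  isCompact : IsCompact carrier
  exists_chart : ∀ x ∈ carrier, ∃ c : CornerChart n carrier, x ∈ c.chart.source

variable {n} in
/-- The inclusion of the coordinate hyperplane `y j = 0`. -/
def faceIncl (j : Fin (n + 1)) (y : EuclideanSpace ℝ (Fin n)) : Model n :=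
  WithLp.toLp 2 (Fin.insertNth (α := fun _ => ℝ) j 0 y.ofLp)

namespace CornerChart

variable {n} {R : Set X} (c : CornerChart n R)

/-- The part of the chart domain, in coordinates, that belongs to `R`. -/
def domain : Set (Model n) := {y ∈ c.chart.target | ∀ i ∈ c.faces, 0 ≤ y i}

/-- The coordinate frame of the chart at the point with coordinates `y`. -/
def frame (y : Model n) (i : Fin (n + 1)) : TangentSpace 𝓘(ℝ, Model n) (c.chart.symm y) :=
  mfderiv 𝓘(ℝ, Model n) 𝓘(ℝ, Model n) c.chart.symm y (EuclideanSpace.single i (1 : ℝ) : Model n)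

/-- The `j`-th face of `R`, in the coordinates `y i`, `i ≠ j`. -/
def faceDomain (j : Fin (n + 1)) : Set (EuclideanSpace ℝ (Fin n)) := {y | faceIncl j y ∈ c.domain}

/-- The tangent space of the `j`-th face of `R`. -/
def faceTangent (j : Fin (n + 1)) (y : EuclideanSpace ℝ (Fin n)) :
    Submodule ℝ (TangentSpace 𝓘(ℝ, Model n) (c.chart.symm (faceIncl j y))) :=
  Submodule.span ℝ (range fun i : Fin n => c.frame (faceIncl j y) (j.succAbove i))

/-- The coordinate frame of the `j`-th face. -/
def faceFrame (j : Fin (n + 1)) (y : EuclideanSpace ℝ (Fin n)) (i : Fin n) : c.faceTangent j y :=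
  ⟨c.frame (faceIncl j y) (j.succAbove i), Submodule.subset_span (mem_range_self i)⟩

/-- The sign of the coordinate frame with respect to the orientation given by `vol`. -/
def orientationSign (vol : ∀ x : X, FormFiber n (n + 1) x) (y : Model n) : ℝ :=
  SignType.sign (vol (c.chart.symm y) (c.frame y))

end CornerChart

/-- A finite family of charts adapted to `R` with a subordinate partition of unity. -/
structure IntegrationCover (R : Subbody n X) where
  card : ℕ
  chart : Fin card → CornerChart n R.carrier
  weight : SmoothPartitionOfUnity (Fin card) 𝓘(ℝ, Model n) X R.carrier
  subordinate : weight.IsSubordinate fun k => (chart k).chart.source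

variable {n}

instance [IsManifold 𝓘(ℝ, Model n) ∞ X] [T2Space X] [SigmaCompactSpace X] (R : Subbody n X) :
    Nonempty (IntegrationCover n R) := by
  choose c hc using R.exists_chart
  obtain ⟨t, ht⟩ := R.isCompact.elim_nhds_subcover' (fun x hx => (c x hx).chart.source)
    fun x hx => (c x hx).chart.open_source.mem_nhds (hc x hx)
  let e := t.equivFin.symm
  obtain ⟨w, hw⟩ := SmoothPartitionOfUnity.exists_isSubordinate 𝓘(ℝ, Model n)
    R.isCompact.isClosed (fun k => (c (e k).1 (e k).1.2).chart.source)
    (fun k => (c (e k).1 (e k).1.2).chart.open_source) (by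
      intro x hx
      obtain ⟨y, hy, hxy⟩ := mem_iUnion₂.1 (ht hx)
      exact mem_iUnion.2 ⟨e.symm ⟨y, hy⟩, by simpa using hxy⟩)
  exact ⟨⟨t.card, fun k => c (e k).1 (e k).1.2, w, hw⟩⟩

namespace Subbody

variable [IsManifold 𝓘(ℝ, Model n) ∞ X] [T2Space X] [SigmaCompactSpace X]
variable (R : Subbody n X) (vol : ∀ x : X, FormFiber n (n + 1) x)

/-- A chosen cover; the integrals below do not depend on the choice. -/
def cover : IntegrationCover n R := Classical.choice inferInstance

/-- The integral of an `(n + 1)`-form over `R`, where `X` carries the orientation given by `vol`. -/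
def integral (θ : ∀ x : X, FormFiber n (n + 1) x) : ℝ :=
  ∑ k, ∫ y in (R.cover.chart k).domain,
    R.cover.weight k ((R.cover.chart k).chart.symm y) *
      ((R.cover.chart k).orientationSign vol y *
        θ ((R.cover.chart k).chart.symm y) ((R.cover.chart k).frame y))

/-- The integral over the boundary of `R`, with the induced orientation (outward vector first), of a
field `τ` of alternating `n`-forms on the tangent spaces of the faces of `R`. In a chart, the outward
vector at the face `y j = 0` is `-∂ j`, and the frame of the face has the sign `-(-1) ^ j` with respect
to the boundary orientation induced by the orientation of the coordinates. -/
def boundaryIntegral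
    (τ : ∀ (x : X) (H : Submodule ℝ (TangentSpace 𝓘(ℝ, Model n) x)), H [⋀^Fin n]→L[ℝ] ℝ) : ℝ :=
  ∑ k, ∑ j ∈ (R.cover.chart k).faces, ∫ y in (R.cover.chart k).faceDomain j,
    R.cover.weight k ((R.cover.chart k).chart.symm (faceIncl j y)) *
      (-(-1) ^ (j : ℕ) * (R.cover.chart k).orientationSign vol (faceIncl j y) *
        τ _ ((R.cover.chart k).faceTangent j y) ((R.cover.chart k).faceFrame j y))

end Subbody

end Bodies

section Bundles

variable (n : ℕ) {X : Type*} [TopologicalSpace X] [ChartedSpace (Model n) X]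
  [IsManifold 𝓘(ℝ, Model n) ∞ X]
  (F : Type*) [NormedAddCommGroup F] [NormedSpace ℝ F]
  (W : X → Type*) [∀ x, AddCommGroup (W x)] [∀ x, Module ℝ (W x)] [∀ x, TopologicalSpace (W x)]
  [TopologicalSpace (Bundle.TotalSpace F W)] [FiberBundle F W] [VectorBundle ℝ F W]

/-- The module of smooth sections of `W`. -/
abbrev Sections := Cₛ^∞⟮𝓘(ℝ, Model n); F, W⟯

variable {n F W}

instance : SMul (SmoothFun n X) (Sections n F W) where
  smul f s := ⟨fun x => f x • s x, f.contMDiff.smul_section s.contMDiff⟩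

@[simp] theorem sections_smul_apply (f : SmoothFun n X) (s : Sections n F W) (x : X) :
    (f • s) x = f x • s x := rfl

instance : Module (SmoothFun n X) (Sections n F W) where
  one_smul s := by ext x; simp
  mul_smul f g s := by ext x; simp [mul_smul]
  smul_zero f := by ext x; simp
  smul_add f s s' := by ext x; simp
  add_smul f g s := by ext x; simp [add_smul]
  zero_smul s := by ext x; simp

instance : IsScalarTower ℝ (SmoothFun n X) (Sections n F W) where
  smul_assoc c f s := by ext x; simp [mul_smul]

variable (n F W) (r : ℕ)

/-- Body hyper-force fields: smooth sections of `L(J^r W, ⋀^(n+1) T*X)`. -/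
abbrev BodyHyperForce := jetHom (X := X) n (Sections n F W) r (n + 1)
/-- Traction hyper-stress fields: smooth sections of `L(J^r W, ⋀^n T*X)`. -/
abbrev TractionHyperStress := jetHom (X := X) n (Sections n F W) r n
/-- Non-holonomic stress fields: smooth sections of `L(J¹(J^r W), ⋀^(n+1) T*X)`. -/
abbrev NonHolonomicStress := jetHom (X := X) n (jetSections (X := X) n (Sections n F W) r) 1 (n + 1)

/-- A system of hyper-tractions: for each subbody `R` and each tangent space `H` of a face of `R` at a
boundary point `x`, a linear map from the jet space at `x` to the `n`-forms on `H`. The values at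
pairs `(x, H)` that do not belong to the boundary of `R` play no role. -/
abbrev HyperTractionSystem :=
  ∀ (_R : Subbody n X) (x : X) (H : Submodule ℝ (TangentSpace 𝓘(ℝ, Model n) x)),
    Jet n (Sections n F W) r x →ₗ[ℝ] (H [⋀^Fin n]→L[ℝ] ℝ)

variable {n F W r}

/-- The Cauchy formula: on the boundary of each subbody, the hyper-traction is the restriction of the
traction hyper-stress `σ` to vectors that are tangent to the boundary. -/
def CauchyFormula (t : HyperTractionSystem n F W r) (σ : TractionHyperStress n F W r) : Prop :=
  ∀ (R : Subbody n X) (c : CornerChart n R.carrier), ∀ j ∈ c.faces, ∀ y ∈ c.faceDomain j,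
    ∀ u : Jet n (Sections n F W) r (c.chart.symm (faceIncl j y)),
      t R _ (c.faceTangent j y) u =
        (σ.1 _ u).compContinuousLinearMap (c.faceTangent j y).subtypeL

/-- `P` represents the hyper-force system `(b, t)`: for each subbody, the power of `P` equals the power
of the body hyper-force and of the hyper-traction, for all sections of the jet bundle (holonomic or
not). -/
def Represents [T2Space X] [SigmaCompactSpace X] (vol : ∀ x : X, FormFiber n (n + 1) x)
    (P : NonHolonomicStress n F W r) (b : BodyHyperForce n F W r)
    (t : HyperTractionSystem n F W r) : Prop :=
  ∀ (R : Subbody n X) (A : jetSections n (Sections n F W) r),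
    R.integral vol (fun x => P.1 x (jet n 1 x A)) =
      R.integral vol (fun x => b.1 x (A.1 x)) +
        R.boundaryIntegral vol (fun x H => t R x H (A.1 x))

/-- `div P = 𝔡 (p_σ P) - P`. The equation is between linear maps on `J¹(J^r W)`, where a body
hyper-force acts through the projection to `J^r W`. -/
def IsDivergence [T2Space X] (div : NonHolonomicStress n F W r →ₗ[ℝ] BodyHyperForce n F W r) : Prop :=
  ∀ P : NonHolonomicStress n F W r,
    ∃ h : tractionPart n (Sections n F W) r P.1 ∈ TractionHyperStress n F W r,
      ∀ (x : X) (B : Jet n (jetSections n (Sections n F W) r) 1 x),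
        (div P).1 x (value n (Sections n F W) r x B) =
          exteriorJet n ⟨tractionPart n (Sections n F W) r P.1, h⟩ x B - P.1 x B

end Bundles

section Naturality

variable {n : ℕ} {X : Type*} [TopologicalSpace X] [ChartedSpace (Model n) X]
  [IsManifold 𝓘(ℝ, Model n) ∞ X]
  {F : Type*} [NormedAddCommGroup F] [NormedSpace ℝ F]
  {W : X → Type*} [∀ x, AddCommGroup (W x)] [∀ x, Module ℝ (W x)] [∀ x, TopologicalSpace (W x)]
  [TopologicalSpace (Bundle.TotalSpace F W)] [FiberBundle F W] [VectorBundle ℝ F W]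
  {X' : Type*} [TopologicalSpace X'] [ChartedSpace (Model n) X']
  [IsManifold 𝓘(ℝ, Model n) ∞ X']
  {F' : Type*} [NormedAddCommGroup F'] [NormedSpace ℝ F']
  {W' : X' → Type*} [∀ x, AddCommGroup (W' x)] [∀ x, Module ℝ (W' x)]
  [∀ x, TopologicalSpace (W' x)]
  [TopologicalSpace (Bundle.TotalSpace F' W')] [FiberBundle F' W'] [VectorBundle ℝ F' W']
  {r : ℕ} (φ : X ≃ₘ^∞⟮𝓘(ℝ, Model n), 𝓘(ℝ, Model n)⟯ X') (Φ : ∀ x, W x ≃ₗ[ℝ] W' (φ x))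

/-- The section `s'` is the image of `s` under the bundle isomorphism `Φ` over `φ`. -/
def RelatedSections (s : Sections n F W) (s' : Sections n F' W') : Prop :=
  ∀ x, s' (φ x) = Φ x (s x)

/-- The section `A'` of the jet bundle is the image of `A` under the isomorphism of jet bundles induced
by `Φ`. -/
def RelatedJetSections (A : jetSections (X := X) n (Sections n F W) r)
    (A' : jetSections (X := X') n (Sections n F' W') r) : Prop :=
  ∀ (x : X) (s : Sections n F W) (s' : Sections n F' W'), RelatedSections φ Φ s s' →
    A.1 x = jet n r x s → A'.1 (φ x) = jet n r (φ x) s'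

/-- The non-holonomic stress `P` is the pullback of `P'` under `Φ`. -/
def RelatedStresses (P : NonHolonomicStress n F W r) (P' : NonHolonomicStress n F' W' r) : Prop :=
  ∀ (A : jetSections (X := X) n (Sections n F W) r)
    (A' : jetSections (X := X') n (Sections n F' W') r), RelatedJetSections φ Φ A A' → ∀ x : X,
    P.1 x (jet n 1 x A) = (P'.1 (φ x) (jet n 1 (φ x) A')).compContinuousLinearMap
      (mfderiv 𝓘(ℝ, Model n) 𝓘(ℝ, Model n) φ x)

/-- The body hyper-force `b` is the pullback of `b'` under `Φ`. -/
def RelatedForces (b : BodyHyperForce n F W r) (b' : BodyHyperForce n F' W' r) : Prop :=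
  ∀ (A : jetSections (X := X) n (Sections n F W) r)
    (A' : jetSections (X := X') n (Sections n F' W') r), RelatedJetSections φ Φ A A' → ∀ x : X,
    b.1 x (A.1 x) = (b'.1 (φ x) (A'.1 (φ x))).compContinuousLinearMap
      (mfderiv 𝓘(ℝ, Model n) 𝓘(ℝ, Model n) φ x)

end Naturality

end HyperStress
end

noncomputable section
namespace HyperStress

/-! Fix a point `x` and let 𝔪 be the ideal of smooth functions vanishing there. Hadamard's lemma
puts a function with `f x = 0` and `df x = 0` into 𝔪² (`mem_vanishingIdeal_sq`), and a section of
the jet bundle that vanishes at `x` is a sum of multiples `f • B` with `f` in 𝔪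
(`mem_smul_top_of_eval_eq_zero`). Hence, for `f x = 0`, the jet j¹(fA) at `x` depends only on `df x`
and `A x`; it is the vertical element df ⊗ A(x). For a form Θ of top degree α ∧ (v ⌟ Θ) = α(v) Θ, so
the traction p_σ(P) is characterised by df ∧ (p_σ(P)·A) = P·j¹(fA) at every zero `x` of `f`
(`wedgeForm_traction`, `eq_of_wedgeForm_eq`).

By the Leibniz rule the left-hand side is also d(p_σ(P)·fA) at `x`. Therefore d(p_σ(P)·A) − P·j¹A
vanishes at `x` as soon as `A x = 0` (`divPairing_eq_zero`): it is a function of `A x` alone, and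
this function is div P. The operator is of first order because p_σ is linear over smooth functions
and d annihilates, at `x`, the multiples by elements of 𝔪². It is natural because d commutes with
pullback (`dForm_pullbackForm`) and p_σ can be computed in any pair of dual frames
(`tractionPart_eq_sum`).

For the representation of force systems, Stokes' theorem on subbodies (`Subbody.integral_dForm`)
turns the boundary power into ∫ d(σ·A). The global balance then says that the form P·j¹A − b·A −
d(σ·A) has integral zero over every subbody. Small coordinate cubes are subbodies, so the form
itself is zero (`eq_zero_of_integral_eq_zero`). Testing this with fA, where `f x = 0`, leaves
P·j¹(fA) = df ∧ (σ·A), that is p_σ(P) = σ; what then remains is div P + b = 0. All these steps can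
be reversed (`power_eq_iff`).

Stokes' theorem is reduced by a partition of unity v_k to the divergence theorem on an orthant in
each chart. The extra terms dv_k ∧ η add up to zero on the body; since they are integrated in
different charts, a change of variables is needed before they can be added. -/

theorem infty_add_one_le : (∞ : ℕ∞ω) + 1 ≤ ∞ := by
  norm_cast

theorem minSmoothness_two_le_infty : minSmoothness ℝ 2 ≤ (∞ : ℕ∞ω) := by
  rw [minSmoothness_of_isRCLikeNormedField]
  norm_cast

/-! ### Smooth families of alternating forms on the model space. -/

section FlatForms

variable {n m : ℕ}

/-- The values of an alternating form on the tuples of vectors of the standard basis. -/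
def formCoords (n m : ℕ) : (Model n [⋀^Fin m]→L[ℝ] ℝ) →ₗ[ℝ] ((Fin m → Fin (n + 1)) → ℝ) where
  toFun α t := α fun i => EuclideanSpace.single (t i) (1 : ℝ)
  map_add' _ _ := rfl
  map_smul' _ _ := rfl

theorem formCoords_injective : Function.Injective (formCoords n m) := by
  intro α β h
  apply ContinuousAlternatingMap.toAlternatingMap_injective
  refine Module.Basis.ext_alternating (EuclideanSpace.basisFun (Fin (n + 1)) ℝ).toBasis ?_
  intro t _
  simpa [formCoords] using congrFun h t

instance : FiniteDimensional ℝ (Model n [⋀^Fin m]→L[ℝ] ℝ) :=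
  FiniteDimensional.of_injective (formCoords n m) formCoords_injective

theorem exists_formCoords_leftInverse (n m : ℕ) :
    ∃ L : ((Fin m → Fin (n + 1)) → ℝ) →L[ℝ] (Model n [⋀^Fin m]→L[ℝ] ℝ),
      ∀ α, L (formCoords n m α) = α := by
  obtain ⟨g, hg⟩ := LinearMap.exists_leftInverse_of_injective (formCoords n m)
    (LinearMap.ker_eq_bot.2 formCoords_injective)
  exact ⟨LinearMap.toContinuousLinearMap g, fun α => LinearMap.congr_fun hg α⟩

variable {V : Type*} [NormedAddCommGroup V] [NormedSpace ℝ V]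

/-- The space of forms is finite-dimensional, so the coordinates `formCoords` have a continuous
linear left inverse and smoothness can be tested on fixed vectors. -/
theorem contDiffAt_form {α : V → Model n [⋀^Fin m]→L[ℝ] ℝ} {y : V}
    (h : ∀ v : Fin m → Model n, ContDiffAt ℝ ∞ (fun z => α z v) y) : ContDiffAt ℝ ∞ α y := by
  obtain ⟨L, hL⟩ := exists_formCoords_leftInverse n m
  have : α = fun z => L (formCoords n m (α z)) := by simp [hL]
  rw [this]
  exact L.contDiff.contDiffAt.comp y (contDiffAt_pi.2 fun t => h _)

theorem contDiffAt_form_apply {α : V → Model n [⋀^Fin m]→L[ℝ] ℝ} {y : V}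
    (h : ContDiffAt ℝ ∞ α y) (v : Fin m → Model n) : ContDiffAt ℝ ∞ (fun z => α z v) y := by
  have : ContDiff ℝ ∞ (fun α : Model n [⋀^Fin m]→L[ℝ] ℝ => α v) :=
    (LinearMap.toContinuousLinearMap
      ({ toFun := fun α => α v, map_add' := fun _ _ => rfl, map_smul' := fun _ _ => rfl } :
        (Model n [⋀^Fin m]→L[ℝ] ℝ) →ₗ[ℝ] ℝ)).contDiff
  exact this.contDiffAt.comp y h

theorem contDiffAt_form_comp {α : V → Model n [⋀^Fin m]→L[ℝ] ℝ}
    {T : V → Model n →L[ℝ] Model n} {y : V} (h : ContDiffAt ℝ ∞ α y) (hT : ContDiffAt ℝ ∞ T y) :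
    ContDiffAt ℝ ∞ (fun z => (α z).compContinuousLinearMap (T z)) y := by
  obtain ⟨L, hL⟩ := exists_formCoords_leftInverse n m
  refine contDiffAt_form fun v => ?_
  -- Expanding `α z` in the fixed forms `L (Pi.single t 1)` separates the two dependences on `z`:
  -- one is in scalar coefficients, the other in the arguments of a fixed multilinear map.
  have h1 : ∀ z, ((α z).compContinuousLinearMap (T z)) v =
      ∑ t, formCoords n m (α z) t * (L (Pi.single t 1)) (fun i => T z (v i)) := by
    intro z
    have h2 : α z = ∑ t, formCoords n m (α z) t • L (Pi.single t 1) := by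
      rw [← hL (α z)]
      simp only [hL]
      conv_lhs => rw [← hL (α z), pi_eq_sum_univ' (formCoords n m (α z))]
      rw [map_sum]
      refine Finset.sum_congr rfl fun t _ => ?_
      rw [← map_smul]
    conv_lhs => rw [h2]
    simp [ContinuousAlternatingMap.sum_apply, Function.comp_def]
  simp only [h1]
  refine ContDiffAt.sum fun t _ => ContDiffAt.mul (contDiffAt_form_apply h _) ?_
  have h3 : ContDiffAt ℝ ∞ (fun z => fun i => T z (v i)) y :=
    contDiffAt_pi.2 fun i => hT.clm_apply contDiffAt_const
  exact (L (Pi.single t 1)).toContinuousMultilinearMap.contDiff.contDiffAt.comp y h3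

end FlatForms

/-! ### Differential forms and the exterior derivative in arbitrary charts. -/

section ChartForms

variable {n : ℕ} {X : Type*} [TopologicalSpace X] [ChartedSpace (Model n) X] {m : ℕ}

/-- The coordinate expression of a form in a chart. -/
def formIn (θ : ∀ x : X, FormFiber n m x) (e : OpenPartialHomeomorph X (Model n)) (y : Model n) :
    (Model n) [⋀^Fin m]→L[ℝ] ℝ :=
  (θ (e.symm y)).compContinuousLinearMap (mfderiv 𝓘(ℝ, Model n) 𝓘(ℝ, Model n) e.symm y)

theorem formInChart_eq (θ : ∀ x : X, FormFiber n m x) (x₀ : X) :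
    formInChart n θ x₀ = formIn θ (chartAt (Model n) x₀) := by
  ext1 y
  unfold formInChart formIn
  simp only [mfld_simps]
  rfl

variable {e e' : OpenPartialHomeomorph X (Model n)}

theorem mdifferentiableAt_chart (he : e ∈ IsManifold.maximalAtlas 𝓘(ℝ, Model n) ∞ X) {x : X}
    (hx : x ∈ e.source) : MDifferentiableAt 𝓘(ℝ, Model n) 𝓘(ℝ, Model n) e x :=
  (contMDiffAt_of_mem_maximalAtlas he hx).mdifferentiableAt (by simp)

theorem mdifferentiableAt_chart_symm (he : e ∈ IsManifold.maximalAtlas 𝓘(ℝ, Model n) ∞ X)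
    {y : Model n} (hy : y ∈ e.target) :
    MDifferentiableAt 𝓘(ℝ, Model n) 𝓘(ℝ, Model n) e.symm y :=
  (contMDiffAt_symm_of_mem_maximalAtlas he hy).mdifferentiableAt (by simp)

theorem mfderiv_chart_symm_comp (he : e ∈ IsManifold.maximalAtlas 𝓘(ℝ, Model n) ∞ X) {x : X}
    (hx : x ∈ e.source) :
    (mfderiv 𝓘(ℝ, Model n) 𝓘(ℝ, Model n) e.symm (e x)).comp
      (mfderiv 𝓘(ℝ, Model n) 𝓘(ℝ, Model n) e x) = ContinuousLinearMap.id ℝ _ := by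
  rw [← mfderiv_comp (I := 𝓘(ℝ, Model n)) (I' := 𝓘(ℝ, Model n)) (I'' := 𝓘(ℝ, Model n)) x
    (mdifferentiableAt_chart_symm he (e.map_source hx)) (mdifferentiableAt_chart he hx)]
  have : e.symm ∘ e =ᶠ[𝓝 x] id := by
    filter_upwards [e.open_source.mem_nhds hx] with z hz using e.left_inv hz
  rw [this.mfderiv_eq, mfderiv_id]

theorem mfderiv_chart_comp_symm (he : e ∈ IsManifold.maximalAtlas 𝓘(ℝ, Model n) ∞ X)
    {y : Model n} (hy : y ∈ e.target) :
    (mfderiv 𝓘(ℝ, Model n) 𝓘(ℝ, Model n) e (e.symm y)).comp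
      (mfderiv 𝓘(ℝ, Model n) 𝓘(ℝ, Model n) e.symm y) = ContinuousLinearMap.id ℝ _ := by
  rw [← mfderiv_comp (I := 𝓘(ℝ, Model n)) (I' := 𝓘(ℝ, Model n)) (I'' := 𝓘(ℝ, Model n)) y
    (mdifferentiableAt_chart he (e.map_target hy)) (mdifferentiableAt_chart_symm he hy)]
  have : e ∘ e.symm =ᶠ[𝓝 y] id := by
    filter_upwards [e.open_target.mem_nhds hy] with z hz using e.right_inv hz
  rw [this.mfderiv_eq, mfderiv_id]

theorem contDiffAt_transition (he : e ∈ IsManifold.maximalAtlas 𝓘(ℝ, Model n) ∞ X)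
    (he' : e' ∈ IsManifold.maximalAtlas 𝓘(ℝ, Model n) ∞ X) {y : Model n} (hy : y ∈ e.target)
    (hy' : e.symm y ∈ e'.source) : ContDiffAt ℝ ∞ (e' ∘ e.symm) y := by
  rw [← contMDiffAt_iff_contDiffAt]
  exact (contMDiffAt_of_mem_maximalAtlas he' hy').comp y (contMDiffAt_symm_of_mem_maximalAtlas he hy)

theorem formIn_transition (he : e ∈ IsManifold.maximalAtlas 𝓘(ℝ, Model n) ∞ X)
    (he' : e' ∈ IsManifold.maximalAtlas 𝓘(ℝ, Model n) ∞ X) (θ : ∀ x : X, FormFiber n m x)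
    {y : Model n} (hy : y ∈ e.target) (hy' : e.symm y ∈ e'.source) :
    formIn θ e y = (formIn θ e' ((e' ∘ e.symm) y)).compContinuousLinearMap
      (fderiv ℝ (e' ∘ e.symm) y) := by
  have h1 : fderiv ℝ (e' ∘ e.symm) y =
      (mfderiv 𝓘(ℝ, Model n) 𝓘(ℝ, Model n) e' (e.symm y)).comp
        (mfderiv 𝓘(ℝ, Model n) 𝓘(ℝ, Model n) e.symm y) := by
    rw [← mfderiv_eq_fderiv]
    exact mfderiv_comp (I := 𝓘(ℝ, Model n)) (I' := 𝓘(ℝ, Model n)) (I'' := 𝓘(ℝ, Model n)) y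
      (mdifferentiableAt_chart he' hy') (mdifferentiableAt_chart_symm he hy)
  have h2 := mfderiv_chart_symm_comp he' hy'
  rw [h1]
  -- The points `e.symm y` and `e'.symm (e' (e.symm y))` are only propositionally equal. Reading
  -- every fibre as forms on the model space allows the equality to be substituted.
  have key : ∀ (α : X → (Model n) [⋀^Fin m]→L[ℝ] ℝ) (x x' : X) (_ : x' = x)
      (A B C : Model n →L[ℝ] Model n), A.comp B = ContinuousLinearMap.id ℝ _ →
      (α x).compContinuousLinearMap C =
        ((α x').compContinuousLinearMap A).compContinuousLinearMap (B.comp C) := by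
    rintro α x _ rfl A B C h
    ext v
    have h' : ∀ w, A (B w) = w := fun w => DFunLike.congr_fun h w
    simp [Function.comp_def, h']
  exact key θ _ _ (e'.left_inv hy') _ _ _ h2

variable [IsManifold 𝓘(ℝ, Model n) ∞ X]

/-- Membership in `smoothForms` speaks of preferred charts only; the transition map carries
smoothness to every chart of the maximal atlas, in particular to the charts adapted to a body. -/
theorem contDiffAt_formIn {θ : ∀ x : X, FormFiber n m x} (hθ : θ ∈ smoothForms n X m)
    (he : e ∈ IsManifold.maximalAtlas 𝓘(ℝ, Model n) ∞ X) {y : Model n} (hy : y ∈ e.target) :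
    ContDiffAt ℝ ∞ (formIn θ e) y := by
  set e' := chartAt (Model n) (e.symm y)
  have he' : e' ∈ IsManifold.maximalAtlas 𝓘(ℝ, Model n) ∞ X := IsManifold.chart_mem_maximalAtlas _
  have hy' : e.symm y ∈ e'.source := mem_chart_source _ _
  have hT := contDiffAt_transition he he' hy hy'
  have h1 : formIn θ e =ᶠ[𝓝 y] fun z => (formIn θ e' ((e' ∘ e.symm) z)).compContinuousLinearMap
      (fderiv ℝ (e' ∘ e.symm) z) := by
    filter_upwards [(e.symm.isOpen_inter_preimage e'.open_source).mem_nhds ⟨hy, hy'⟩] with z hz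
    exact formIn_transition he he' θ hz.1 hz.2
  refine ContDiffAt.congr_of_eventuallyEq ?_ h1
  refine contDiffAt_form_comp ?_ (hT.fderiv_right infty_add_one_le)
  have h2 := hθ (e.symm y)
  rw [formInChart_eq, extChartAt_target] at h2
  simp only [mfld_simps] at h2
  exact (h2.contDiffAt (e'.open_target.mem_nhds (e'.map_source hy'))).comp y hT

theorem mem_smoothForms_of_formIn {θ : ∀ x : X, FormFiber n m x}
    (h : ∀ x : X, ∃ e ∈ IsManifold.maximalAtlas 𝓘(ℝ, Model n) ∞ X, x ∈ e.source ∧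
      ContDiffAt ℝ ∞ (formIn θ e) (e x)) : θ ∈ smoothForms n X m := by
  intro x₀ y hy
  apply ContDiffAt.contDiffWithinAt
  rw [formInChart_eq]
  simp only [mfld_simps] at hy
  set e := chartAt (Model n) x₀
  have he : e ∈ IsManifold.maximalAtlas 𝓘(ℝ, Model n) ∞ X := IsManifold.chart_mem_maximalAtlas _
  obtain ⟨e', he', hy', h'⟩ := h (e.symm y)
  have hT := contDiffAt_transition he he' hy hy'
  have h1 : formIn θ e =ᶠ[𝓝 y] fun z => (formIn θ e' ((e' ∘ e.symm) z)).compContinuousLinearMap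
      (fderiv ℝ (e' ∘ e.symm) z) := by
    filter_upwards [(e.symm.isOpen_inter_preimage e'.open_source).mem_nhds ⟨hy, hy'⟩] with z hz
    exact formIn_transition he he' θ hz.1 hz.2
  refine ContDiffAt.congr_of_eventuallyEq ?_ h1
  exact contDiffAt_form_comp (ContDiffAt.comp (g := formIn θ e') y h' hT) (hT.fderiv_right infty_add_one_le)

/-- `dForm` changes its chart from point to point. Naturality of `extDeriv` under the transition to
the preferred chart at `e.symm y` shows that one chart computes it at all its points; without this
its smoothness would not be visible. -/
theorem formIn_dForm {θ : ∀ x : X, FormFiber n m x} (hθ : θ ∈ smoothForms n X m)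
    (he : e ∈ IsManifold.maximalAtlas 𝓘(ℝ, Model n) ∞ X) {y : Model n} (hy : y ∈ e.target) :
    formIn (dForm n θ) e y = extDeriv (formIn θ e) y := by
  set e' := chartAt (Model n) (e.symm y) with hee'
  have he' : e' ∈ IsManifold.maximalAtlas 𝓘(ℝ, Model n) ∞ X := IsManifold.chart_mem_maximalAtlas _
  have hy' : e.symm y ∈ e'.source := mem_chart_source _ _
  have hT := contDiffAt_transition he he' hy hy'
  have h1 : formIn θ e =ᶠ[𝓝 y] fun z => (formIn θ e' ((e' ∘ e.symm) z)).compContinuousLinearMap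
      (fderiv ℝ (e' ∘ e.symm) z) := by
    filter_upwards [(e.symm.isOpen_inter_preimage e'.open_source).mem_nhds ⟨hy, hy'⟩] with z hz
    exact formIn_transition he he' θ hz.1 hz.2
  have h2 : DifferentiableAt ℝ (formIn θ e') ((e' ∘ e.symm) y) :=
    (contDiffAt_formIn hθ he' (e'.map_source hy')).differentiableAt (by simp)
  rw [h1.extDeriv_eq, extDeriv_pullback h2 hT minSmoothness_two_le_infty]
  have h3 : fderiv ℝ (e' ∘ e.symm) y =
      (mfderiv 𝓘(ℝ, Model n) 𝓘(ℝ, Model n) e' (e.symm y)).comp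
        (mfderiv 𝓘(ℝ, Model n) 𝓘(ℝ, Model n) e.symm y) := by
    rw [← mfderiv_eq_fderiv]
    exact mfderiv_comp (I := 𝓘(ℝ, Model n)) (I' := 𝓘(ℝ, Model n)) (I'' := 𝓘(ℝ, Model n)) y
      (mdifferentiableAt_chart he' hy') (mdifferentiableAt_chart_symm he hy)
  rw [h3]
  unfold formIn dForm
  rw [formInChart_eq]
  simp only [mfld_simps]
  rfl

theorem dForm_mem_smoothForms {θ : ∀ x : X, FormFiber n m x} (hθ : θ ∈ smoothForms n X m) :
    dForm n θ ∈ smoothForms n X (m + 1) := by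
  refine mem_smoothForms_of_formIn fun x => ⟨chartAt (Model n) x, IsManifold.chart_mem_maximalAtlas _,
    mem_chart_source _ _, ?_⟩
  set e := chartAt (Model n) x
  have he : e ∈ IsManifold.maximalAtlas 𝓘(ℝ, Model n) ∞ X := IsManifold.chart_mem_maximalAtlas _
  have hx : e x ∈ e.target := e.map_source (mem_chart_source _ _)
  have h1 : formIn (dForm n θ) e =ᶠ[𝓝 (e x)] extDeriv (formIn θ e) := by
    filter_upwards [e.open_target.mem_nhds hx] with z hz using formIn_dForm hθ he hz
  refine ContDiffAt.congr_of_eventuallyEq ?_ h1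
  exact (ContinuousAlternatingMap.alternatizeUncurryFinCLM ℝ (Model n) ℝ).contDiff.contDiffAt.comp _
    ((contDiffAt_formIn hθ he hx).fderiv_right infty_add_one_le)

end ChartForms

end HyperStress
end

noncomputable section
namespace HyperStress

set_option linter.unusedSectionVars false

/-! ### Hadamard's lemma on the model space. -/

section Hadamard

theorem contDiff_mul_of_tsupport_subset {V : Type*} [NormedAddCommGroup V] [NormedSpace ℝ V]
    {χ g : V → ℝ} {U : Set V} (hU : IsOpen U) (hχ : ContDiff ℝ ∞ χ) (hs : tsupport χ ⊆ U)
    (hg : ContDiffOn ℝ ∞ g U) : ContDiff ℝ ∞ (fun y => χ y * g y) := by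
  rw [contDiff_iff_contDiffAt]
  intro y
  by_cases hy : y ∈ U
  · exact hχ.contDiffAt.mul (hg.contDiffAt (hU.mem_nhds hy))
  · have : (fun y => χ y * g y) =ᶠ[𝓝 y] fun _ => 0 := by
      filter_upwards [(isClosed_tsupport χ).isOpen_compl.mem_nhds fun h => hy (hs h)] with z hz
      rw [image_eq_zero_of_notMem_tsupport hz, zero_mul]
    exact contDiffAt_const.congr_of_eventuallyEq this

theorem exists_contDiffBump_tsupport_subset {V : Type*} [NormedAddCommGroup V] [NormedSpace ℝ V]
    [FiniteDimensional ℝ V] {c : V} {U : Set V} (hU : U ∈ 𝓝 c) :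
    ∃ χ : ContDiffBump c, tsupport χ ⊆ U := by
  obtain ⟨ε, hε, h⟩ := Metric.nhds_basis_closedBall.mem_iff.1 hU
  exact ⟨⟨ε / 2, ε, half_pos hε, half_lt_self hε⟩, by rwa [ContDiffBump.tsupport_eq]⟩

variable {V : Type*} [NormedAddCommGroup V] [NormedSpace ℝ V] {G : Type*} [NormedAddCommGroup G]
  [NormedSpace ℝ G] [CompleteSpace G]

/-- The integral is the value at `0` of the convolution of the indicator of (0, 1] with a smooth,
compactly supported function depending smoothly on the parameter `y`, so smoothness of such
convolutions applies. -/
theorem contDiff_integral_unitInterval_smul {g : V → G} (hg : ContDiff ℝ ∞ g) :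
    ContDiff ℝ ∞ fun y => ∫ t in (0 : ℝ)..1, g (t • y) := by
  -- The cutoff provides compact support. It equals 1 on [-2, 2], which contains the points `-t`, `0
  -- < t ≤ 1`, at which the convolution at `0` evaluates it.
  let χ : ContDiffBump (0 : ℝ) := ⟨2, 3, by norm_num, by norm_num⟩
  have h := contDiffOn_convolution_right_with_param (𝕜 := ℝ) (μ := (volume : Measure ℝ)) (n := ⊤)
    (f := indicator (Ioc (0 : ℝ) 1) fun _ => (1 : ℝ)) (ContinuousLinearMap.lsmul ℝ ℝ)
    (g := fun (p : V) (x : ℝ) => χ x • g ((-x) • p)) (s := univ) (k := tsupport χ) isOpen_univ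
    χ.hasCompactSupport (fun p x _ hx => by simp [image_eq_zero_of_notMem_tsupport hx])
    ((integrable_indicator_iff measurableSet_Ioc).2 (by simp)).locallyIntegrable
    (by
      apply ContDiff.contDiffOn
      exact (χ.contDiff.comp contDiff_snd).smul
        (hg.comp (contDiff_snd.neg.smul contDiff_fst)))
  have h' : ContDiff ℝ ∞ (fun q : V × ℝ => (MeasureTheory.convolution
      (indicator (Ioc (0 : ℝ) 1) fun _ => (1 : ℝ))
      (fun x => χ x • g ((-x) • q.1)) (ContinuousLinearMap.lsmul ℝ ℝ) volume) q.2) := by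
    rw [← contDiffOn_univ]
    simpa using h
  convert h'.comp (contDiff_id.prodMk (contDiff_const (c := (0 : ℝ)))) using 1
  funext y
  symm
  simp only [Function.comp, id, MeasureTheory.convolution, ContinuousLinearMap.lsmul_apply, zero_sub,
    neg_neg]
  rw [intervalIntegral.integral_of_le zero_le_one, ← integral_indicator measurableSet_Ioc]
  congr 1
  ext t
  by_cases ht : t ∈ Ioc (0 : ℝ) 1
  · have : χ (-t) = 1 := χ.one_of_mem_closedBall (by
      rw [mem_closedBall_zero_iff, norm_neg, Real.norm_eq_abs, abs_of_pos ht.1]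
      exact ht.2.trans (by norm_num [χ]))
    simp [ht, this]
  · simp [ht]

/-- Integrate the derivative of `g` along the segment from `c` to `y` and split it into partial
derivatives; the averaged partial derivatives are the `h i`. -/
theorem exists_contDiff_sum_mul {n : ℕ} {g : Model n → ℝ} (hg : ContDiff ℝ ∞ g) (c : Model n)
    (h0 : g c = 0) : ∃ h : Fin (n + 1) → Model n → ℝ, (∀ i, ContDiff ℝ ∞ (h i)) ∧
      (∀ i, h i c = fderiv ℝ g c (EuclideanSpace.single i 1)) ∧
      ∀ y, g y = ∑ i, (y i - c i) * h i y := by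
  refine ⟨fun i y => ∫ t in (0 : ℝ)..1,
    fderiv ℝ g (c + t • (y - c)) (EuclideanSpace.single i (1 : ℝ)), ?_, ?_, ?_⟩
  · intro i
    have h1 : ContDiff ℝ ∞ fun z : Model n => fderiv ℝ g (c + z) (EuclideanSpace.single i (1 : ℝ)) :=
      ((hg.fderiv_right infty_add_one_le).comp (contDiff_const.add contDiff_id)).clm_apply
        contDiff_const
    exact (contDiff_integral_unitInterval_smul h1).comp (contDiff_id.sub contDiff_const)
  · intro i
    simp
  · intro y
    have hd : ∀ t : ℝ, HasDerivAt (fun t : ℝ => g (c + t • (y - c)))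
        (fderiv ℝ g (c + t • (y - c)) (y - c)) t := by
      intro t
      have h1 : HasDerivAt (fun t : ℝ => c + t • (y - c)) (y - c) t := by
        simpa using ((hasDerivAt_id t).smul_const (y - c)).const_add c
      exact ((hg.differentiable (by simp)) _).hasFDerivAt.comp_hasDerivAt t h1
    have hc : ∀ v : Model n, Continuous fun t : ℝ => fderiv ℝ g (c + t • (y - c)) v := by
      intro v
      exact ((hg.continuous_fderiv (by simp)).comp (by fun_prop)).clm_apply continuous_const
    have h2 := intervalIntegral.integral_eq_sub_of_hasDerivAt (a := 0) (b := 1)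
      (fun t _ => hd t) ((hc _).intervalIntegrable _ _)
    simp only [one_smul, zero_smul, add_zero, add_sub_cancel, h0, sub_zero] at h2
    rw [← h2]
    simp only [← intervalIntegral.integral_const_mul]
    rw [← intervalIntegral.integral_finsetSum]
    · congr 1
      ext t
      have h3 : y - c = ∑ i, (y i - c i) • EuclideanSpace.single i (1 : ℝ) := by
        have := (EuclideanSpace.basisFun (Fin (n + 1)) ℝ).sum_repr (y - c)
        simpa using this.symm
      conv_lhs => rw [h3, map_sum]
      simp only [map_smul, smul_eq_mul, ← h3]
    · intro i _
      exact ((hc _).const_mul _).intervalIntegrable _ _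

end Hadamard

/-! ### Bump functions and the powers of the vanishing ideal. -/

section Bump

variable {n : ℕ} {X : Type*} [TopologicalSpace X] [ChartedSpace (Model n) X] [T2Space X]
  [IsManifold 𝓘(ℝ, Model n) ∞ X]

theorem exists_smoothFun_eventuallyEq {U : Set X} (hU : IsOpen U) {x : X} (hx : x ∈ U) {g : X → ℝ}
    (hg : ContMDiffOn 𝓘(ℝ, Model n) 𝓘(ℝ) ∞ g U) :
    ∃ f : SmoothFun n X, (⇑f =ᶠ[𝓝 x] g) ∧ ∀ y ∉ U, f y = 0 := by
  obtain ⟨b, hb⟩ := (SmoothBumpFunction.nhds_basis_tsupport (I := 𝓘(ℝ, Model n)) x).mem_iff.1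
    (hU.mem_nhds hx)
  refine ⟨⟨fun y => b y * g y, ?_⟩, ?_, ?_⟩
  · intro y
    by_cases hy : y ∈ U
    · exact b.contMDiff.contMDiffAt.mul (hg.contMDiffAt (hU.mem_nhds hy))
    · have : (fun y => b y * g y) =ᶠ[𝓝 y] fun _ => 0 := by
        filter_upwards [(isClosed_tsupport b).isOpen_compl.mem_nhds fun h => hy (hb.2 h)] with z hz
        rw [image_eq_zero_of_notMem_tsupport hz, zero_mul]
      exact contMDiffAt_const.congr_of_eventuallyEq this
  · filter_upwards [b.eventuallyEq_one] with y hy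
    change b y * g y = g y
    rw [hy]
    simp
  · intro y hy
    change b y * g y = 0
    rw [image_eq_zero_of_notMem_tsupport fun h => hy (hb.2 h), zero_mul]

theorem exists_smoothFun_bump {U : Set X} {x : X} (hU : U ∈ 𝓝 x) :
    ∃ f : SmoothFun n X, (⇑f =ᶠ[𝓝 x] fun _ => 1) ∧ ∀ y ∉ U, f y = 0 := by
  obtain ⟨V, hVU, hV, hx⟩ := mem_nhds_iff.1 hU
  obtain ⟨f, h1, h2⟩ := exists_smoothFun_eventuallyEq (n := n) hV hx (g := fun _ => 1) contMDiffOn_const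
  exact ⟨f, h1, fun y hy => h2 y fun h => hy (hVU h)⟩

/-- The complement of a bump function that is supported where `u` vanishes acts on `u` trivially. -/
theorem exists_mem_vanishingIdeal_of_eventually {x : X} {p : X → Prop} (hp : ∀ᶠ y in 𝓝 x, p y) :
    ∃ f ∈ vanishingIdeal n x, ∀ y, ¬ p y → f y = 1 := by
  obtain ⟨f, h1, h2⟩ := exists_smoothFun_bump (n := n) hp
  refine ⟨1 - f, ?_, fun y hy => ?_⟩
  · rw [mem_vanishingIdeal]
    simp [h1.self_of_nhds]
  · simp [h2 y hy]

/-- Take `g` in the ideal that equals 1 wherever `f` is nonzero; then `f = g ^ k * f`. -/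
theorem mem_vanishingIdeal_pow_of_eventuallyEq {x : X} {f : SmoothFun n X}
    (h : ∀ᶠ y in 𝓝 x, f y = 0) (k : ℕ) : f ∈ vanishingIdeal n x ^ k := by
  obtain ⟨g, hg, hg1⟩ := exists_mem_vanishingIdeal_of_eventually (n := n) h
  have : f = g ^ k * f := by
    ext y
    by_cases hy : f y = 0
    · simp [hy]
    · simp [hg1 y hy]
  rw [this]
  exact Ideal.mul_mem_right _ _ (Ideal.pow_mem_pow hg k)

theorem contMDiffOn_comp_chart {e : OpenPartialHomeomorph X (Model n)}
    (he : e ∈ IsManifold.maximalAtlas 𝓘(ℝ, Model n) ∞ X) {h : Model n → ℝ} (hh : ContDiff ℝ ∞ h) :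
    ContMDiffOn 𝓘(ℝ, Model n) 𝓘(ℝ) ∞ (fun z => h (e z)) e.source :=
  hh.contMDiff.comp_contMDiffOn (contMDiffOn_of_mem_maximalAtlas he)

theorem contDiffOn_smoothFun_chart_symm {e : OpenPartialHomeomorph X (Model n)}
    (he : e ∈ IsManifold.maximalAtlas 𝓘(ℝ, Model n) ∞ X) (f : SmoothFun n X) :
    ContDiffOn ℝ ∞ (fun y => f (e.symm y)) e.target := by
  rw [← contMDiffOn_iff_contDiffOn]
  exact f.contMDiff.comp_contMDiffOn (contMDiffOn_symm_of_mem_maximalAtlas he)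

/-- In a chart Hadamard's lemma writes `f` as a sum of products of a centred coordinate and a
function whose value at the centre is a partial derivative of `f`, here zero. The factors are
extended to all of `X` by bump functions; this changes `f` only by a function that vanishes near
`x`, which lies in every power of the ideal. -/
theorem mem_vanishingIdeal_sq {x : X} {f : SmoothFun n X} (h0 : f x = 0)
    (h1 : mfderiv 𝓘(ℝ, Model n) 𝓘(ℝ) f x = 0) : f ∈ vanishingIdeal n x ^ 2 := by
  set e := chartAt (Model n) x
  have he : e ∈ IsManifold.maximalAtlas 𝓘(ℝ, Model n) ∞ X := IsManifold.chart_mem_maximalAtlas _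
  have hx : x ∈ e.source := mem_chart_source _ _
  obtain ⟨χ, hχ⟩ := exists_contDiffBump_tsupport_subset
    (e.open_target.mem_nhds (e.map_source hx))
  let g : Model n → ℝ := fun y => χ y * f (e.symm y)
  have hg : ContDiff ℝ ∞ g := contDiff_mul_of_tsupport_subset e.open_target χ.contDiff hχ
    (contDiffOn_smoothFun_chart_symm he f)
  have hgf : g =ᶠ[𝓝 (e x)] f ∘ e.symm := by
    filter_upwards [χ.eventuallyEq_one] with y hy
    simp [g, hy]
  obtain ⟨h, hh, hhc, hsum⟩ := exists_contDiff_sum_mul hg (e x)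
    (by simp [hgf.self_of_nhds, e.left_inv hx, h0])
  have hz : fderiv ℝ g (e x) = 0 := by
    rw [hgf.fderiv_eq, ← mfderiv_eq_fderiv]
    have h2 : mfderiv 𝓘(ℝ, Model n) 𝓘(ℝ) f (e.symm (e x)) = 0 := by
      rw [e.left_inv hx]; exact h1
    rw [mfderiv_comp (I' := 𝓘(ℝ, Model n)) _ (f.contMDiff.mdifferentiableAt (by simp))
      (mdifferentiableAt_chart_symm he (e.map_source hx)), h2]
    exact ContinuousLinearMap.zero_comp _
  choose H hH _ using fun i => exists_smoothFun_eventuallyEq e.open_source hx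
    (contMDiffOn_comp_chart he (hh i))
  choose N hN _ using fun i : Fin (n + 1) => exists_smoothFun_eventuallyEq e.open_source hx
    (contMDiffOn_comp_chart he (h := fun y => y i - (e x) i)
      (((EuclideanSpace.proj i : Model n →L[ℝ] ℝ).contDiff).sub contDiff_const))
  have hmem : ∑ i, N i * H i ∈ vanishingIdeal n x ^ 2 := by
    refine Ideal.sum_mem _ fun i _ => ?_
    rw [pow_two]
    refine Ideal.mul_mem_mul ?_ ?_
    · rw [mem_vanishingIdeal, (hN i).self_of_nhds]
      exact sub_self _
    · rw [mem_vanishingIdeal, (hH i).self_of_nhds]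
      simp [hhc, hz]
  have hdiff : f - ∑ i, N i * H i ∈ vanishingIdeal n x ^ 2 := by
    refine mem_vanishingIdeal_pow_of_eventuallyEq ?_ 2
    have hc := (e.continuousAt hx).tendsto.eventually hgf
    filter_upwards [hc, e.open_source.mem_nhds hx, eventually_all.2 hN, eventually_all.2 hH]
      with y hy hys hNy hHy
    have h3 : (∑ i, N i * H i : SmoothFun n X) y = ∑ i, N i y * H i y := by
      rw [← ContMDiffMap.coeFnAddMonoidHom_apply, map_sum]
      simp
    have h4 : f y = g (e y) := by rw [hy, Function.comp, e.left_inv hys]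
    rw [ContMDiffMap.coe_sub, Pi.sub_apply, h3, h4, hsum (e y)]
    simp [hNy, hHy]
  simpa using add_mem hdiff hmem

end Bump

end HyperStress
end

noncomputable section
namespace HyperStress

set_option linter.unusedSectionVars false

/-! ### Sections of the jet bundle at a point and vertical elements. -/

section Jets

variable {n : ℕ} {X : Type*} [TopologicalSpace X] [ChartedSpace (Model n) X] [T2Space X]
  [IsManifold 𝓘(ℝ, Model n) ∞ X]
variable {M : Type*} [AddCommGroup M] [Module (SmoothFun n X) M] [Module ℝ M]
  [IsScalarTower ℝ (SmoothFun n X) M] {r : ℕ}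

theorem jet_surjective (x : X) : Function.Surjective (jet n (M := M) r x) :=
  Submodule.mkQ_surjective _

@[simp] theorem value_jet (x : X) (A : jetSections (X := X) n M r) :
    value n M r x (jet n 1 x A) = A.1 x := rfl

theorem smoothFun_sum_smul_apply {N : ℕ} (f : Fin N → SmoothFun n X)
    (A : Fin N → jetSections (X := X) n M r) (x : X) :
    (∑ i, f i • A i).1 x = ∑ i, f i x • (A i).1 x := by
  rw [Submodule.coe_sum, Finset.sum_apply]
  rfl

theorem jetSections_sub_algebraMap_smul (f : SmoothFun n X) (c : ℝ)
    (A : jetSections (X := X) n M r) :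
    (f - algebraMap ℝ (SmoothFun n X) c) • A = f • A - c • A := by
  ext y
  rw [Submodule.coe_sub, Pi.sub_apply, jetSections_smul_apply, jetSections_smul_apply,
    ContMDiffMap.coe_sub, Pi.sub_apply, sub_smul]
  rfl

/-- Near `x` the section `A` is a combination `B` of prolongations. With `s₀` the combination with
coefficients frozen at `x`, split `A = (A - B) + (B - j^r s₀) + j^r s₀`. The first term vanishes
near `x`, the second has coefficients `f i - f i x`, and in the third `s₀` vanishes at `x` to order
`r`, so that `prolong_mem` applies. This is the converse of `eval_eq_zero_of_mem`. -/
theorem mem_smul_top_of_eval_eq_zero {x : X} {A : jetSections (X := X) n M r} (h : A.1 x = 0) :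
    A ∈ (vanishingIdeal n x • ⊤ : Submodule (SmoothFun n X) (jetSections (X := X) n M r)) := by
  obtain ⟨N, f, s, hs⟩ := A.2 x
  obtain ⟨g, hg, hg1⟩ := exists_mem_vanishingIdeal_of_eventually (n := n) hs
  set B : jetSections (X := X) n M r := ∑ i, f i • prolong n r (s i) with hB
  have hBx : ∀ y, B.1 y = ∑ i, f i y • jet n r y (s i) := fun y => smoothFun_sum_smul_apply _ _ y
  have h1 : A - B = g • (A - B) := by
    ext y
    rw [jetSections_smul_apply]
    by_cases hy : A.1 y = ∑ i, f i y • jet n r y (s i)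
    · have : (A - B).1 y = 0 := by
        rw [Submodule.coe_sub, Pi.sub_apply, hBx, hy, sub_self]
      rw [this, smul_zero]
    · rw [hg1 y hy, one_smul]
  have h2 : A - B ∈ (vanishingIdeal n x • ⊤ :
      Submodule (SmoothFun n X) (jetSections (X := X) n M r)) := by
    rw [h1]
    exact Submodule.smul_mem_smul hg trivial
  set s₀ : M := ∑ i, f i x • s i
  have h3 : B - prolong n r s₀ = ∑ i, (f i - algebraMap ℝ (SmoothFun n X) (f i x)) •
      prolong n r (s i) := by
    rw [hB, map_sum, ← Finset.sum_sub_distrib]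
    refine Finset.sum_congr rfl fun i _ => ?_
    rw [map_smul, jetSections_sub_algebraMap_smul]
  have h4 : B - prolong n r s₀ ∈ (vanishingIdeal n x • ⊤ :
      Submodule (SmoothFun n X) (jetSections (X := X) n M r)) := by
    rw [h3]
    refine Submodule.sum_mem _ fun i _ => Submodule.smul_mem_smul ?_ trivial
    rw [mem_vanishingIdeal]
    exact sub_self (f i x)
  have h5 : prolong n r s₀ ∈ (vanishingIdeal n x • ⊤ :
      Submodule (SmoothFun n X) (jetSections (X := X) n M r)) := by
    refine prolong_mem n r ((jet_eq_zero_iff n r x s₀).1 ?_)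
    rw [← h, hs.self_of_nhds, map_sum]
    simp only [map_smul]
  have := add_mem (add_mem h2 h4) h5
  simpa using this

/-- In `f • A - g • B = (f - g) • A + g • (A - B)` the factor `f - g` lies in the square of the
ideal, and in the second term both `g` and `A - B` vanish at `x`. -/
theorem jet_one_smul_congr {x : X} {f g : SmoothFun n X} {A B : jetSections (X := X) n M r}
    (hf : f x = 0) (hg : g x = 0)
    (hfg : mfderiv 𝓘(ℝ, Model n) 𝓘(ℝ) f x = mfderiv 𝓘(ℝ, Model n) 𝓘(ℝ) g x)
    (hAB : A.1 x = B.1 x) : jet n 1 x (f • A) = jet n 1 x (g • B) := by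
  rw [← sub_eq_zero, ← map_sub]
  have h : f • A - g • B = (f - g) • A + g • (A - B) := by
    ext y
    simp [sub_smul, smul_sub]
  rw [h, jet_eq_zero_iff]
  refine add_mem ?_ ?_
  · refine Submodule.smul_mem_smul (mem_vanishingIdeal_sq (by simp [hf, hg]) ?_) trivial
    have h1 := (f.contMDiff.mdifferentiableAt (x := x) (by simp)).hasMFDerivAt
    have h2 := (g.contMDiff.mdifferentiableAt (x := x) (by simp)).hasMFDerivAt
    rw [hfg] at h1
    exact (h1.sub h2).mfderiv.trans (sub_self _)
  · rw [vanishing, pow_succ, pow_one, ← smul_eq_mul, Submodule.smul_assoc]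
    exact Submodule.smul_mem_smul ((mem_vanishingIdeal n).2 hg)
      (mem_smul_top_of_eval_eq_zero (by simp [hAB]))

/-- Frees `vertical` from the function and the holonomic representative chosen in its definition:
any function with the right 1-jet and any section with the right value will do. -/
theorem vertical_apply {x : X} {α : TangentSpace 𝓘(ℝ, Model n) x →L[ℝ] ℝ} {f : SmoothFun n X}
    (hf : f x = 0) (hα : mfderiv 𝓘(ℝ, Model n) 𝓘(ℝ) f x = α) (A : jetSections (X := X) n M r) :
    vertical n M r x α (A.1 x) = jet n 1 x (f • A) := by
  obtain ⟨s, hs⟩ := jet_surjective x (A.1 x)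
  rw [← hs]
  change jet n 1 x (smoothFunOfCovector n x α • prolong n r s) = _
  have h := (exists_smoothFun_mfderiv_eq n x α).choose_spec
  exact jet_one_smul_congr h.1 hf (h.2.trans hα.symm) hs

end Jets

/-! ### The traction hyper-stress in arbitrary frames and its smoothness. -/

section Traction

variable {n : ℕ} {X : Type*} [TopologicalSpace X] [ChartedSpace (Model n) X]

theorem contract_apply {V : Type*} [AddCommGroup V] [Module ℝ V] [TopologicalSpace V] {m : ℕ}
    (v : V) (θ : V [⋀^Fin (m + 1)]→L[ℝ] ℝ) (w : Fin m → V) :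
    contract v θ w = θ (Matrix.vecCons v w) := rfl

theorem contract_sum_smul {V ι : Type*} [AddCommGroup V] [Module ℝ V] [TopologicalSpace V] {m : ℕ}
    (s : Finset ι) (c : ι → ℝ) (v : ι → V) (θ : V [⋀^Fin (m + 1)]→L[ℝ] ℝ) :
    contract (∑ i ∈ s, c i • v i) θ = ∑ i ∈ s, c i • contract (v i) θ := by
  ext w
  have h : ∀ u : V, contract u θ w = (θ.toAlternatingMap.curryLeft u) w := fun _ => rfl
  rw [h, ContinuousAlternatingMap.sum_apply, map_sum]
  simp only [map_smul]
  exact map_sum (({ toFun := fun α => α w, map_add' := fun _ _ => rfl, map_smul' := fun _ _ => rfl } :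
    (V [⋀^Fin m]→ₗ[ℝ] ℝ) →ₗ[ℝ] ℝ)) (fun i => c i • θ.toAlternatingMap.curryLeft (v i)) s

variable [T2Space X] [IsManifold 𝓘(ℝ, Model n) ∞ X]
variable {m : ℕ}

variable (n) in
/-- The differential of a real function, as a linear form on the model space. -/
def diffAt (f : X → ℝ) (x : X) : Model n →L[ℝ] ℝ := mfderiv 𝓘(ℝ, Model n) 𝓘(ℝ) f x

/-- The differential of the inverse of a chart, as a linear map of the model space. -/
def frameMap (e : OpenPartialHomeomorph X (Model n)) (y : Model n) : Model n →L[ℝ] Model n :=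
  mfderiv 𝓘(ℝ, Model n) 𝓘(ℝ, Model n) e.symm y

/-- The differential of a chart, as a linear map of the model space. -/
def coframeMap (e : OpenPartialHomeomorph X (Model n)) (x : X) : Model n →L[ℝ] Model n :=
  mfderiv 𝓘(ℝ, Model n) 𝓘(ℝ, Model n) e x

theorem coframeMap_frameMap {e : OpenPartialHomeomorph X (Model n)}
    (he : e ∈ IsManifold.maximalAtlas 𝓘(ℝ, Model n) ∞ X) {y : Model n} (hy : y ∈ e.target)
    (v : Model n) : coframeMap e (e.symm y) (frameMap e y v) = v :=
  DFunLike.congr_fun (mfderiv_chart_comp_symm he hy) v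

theorem frameMap_coframeMap {e : OpenPartialHomeomorph X (Model n)}
    (he : e ∈ IsManifold.maximalAtlas 𝓘(ℝ, Model n) ∞ X) {x : X} (hx : x ∈ e.source)
    (v : Model n) : frameMap e (e x) (coframeMap e x v) = v :=
  DFunLike.congr_fun (mfderiv_chart_symm_comp he hx) v

theorem formIn_apply (θ : ∀ x : X, FormFiber n m x) (e : OpenPartialHomeomorph X (Model n))
    (y : Model n) (v : Fin m → Model n) :
    formIn θ e y v = θ (e.symm y) fun i => frameMap e y (v i) := rfl

theorem hasMFDerivAt_smoothFun (f : SmoothFun n X) (x : X) :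
    HasMFDerivAt 𝓘(ℝ, Model n) 𝓘(ℝ) f x (diffAt n f x) :=
  (f.contMDiff.mdifferentiableAt (by simp)).hasMFDerivAt

theorem diffAt_sum_smul {N : ℕ} (c : Fin N → ℝ) (f : Fin N → SmoothFun n X) (x : X) :
    diffAt n (∑ i, c i • f i : SmoothFun n X) x = ∑ i, c i • diffAt n (f i) x := by
  induction N with
  | zero =>
    rw [Finset.univ_eq_empty, Finset.sum_empty, Finset.sum_empty]
    exact mfderiv_const
  | succ N ih =>
    rw [Fin.sum_univ_succ, Fin.sum_univ_succ, ← ih]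
    exact (((hasMFDerivAt_smoothFun (f 0) x).const_smul (c 0)).add
      (hasMFDerivAt_smoothFun (∑ i : Fin N, c i.succ • f i.succ : SmoothFun n X) x)).mfderiv

theorem smoothFun_sum_smul_eval {N : ℕ} (c : Fin N → ℝ) (f : Fin N → SmoothFun n X) (x : X) :
    (∑ i, c i • f i : SmoothFun n X) x = ∑ i, c i * f i x := by
  rw [← ContMDiffMap.coeFnAddMonoidHom_apply, map_sum]
  simp

variable {M : Type*} [AddCommGroup M] [Module (SmoothFun n X) M] [Module ℝ M]
  [IsScalarTower ℝ (SmoothFun n X) M] {r : ℕ}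

/-- The traction part can be computed in any basis of the tangent space. -/
theorem tractionPart_eq_sum
    (P : ∀ x : X, Jet n (jetSections (X := X) n M r) 1 x →ₗ[ℝ] FormFiber n (m + 1) x) {x : X}
    (A : jetSections (X := X) n M r) {E : Fin (n + 1) → Model n} {f : Fin (n + 1) → SmoothFun n X}
    (hf : ∀ i, f i x = 0)
    (hE : ∀ i j, diffAt n (f i) x (E j) = if i = j then 1 else 0) :
    tractionPart n M r P x (A.1 x) = ∑ i, contract (V := TangentSpace 𝓘(ℝ, Model n) x) (E i)
      (P x (jet n 1 x (f i • A))) := by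
  let a : Matrix (Fin (n + 1)) (Fin (n + 1)) ℝ := Matrix.of fun k j => E j k
  let d : Fin (n + 1) → Model n →L[ℝ] ℝ := fun i => diffAt n (f i) x
  let b : Matrix (Fin (n + 1)) (Fin (n + 1)) ℝ := Matrix.of fun j k => d j (EuclideanSpace.single k 1)
  have hsum : ∀ v : Model n, v = ∑ k, v k • EuclideanSpace.single k (1 : ℝ) := fun v => by
    simpa using ((EuclideanSpace.basisFun (Fin (n + 1)) ℝ).sum_repr v).symm
  have hba : b * a = 1 := by
    ext i j
    rw [Matrix.mul_apply, Matrix.one_apply]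
    refine Eq.trans ?_ (hE i j)
    change _ = d i (E j)
    conv_rhs => rw [hsum (E j), map_sum]
    refine Finset.sum_congr rfl fun k _ => ?_
    rw [map_smul, smul_eq_mul, mul_comm]
    rfl
  -- `hba` is the duality of `d` and `E` in matrix form. A one-sided inverse of a square matrix is
  -- two-sided, and the opposite product expands the standard covectors in the `d j`.
  have hab : a * b = 1 := mul_eq_one_comm.1 hba
  have hproj : ∀ k, (EuclideanSpace.proj k : Model n →L[ℝ] ℝ) = ∑ j, a k j • d j := by
    intro k
    ext v
    rw [hsum v, map_sum, map_sum]
    refine Finset.sum_congr rfl fun l _ => ?_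
    rw [map_smul, map_smul]
    congr 1
    have := congrFun (congrFun hab k) l
    rw [Matrix.mul_apply, Matrix.one_apply] at this
    rw [sum_apply]
    simpa [b] using this.symm
  have hv : ∀ k, P x (vertical n M r x (EuclideanSpace.proj k : Model n →L[ℝ] ℝ) (A.1 x)) =
      ∑ j, a k j • P x (jet n 1 x (f j • A)) := by
    intro k
    rw [vertical_apply (f := ∑ j, a k j • f j) (by simp [smoothFun_sum_smul_eval, hf])
      ((diffAt_sum_smul _ _ _).trans (hproj k).symm), Finset.sum_smul, map_sum, map_sum]
    refine Finset.sum_congr rfl fun j _ => ?_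
    rw [smul_assoc, map_smul, map_smul]
  rw [tractionPart, LinearMap.sum_apply]
  simp only [LinearMap.comp_apply]
  simp only [hv, map_sum, map_smul]
  rw [Finset.sum_comm]
  refine Finset.sum_congr rfl fun j _ => ?_
  have hE' : E j = ∑ k, a k j • (EuclideanSpace.single k (1 : ℝ) : Model n) := hsum (E j)
  conv_rhs => rw [hE']
  exact (contract_sum_smul (V := TangentSpace 𝓘(ℝ, Model n) x) _ _ _ _).symm

theorem mfderiv_coord_frame {e : OpenPartialHomeomorph X (Model n)}
    (he : e ∈ IsManifold.maximalAtlas 𝓘(ℝ, Model n) ∞ X) {y : Model n} (hy : y ∈ e.target)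
    {i : Fin (n + 1)} {f : X → ℝ} {c : ℝ} (hf : f =ᶠ[𝓝 (e.symm y)] fun z => e z i - c)
    (j : Fin (n + 1)) :
    diffAt n f (e.symm y) (frameMap e y (EuclideanSpace.single j 1)) = if i = j then 1 else 0 := by
  have hp : HasFDerivAt (fun z : Model n => z i - c) (EuclideanSpace.proj i : Model n →L[ℝ] ℝ)
      (e (e.symm y)) := (EuclideanSpace.proj i : Model n →L[ℝ] ℝ).hasFDerivAt.sub_const c
  have h1 : diffAt n f (e.symm y) = (EuclideanSpace.proj i : Model n →L[ℝ] ℝ).comp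
      (coframeMap e (e.symm y)) := by
    refine (hf.mfderiv_eq (I := 𝓘(ℝ, Model n)) (I' := 𝓘(ℝ))).trans ?_
    exact (hp.hasMFDerivAt.comp (e.symm y)
      (mdifferentiableAt_chart he (e.map_target hy)).hasMFDerivAt).mfderiv
  rw [h1, ContinuousLinearMap.comp_apply, coframeMap_frameMap he hy]
  simp

/-- The definition makes unrelated choices at different points. In the moving coordinate frame of
one chart, the functions dual to the frame at `z` are `N i - N i z` with `N i` the coordinates, and
P·j¹((N i − N i z) A) = P·j¹(N i A) − (N i z) P·j¹A. Both forms on the right are smooth and no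
longer involve a choice at `z`. -/
theorem tractionPart_mem (P : jetHom n (jetSections (X := X) n M r) 1 (m + 1)) :
    tractionPart n M r P.1 ∈ jetHom (X := X) n M r m := by
  intro A hA
  lift A to jetSections (X := X) n M r using hA
  refine mem_smoothForms_of_formIn fun x => ⟨chartAt (Model n) x, IsManifold.chart_mem_maximalAtlas _,
    mem_chart_source _ _, ?_⟩
  set e := chartAt (Model n) x
  have he : e ∈ IsManifold.maximalAtlas 𝓘(ℝ, Model n) ∞ X := IsManifold.chart_mem_maximalAtlas _
  have hx : x ∈ e.source := mem_chart_source _ _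
  choose N hN _ using fun i : Fin (n + 1) => exists_smoothFun_eventuallyEq e.open_source hx
    (contMDiffOn_comp_chart he (h := fun y => y i)
      (EuclideanSpace.proj i : Model n →L[ℝ] ℝ).contDiff)
  let Θ : jetSections (X := X) n M r → ∀ z : X, FormFiber n (m + 1) z :=
    fun B z => P.1 z (jet n 1 z B)
  have hΘ : ∀ B, Θ B ∈ smoothForms n X (m + 1) := fun B => P.2 _ (prolong n 1 B).2
  have hex : e x ∈ e.target := e.map_source hx
  refine contDiffAt_form fun v => ?_
  have key : ∀ᶠ y in 𝓝 (e x), formIn (fun z => tractionPart n M r P.1 z (A.1 z)) e y v =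
      ∑ i, (formIn (Θ (N i • A)) e y (Matrix.vecCons (EuclideanSpace.single i 1) v) -
        N i (e.symm y) * formIn (Θ A) e y (Matrix.vecCons (EuclideanSpace.single i 1) v)) := by
    -- Differentials at nearby points are needed, so `N i` must agree with the coordinate on a
    -- neighbourhood of each such point, not only at the point.
    have h1 := (e.continuousAt_symm hex).tendsto.eventually
      (e.left_inv hx ▸ eventually_all.2 fun i => eventually_eventually_nhds.2 (hN i))
    filter_upwards [e.open_target.mem_nhds hex, h1] with y hy hy1
    have hz : ∀ i, (N i - algebraMap ℝ (SmoothFun n X) (N i (e.symm y))) (e.symm y) = 0 :=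
      fun i => sub_self _
    have h2 := tractionPart_eq_sum P.1 A (x := e.symm y)
      (E := fun i => frameMap e y (EuclideanSpace.single i 1)) hz (fun i j => by
          refine mfderiv_coord_frame he hy (c := N i (e.symm y)) ?_ j
          filter_upwards [hy1 i] with z hz
          change N i z - N i (e.symm y) = _
          rw [hz])
    simp only [formIn_apply]
    refine (congrArg (fun θ : FormFiber n m (e.symm y) => θ fun i => frameMap e y (v i)) h2).trans
      ((ContinuousAlternatingMap.sum_apply (M := TangentSpace 𝓘(ℝ, Model n) (e.symm y)) _ _).trans ?_)
    refine Finset.sum_congr rfl fun i _ => ?_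
    have h3 : (fun k => frameMap e y (Matrix.vecCons (EuclideanSpace.single i (1 : ℝ)) v k)) =
        Matrix.vecCons (frameMap e y (EuclideanSpace.single i (1 : ℝ)))
          fun k => frameMap e y (v k) := by
      ext k : 1
      refine Fin.cases ?_ (fun k => ?_) k <;> rfl
    have h4 : P.1 (e.symm y) (jet n 1 (e.symm y)
        ((N i - algebraMap ℝ (SmoothFun n X) (N i (e.symm y))) • A)) =
        Θ (N i • A) (e.symm y) - N i (e.symm y) • Θ A (e.symm y) := by
      rw [jetSections_sub_algebraMap_smul, map_sub, map_sub,
        (jet n 1 (e.symm y)).map_smul, (P.1 (e.symm y)).map_smul]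
    refine (congrArg (fun θ : FormFiber n (m + 1) (e.symm y) => θ (Matrix.vecCons
      (frameMap e y (EuclideanSpace.single i (1 : ℝ))) fun k => frameMap e y (v k))) h4).trans ?_
    rw [h3]
    rfl
  refine ContDiffAt.congr_of_eventuallyEq ?_ key
  refine ContDiffAt.sum fun i _ => ContDiffAt.sub ?_ (ContDiffAt.mul ?_ ?_)
  · exact contDiffAt_form_apply (contDiffAt_formIn (hΘ _) he hex) _
  · exact (contDiffOn_smoothFun_chart_symm he (N i)).contDiffAt (e.open_target.mem_nhds hex)
  · exact contDiffAt_form_apply (contDiffAt_formIn (hΘ _) he hex) _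

end Traction

end HyperStress
end

noncomputable section
namespace HyperStress

set_option linter.unusedSectionVars false

/-! ### Exterior multiplication by a linear form. -/

section Wedge

variable {n m : ℕ}

/-- The exterior product of a linear form and an alternating form. -/
def wedgeForm (α : Model n →L[ℝ] ℝ) (η : Model n [⋀^Fin m]→L[ℝ] ℝ) :
    Model n [⋀^Fin (m + 1)]→L[ℝ] ℝ :=
  ContinuousAlternatingMap.alternatizeUncurryFin (α.smulRight η)

theorem wedgeForm_apply (α : Model n →L[ℝ] ℝ) (η : Model n [⋀^Fin m]→L[ℝ] ℝ)
    (v : Fin (m + 1) → Model n) :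
    wedgeForm α η v = ∑ k : Fin (m + 1), (-1) ^ (k : ℕ) * (α (v k) * η (k.removeNth v)) := by
  rw [wedgeForm, ContinuousAlternatingMap.alternatizeUncurryFin_apply]
  simp [zsmul_eq_mul]

theorem wedgeForm_sum {ι : Type*} (s : Finset ι) (α : Model n →L[ℝ] ℝ)
    (η : ι → Model n [⋀^Fin m]→L[ℝ] ℝ) :
    wedgeForm α (∑ i ∈ s, η i) = ∑ i ∈ s, wedgeForm α (η i) := by
  ext v
  rw [ContinuousAlternatingMap.sum_apply]
  simp only [wedgeForm_apply, ContinuousAlternatingMap.sum_apply, Finset.mul_sum]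
  rw [Finset.sum_comm]

theorem wedgeForm_comp (α : Model n →L[ℝ] ℝ) (η : Model n [⋀^Fin m]→L[ℝ] ℝ)
    (T : Model n →L[ℝ] Model n) :
    (wedgeForm α η).compContinuousLinearMap T =
      wedgeForm (α.comp T) (η.compContinuousLinearMap T) := by
  ext v
  rw [ContinuousAlternatingMap.compContinuousLinearMap_apply]
  simp only [wedgeForm_apply]
  rfl

theorem form_eq_zero_of_lt (h : n + 1 < m) (η : Model n [⋀^Fin m]→L[ℝ] ℝ) : η = 0 := by
  ext v
  refine η.toAlternatingMap.map_linearDependent v fun hv => ?_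
  have := hv.fintype_card_le_finrank
  simp at this
  omega

/-- The product α ∧ Θ has degree n + 2 on a space of dimension n + 1, hence is zero. Evaluated on
(v, w) and expanded, it gives α(v) Θ(w) minus the value of α ∧ (v ⌟ Θ) on w. -/
theorem wedgeForm_contract (α : Model n →L[ℝ] ℝ) (v : Model n)
    (Θ : Model n [⋀^Fin (n + 1)]→L[ℝ] ℝ) : wedgeForm α (contract v Θ) = α v • Θ := by
  ext w
  have h := DFunLike.congr_fun (form_eq_zero_of_lt (n := n) (m := n + 2) (by omega) (wedgeForm α Θ))
    (Fin.cons v w : Fin (n + 2) → Model n)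
  rw [wedgeForm_apply, Fin.sum_univ_succ] at h
  simp only [Fin.removeNth_zero, Fin.tail_cons, Fin.cons_zero, Fin.cons_succ, Fin.val_zero,
    pow_zero, one_mul, ContinuousAlternatingMap.coe_zero, Pi.zero_apply, Fin.val_succ] at h
  rw [wedgeForm_apply, ContinuousAlternatingMap.smul_apply, smul_eq_mul]
  have h2 : ∀ k : Fin (n + 1), (-1 : ℝ) ^ ((k : ℕ) + 1) *
      (α (w k) * Θ (k.succ.removeNth (Fin.cons v w : Fin (n + 2) → Model n))) =
      -((-1) ^ (k : ℕ) * (α (w k) * contract v Θ (k.removeNth w))) := by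
    intro k
    rw [contract_apply, pow_succ]
    have : (k.succ.removeNth (Fin.cons v w : Fin (n + 2) → Model n)) =
        Matrix.vecCons v (k.removeNth w) := by
      ext i : 1
      refine Fin.cases ?_ (fun i => ?_) i
      · simp [Fin.removeNth]
      · simp [Fin.removeNth]
    rw [this]
    ring
  simp only [h2, Finset.sum_neg_distrib] at h
  linarith

theorem extDeriv_fun_mul_form {g : Model n → ℝ} {η : Model n → Model n [⋀^Fin m]→L[ℝ] ℝ}
    {y : Model n} (hg : DifferentiableAt ℝ g y) (hη : DifferentiableAt ℝ η y) :
    extDeriv (fun z => g z • η z) y = g y • extDeriv η y + wedgeForm (fderiv ℝ g y) (η y) := by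
  rw [extDeriv, fderiv_fun_smul hg hη, ContinuousAlternatingMap.alternatizeUncurryFin_add]
  congr 1
  exact ContinuousAlternatingMap.alternatizeUncurryFin_smul _ _

end Wedge

/-! ### The Leibniz rule for forms on the manifold. -/

section Leibniz

variable {n : ℕ} {X : Type*} [TopologicalSpace X] [ChartedSpace (Model n) X] [T2Space X]
  [IsManifold 𝓘(ℝ, Model n) ∞ X] {m : ℕ}

theorem dForm_eq_comp (θ : ∀ x : X, FormFiber n m x) (x : X) :
    dForm n θ x = (extDeriv (formIn θ (chartAt (Model n) x)) (chartAt (Model n) x x)).compContinuousLinearMap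
      (coframeMap (chartAt (Model n) x) x) := by
  unfold dForm coframeMap
  rw [formInChart_eq]
  simp only [mfld_simps]
  rfl

theorem formIn_comp_coframeMap (θ : ∀ x : X, FormFiber n m x) {e : OpenPartialHomeomorph X (Model n)}
    (he : e ∈ IsManifold.maximalAtlas 𝓘(ℝ, Model n) ∞ X) {x : X} (hx : x ∈ e.source) :
    (formIn θ e (e x)).compContinuousLinearMap (coframeMap e x) = θ x := by
  have key : ∀ (α : X → (Model n) [⋀^Fin m]→L[ℝ] ℝ) (x' : X) (_ : x' = x)
      (A B : Model n →L[ℝ] Model n), (∀ v, A (B v) = v) →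
      ((α x').compContinuousLinearMap A).compContinuousLinearMap B = α x := by
    rintro α _ rfl A B h
    ext v
    simp [Function.comp_def, h]
  exact key θ _ (e.left_inv hx) _ _ (frameMap_coframeMap he hx)

theorem fderiv_smoothFun_chart_symm {e : OpenPartialHomeomorph X (Model n)}
    (he : e ∈ IsManifold.maximalAtlas 𝓘(ℝ, Model n) ∞ X) (f : SmoothFun n X) {y : Model n}
    (hy : y ∈ e.target) :
    fderiv ℝ (fun z => f (e.symm z)) y = (diffAt n f (e.symm y)).comp (frameMap e y) := by
  refine (mfderiv_eq_fderiv (𝕜 := ℝ) (f := fun z => f (e.symm z))).symm.trans ?_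
  exact ((hasMFDerivAt_smoothFun f _).comp y (mdifferentiableAt_chart_symm he hy).hasMFDerivAt).mfderiv

/-- The exterior product of a linear form and an alternating form on a tangent space. -/
def wedgeAt (x : X) (α : Model n →L[ℝ] ℝ) (η : FormFiber n m x) : FormFiber n (m + 1) x :=
  wedgeForm α η

theorem dForm_smoothFun_smul (f : SmoothFun n X) {θ : ∀ x : X, FormFiber n m x}
    (hθ : θ ∈ smoothForms n X m) (x : X) :
    dForm n (fun y => f y • θ y) x =
      f x • dForm n θ x + wedgeAt x (diffAt n f x) (θ x) := by
  set e := chartAt (Model n) x with hee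
  have he : e ∈ IsManifold.maximalAtlas 𝓘(ℝ, Model n) ∞ X := IsManifold.chart_mem_maximalAtlas _
  have hx : x ∈ e.source := mem_chart_source _ _
  have hy : e x ∈ e.target := e.map_source hx
  have h1 : DifferentiableAt ℝ (fun z => f (e.symm z)) (e x) :=
    ((contDiffOn_smoothFun_chart_symm he f).contDiffAt (e.open_target.mem_nhds hy)).differentiableAt
      (by simp)
  have h2 : DifferentiableAt ℝ (formIn θ e) (e x) :=
    (contDiffAt_formIn hθ he hy).differentiableAt (by simp)
  have h3 : formIn (fun y => f y • θ y) e = fun z => f (e.symm z) • formIn θ e z := rfl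
  rw [dForm_eq_comp, dForm_eq_comp, ← hee, h3, extDeriv_fun_mul_form h1 h2,
    fderiv_smoothFun_chart_symm he f hy]
  have h4 : ∀ (α β : Model n [⋀^Fin (m + 1)]→L[ℝ] ℝ) (T : Model n →L[ℝ] Model n) (c : ℝ),
      (c • α + β).compContinuousLinearMap T =
        c • α.compContinuousLinearMap T + β.compContinuousLinearMap T := fun _ _ _ _ => rfl
  refine (h4 _ _ _ _).trans ?_
  have h5 : ((diffAt n f (e.symm (e x))).comp (frameMap e (e x))).comp (coframeMap e x) =
      diffAt n f x := by
    ext v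
    rw [ContinuousLinearMap.comp_apply, ContinuousLinearMap.comp_apply, frameMap_coframeMap he hx,
      e.left_inv hx]
  rw [wedgeForm_comp, h5, e.left_inv hx]
  exact congrArg (fun η => f x • _ + wedgeForm (diffAt n f x) η) (formIn_comp_coframeMap θ he hx)

end Leibniz

/-! ### Construction of the divergence, its uniqueness and its order. -/

section Divergence

variable {n : ℕ} {X : Type*} [TopologicalSpace X] [ChartedSpace (Model n) X] [T2Space X]
  [IsManifold 𝓘(ℝ, Model n) ∞ X]
variable {M : Type*} [AddCommGroup M] [Module (SmoothFun n X) M] [Module ℝ M]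
  [IsScalarTower ℝ (SmoothFun n X) M] {r : ℕ}

/-- The traction part as a smooth section. -/
def traction (P : jetHom (X := X) n (jetSections (X := X) n M r) 1 (n + 1)) : jetHom (X := X) n M r n :=
  ⟨tractionPart n M r P.1, tractionPart_mem P⟩

/-- With functions `c i` whose differentials are the standard covectors, `wedgeForm_contract` turns
the product of df with each summand `e i ⌟ P (j¹ (c i A))` of the traction into df(e i) P·j¹(c i A).
The combination of the `c i` with coefficients df(e i) has the same 1-jet at `x` as `f`. -/
theorem wedgeForm_traction (P : jetHom (X := X) n (jetSections (X := X) n M r) 1 (n + 1)) {f : SmoothFun n X}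
    {x : X} (hf : f x = 0) (A : jetSections (X := X) n M r) :
    wedgeAt x (diffAt n f x) ((traction P).1 x (A.1 x)) = P.1 x (jet n 1 x (f • A)) := by
  have h := fun i : Fin (n + 1) =>
    (exists_smoothFun_mfderiv_eq n x (EuclideanSpace.proj i : Model n →L[ℝ] ℝ)).choose_spec
  set c := fun i : Fin (n + 1) =>
    (exists_smoothFun_mfderiv_eq n x (EuclideanSpace.proj i : Model n →L[ℝ] ℝ)).choose
  have hc0 : ∀ i, c i x = 0 := fun i => (h i).1
  have hc : ∀ i, diffAt n (c i) x = EuclideanSpace.proj i := fun i => (h i).2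
  have h1 := tractionPart_eq_sum P.1 A (E := fun i => EuclideanSpace.single i (1 : ℝ))
    (f := c) (fun i => (h i).1) (fun i j => by rw [hc]; simp)
  have h2 : diffAt n f x = ∑ i, diffAt n f x (EuclideanSpace.single i 1) • diffAt n (c i) x := by
    ext v
    have hv : v = ∑ k, v k • EuclideanSpace.single k (1 : ℝ) := by
      simpa using ((EuclideanSpace.basisFun (Fin (n + 1)) ℝ).sum_repr v).symm
    conv_lhs => rw [hv, map_sum]
    rw [sum_apply]
    refine Finset.sum_congr rfl fun i _ => ?_
    rw [hc, map_smul, smul_apply, smul_eq_mul, smul_eq_mul, mul_comm]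
    rfl
  have h3 : jet n 1 x (f • A) =
      jet n 1 x ((∑ i, diffAt n f x (EuclideanSpace.single i 1) • c i) • A) :=
    jet_one_smul_congr hf (by simp [smoothFun_sum_smul_eval, hc0])
      (h2.trans (diffAt_sum_smul _ _ _).symm) rfl
  rw [h3, Finset.sum_smul, map_sum, map_sum]
  refine (congrArg (wedgeForm (diffAt n f x)) h1).trans ((wedgeForm_sum _ _ _).trans ?_)
  refine Finset.sum_congr rfl fun i _ => ?_
  rw [smul_assoc, LinearMap.map_smul, LinearMap.map_smul]
  exact wedgeForm_contract _ _ _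

/-- The map `A ↦ d(p_σ(P) · A) - P · j¹A` at a point. -/
def divPairing (P : jetHom (X := X) n (jetSections (X := X) n M r) 1 (n + 1)) (x : X) :
    jetSections (X := X) n M r →ₗ[ℝ] FormFiber n (n + 1) x :=
  dPairing n (traction P) x - P.1 x ∘ₗ jet n 1 x

theorem divPairing_apply (P : jetHom (X := X) n (jetSections (X := X) n M r) 1 (n + 1)) (x : X)
    (A : jetSections (X := X) n M r) : divPairing P x A =
      dForm n (fun y => (traction P).1 y (A.1 y)) x - P.1 x (jet n 1 x A) := rfl

/-- On `f • B` with `f x = 0` the Leibniz rule leaves df ∧ (p_σ(P)·B), which `wedgeForm_traction`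
identifies with the subtracted power. Sections vanishing at `x` are sums of such products. -/
theorem divPairing_eq_zero (P : jetHom (X := X) n (jetSections (X := X) n M r) 1 (n + 1)) {x : X}
    {A : jetSections (X := X) n M r} (hA : A.1 x = 0) : divPairing P x A = 0 := by
  have h := mem_smul_top_of_eval_eq_zero hA
  clear hA
  induction h using Submodule.smul_induction_on' with
  | smul f hf B _ =>
    have hf' : f x = 0 := hf
    rw [divPairing_apply, ← wedgeForm_traction P hf']
    have h1 : (fun y => (traction P).1 y ((f • B).1 y)) =
        fun y => f y • (traction P).1 y (B.1 y) := by
      ext y : 1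
      rw [jetSections_smul_apply, map_smul]
    rw [h1, dForm_smoothFun_smul f ((traction P).2 _ B.2), hf']
    exact sub_eq_zero.2 ((congrArg (· + wedgeAt x (diffAt n f x) _) (zero_smul ℝ _)).trans (zero_add _))
  | add A _ B _ hA hB => rw [map_add, hA, hB, add_zero]

/-- The divergence of a non-holonomic stress, at a point. -/
def divergenceAt (P : jetHom (X := X) n (jetSections (X := X) n M r) 1 (n + 1)) (x : X) :
    Jet n M r x →ₗ[ℝ] FormFiber n (n + 1) x :=
  ((vanishing n M r x).restrictScalars ℝ).liftQ (divPairing P x ∘ₗ prolong n r) fun s hs => by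
    rw [LinearMap.mem_ker]
    exact divPairing_eq_zero P ((jet_eq_zero_iff n r x s).2 hs)

/-- `divergenceAt` is built from holonomic sections; an arbitrary `A` differs from a prolongation
with the same value at `x` by a section that vanishes at `x`. -/
theorem divergenceAt_apply (P : jetHom (X := X) n (jetSections (X := X) n M r) 1 (n + 1)) (x : X)
    (A : jetSections (X := X) n M r) : divergenceAt P x (A.1 x) = divPairing P x A := by
  obtain ⟨s, hs⟩ := jet_surjective x (A.1 x)
  rw [← hs]
  change divPairing P x (prolong n r s) = _
  rw [← sub_eq_zero, ← map_sub]
  refine divPairing_eq_zero P ?_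
  rw [Submodule.coe_sub, Pi.sub_apply, ← hs]
  exact sub_self _

theorem divergenceAt_mem (P : jetHom (X := X) n (jetSections (X := X) n M r) 1 (n + 1)) :
    divergenceAt P ∈ jetHom (X := X) n M r (n + 1) := by
  intro A hA
  lift A to jetSections (X := X) n M r using hA
  simp only [divergenceAt_apply]
  exact sub_mem (dForm_mem_smoothForms ((traction P).2 _ A.2)) (P.2 _ (prolong n 1 A).2)

theorem jetSections_exists_eval_eq (x : X) (u : Jet n M r x) :
    ∃ A : jetSections (X := X) n M r, A.1 x = u := by
  obtain ⟨s, hs⟩ := jet_surjective x u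
  exact ⟨prolong n r s, hs⟩

theorem jetHom_ext {m : ℕ} {σ τ : ∀ x : X, Jet n M r x →ₗ[ℝ] FormFiber n m x}
    (h : ∀ (x : X) (A : jetSections (X := X) n M r), σ x (A.1 x) = τ x (A.1 x)) : σ = τ := by
  ext x : 1
  refine LinearMap.ext fun u => ?_
  obtain ⟨A, rfl⟩ := jetSections_exists_eval_eq x u
  exact h x A

theorem traction_add (P Q : jetHom (X := X) n (jetSections (X := X) n M r) 1 (n + 1)) :
    traction (P + Q) = traction P + traction Q := by
  apply Subtype.ext
  ext x : 1
  change tractionPart n M r (P.1 + Q.1) x = tractionPart n M r P.1 x + tractionPart n M r Q.1 x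
  simp only [tractionPart, Pi.add_apply, LinearMap.add_comp, LinearMap.comp_add,
    Finset.sum_add_distrib]

theorem traction_smul (c : ℝ) (P : jetHom (X := X) n (jetSections (X := X) n M r) 1 (n + 1)) :
    traction (c • P) = c • traction P := by
  apply Subtype.ext
  ext x : 1
  change tractionPart n M r (c • P.1) x = c • tractionPart n M r P.1 x
  simp only [tractionPart, Pi.smul_apply, LinearMap.smul_comp, LinearMap.comp_smul,
    Finset.smul_sum]

theorem traction_fun_smul (f : SmoothFun n X)
    (P : jetHom (X := X) n (jetSections (X := X) n M r) 1 (n + 1)) : traction (f • P) = f • traction P := by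
  apply Subtype.ext
  ext x : 1
  rw [jetHom_smul_apply]
  change tractionPart n M r (f • P).1 x = f x • tractionPart n M r P.1 x
  simp only [tractionPart, jetHom_smul_apply, LinearMap.smul_comp, LinearMap.comp_smul,
    Finset.smul_sum]

variable (n M r) in
/-- The divergence of non-holonomic stresses. -/
def divergence : jetHom (X := X) n (jetSections (X := X) n M r) 1 (n + 1) →ₗ[ℝ]
    jetHom (X := X) n M r (n + 1) where
  toFun P := ⟨divergenceAt P, divergenceAt_mem P⟩
  map_add' P Q := by
    apply Subtype.ext
    refine jetHom_ext fun x A => ?_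
    change divergenceAt (P + Q) x (A.1 x) = divergenceAt P x (A.1 x) + divergenceAt Q x (A.1 x)
    simp only [divergenceAt_apply, divPairing_apply, traction_add]
    have h : (fun y => (traction P + traction Q).1 y (A.1 y)) =
      (fun y => (traction P).1 y (A.1 y)) + fun y => (traction Q).1 y (A.1 y) := rfl
    rw [h, dForm_add n ((traction P).2 _ A.2) ((traction Q).2 _ A.2)]
    change _ - (P.1 x (jet n 1 x A) + Q.1 x (jet n 1 x A)) = _
    abel
  map_smul' c P := by
    apply Subtype.ext
    refine jetHom_ext fun x A => ?_
    change divergenceAt (c • P) x (A.1 x) = c • divergenceAt P x (A.1 x)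
    simp only [divergenceAt_apply, divPairing_apply, traction_smul]
    have h : (fun y => (c • traction P).1 y (A.1 y)) =
      c • fun y => (traction P).1 y (A.1 y) := rfl
    rw [h, dForm_smul, smul_sub]
    rfl

theorem divergence_apply (P : jetHom (X := X) n (jetSections (X := X) n M r) 1 (n + 1)) (x : X)
    (A : jetSections (X := X) n M r) : (divergence n M r P).1 x (A.1 x) =
      dForm n (fun y => (traction P).1 y (A.1 y)) x - P.1 x (jet n 1 x A) :=
  divergenceAt_apply P x A

/-- Since the traction is linear over smooth functions, replacing `P` by `f • P` multiplies the
differentiated form by `f`. For `f` in the square of the ideal its exterior derivative vanishes at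
`x`, and so does `f • P` itself. -/
theorem divergence_eq_zero_of_mem_vanishing {x : X}
    {P : jetHom (X := X) n (jetSections (X := X) n M r) 1 (n + 1)}
    (hP : P ∈ vanishing n (jetHom (X := X) n (jetSections (X := X) n M r) 1 (n + 1)) 1 x) :
    (divergence n M r P).1 x = 0 := by
  rw [vanishing] at hP
  induction hP using Submodule.smul_induction_on' with
  | smul f hf P _ =>
    refine LinearMap.ext fun u => ?_
    obtain ⟨A, rfl⟩ := jetSections_exists_eval_eq x u
    rw [divergence_apply, traction_fun_smul]
    have h : (fun y => (f • traction P).1 y (A.1 y)) =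
      fun y => f y • (traction P).1 y (A.1 y) := rfl
    have h2 : f x = 0 := Ideal.pow_le_self two_ne_zero hf
    rw [h, dForm_smul_eq_zero n hf ((traction P).2 _ A.2), jetHom_smul_apply, h2, zero_smul]
    simp
  | add P _ Q _ hP hQ =>
    rw [map_add]
    exact (congrArg₂ (· + ·) hP hQ).trans (add_zero _)

variable (n M r) in
/-- The divergence at a point, as a function of the first jet of the stress. -/
def divergenceSymbol (x : X) :
    Jet n (jetHom (X := X) n (jetSections (X := X) n M r) 1 (n + 1)) 1 x →ₗ[ℝ]
      (Jet n M r x →ₗ[ℝ] FormFiber n (n + 1) x) :=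
  Submodule.liftQ (M₂ := Jet n M r x →ₗ[ℝ] FormFiber n (n + 1) x)
    ((vanishing n (jetHom (X := X) n (jetSections (X := X) n M r) 1 (n + 1)) 1 x).restrictScalars ℝ)
    ({ toFun := fun P => (divergence n M r P).1 x
       map_add' := fun P Q => by rw [map_add]; rfl
       map_smul' := fun c P => by rw [map_smul]; rfl } :
      jetHom (X := X) n (jetSections (X := X) n M r) 1 (n + 1) →ₗ[ℝ]
        (Jet n M r x →ₗ[ℝ] FormFiber n (n + 1) x))
    fun P hP => by
      rw [LinearMap.mem_ker]
      exact divergence_eq_zero_of_mem_vanishing hP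

theorem divergence_eq_symbol (P : jetHom (X := X) n (jetSections (X := X) n M r) 1 (n + 1)) (x : X) :
    (divergence n M r P).1 x = divergenceSymbol n M r x (jet n 1 x P) := rfl

theorem divergence_value (P : jetHom (X := X) n (jetSections (X := X) n M r) 1 (n + 1)) (x : X)
    (B : Jet n (jetSections (X := X) n M r) 1 x) :
    (divergence n M r P).1 x (value n M r x B) = exteriorJet n (traction P) x B - P.1 x B := by
  obtain ⟨A, rfl⟩ := jet_surjective x B
  rw [value_jet, divergence_apply]
  rfl

theorem eq_divergence_of_value (P : jetHom (X := X) n (jetSections (X := X) n M r) 1 (n + 1))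
    (b : jetHom (X := X) n M r (n + 1))
    (h : ∀ (x : X) (B : Jet n (jetSections (X := X) n M r) 1 x),
      b.1 x (value n M r x B) = exteriorJet n (traction P) x B - P.1 x B) :
    b = divergence n M r P := by
  apply Subtype.ext
  refine jetHom_ext fun x A => ?_
  have h1 := h x (jet n 1 x A)
  rw [← divergence_value] at h1
  exact h1

end Divergence

/-! ### The divergence on the stresses of a vector bundle. -/

section Bundles

variable {n r : ℕ} {X : Type*} [TopologicalSpace X] [ChartedSpace (Model n) X]
  [IsManifold 𝓘(ℝ, Model n) ∞ X] [T2Space X] [SigmaCompactSpace X]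
  {F : Type*} [NormedAddCommGroup F] [NormedSpace ℝ F]
  {W : X → Type*} [∀ x, AddCommGroup (W x)] [∀ x, Module ℝ (W x)] [∀ x, TopologicalSpace (W x)]
  [TopologicalSpace (Bundle.TotalSpace F W)] [FiberBundle F W] [VectorBundle ℝ F W]

theorem IsDivergence.eq_divergence {div : NonHolonomicStress n F W r →ₗ[ℝ] BodyHyperForce n F W r}
    (h : IsDivergence div) : div = divergence n (Sections n F W) r :=
  LinearMap.ext fun P => eq_divergence_of_value P (div P) (h P).2

theorem isDivergence_divergence :
    IsDivergence (divergence n (Sections n F W) r : NonHolonomicStress n F W r →ₗ[ℝ] BodyHyperForce n F W r) :=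
  fun P => ⟨tractionPart_mem P, divergence_value P⟩

end Bundles

end HyperStress
end

noncomputable section
namespace HyperStress

set_option linter.unusedSectionVars false

/-! ### Pullback of forms, tractions and divergences under a diffeomorphism. -/

section Pullback

variable {n m : ℕ} {X : Type*} [TopologicalSpace X] [ChartedSpace (Model n) X] [T2Space X]
  [IsManifold 𝓘(ℝ, Model n) ∞ X]
  {X' : Type*} [TopologicalSpace X'] [ChartedSpace (Model n) X'] [T2Space X']
  [IsManifold 𝓘(ℝ, Model n) ∞ X']
  (φ : X ≃ₘ^∞⟮𝓘(ℝ, Model n), 𝓘(ℝ, Model n)⟯ X')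

/-- The differential of a diffeomorphism, as a linear map of the model space. -/
def diffeoDeriv (x : X) : Model n →L[ℝ] Model n := mfderiv 𝓘(ℝ, Model n) 𝓘(ℝ, Model n) φ x

theorem hasMFDerivAt_diffeo (x : X) :
    HasMFDerivAt 𝓘(ℝ, Model n) 𝓘(ℝ, Model n) φ x (diffeoDeriv φ x) :=
  (φ.contMDiff.mdifferentiableAt (by simp)).hasMFDerivAt

theorem exists_diffeoDeriv_rightInverse (x : X) :
    ∃ T : Model n →L[ℝ] Model n, ∀ v, diffeoDeriv φ x (T v) = v := by
  have h2 : φ ∘ φ.symm = id := by ext z; simp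
  have h3 : φ.symm (φ x) = x := by simp
  have h4 := hasMFDerivAt_diffeo φ x
  rw [← h3] at h4
  have h5 := (HasMFDerivAt.comp (φ x) h4 (hasMFDerivAt_diffeo φ.symm (φ x))).mfderiv
  rw [h2, mfderiv_id, h3] at h5
  exact ⟨diffeoDeriv φ.symm (φ x), fun v => (DFunLike.congr_fun h5 v).symm⟩

/-- The pullback of a form under a diffeomorphism. -/
def pullbackForm (θ : ∀ x : X', FormFiber n m x) (x : X) : FormFiber n m x :=
  (θ (φ x)).compContinuousLinearMap (mfderiv 𝓘(ℝ, Model n) 𝓘(ℝ, Model n) φ x)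

/-- In charts the pullback of forms is the pullback under the local expression `T` of `φ`, for which
`extDeriv` is natural. -/
theorem dForm_pullbackForm {θ : ∀ x : X', FormFiber n m x} (hθ : θ ∈ smoothForms n X' m) :
    dForm n (pullbackForm φ θ) = pullbackForm φ (dForm n θ) := by
  ext1 x
  set e := chartAt (Model n) x with hee
  set e' := chartAt (Model n) (φ x) with hee'
  have he : e ∈ IsManifold.maximalAtlas 𝓘(ℝ, Model n) ∞ X := IsManifold.chart_mem_maximalAtlas _
  have he' : e' ∈ IsManifold.maximalAtlas 𝓘(ℝ, Model n) ∞ X' := IsManifold.chart_mem_maximalAtlas _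
  have hx : x ∈ e.source := mem_chart_source _ _
  have hy : e x ∈ e.target := e.map_source hx
  have hx' : φ x ∈ e'.source := mem_chart_source _ _
  let T : Model n → Model n := fun y => e' (φ (e.symm y))
  have hTd : ∀ y ∈ e.target, φ (e.symm y) ∈ e'.source → fderiv ℝ T y =
      ((coframeMap e' (φ (e.symm y))).comp (diffeoDeriv φ (e.symm y))).comp (frameMap e y) := by
    intro y hy hy'
    refine (mfderiv_eq_fderiv (𝕜 := ℝ) (f := T)).symm.trans ?_
    exact (((mdifferentiableAt_chart he' hy').hasMFDerivAt.comp _ (hasMFDerivAt_diffeo φ _)).comp y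
      (mdifferentiableAt_chart_symm he hy).hasMFDerivAt).mfderiv
  have hpt : ∀ y ∈ e.target, φ (e.symm y) ∈ e'.source → formIn (pullbackForm φ θ) e y =
      (formIn θ e' (T y)).compContinuousLinearMap (fderiv ℝ T y) := by
    intro y hy hy'
    rw [hTd y hy hy']
    have h := formIn_comp_coframeMap θ he' hy'
    ext v
    have h1 : formIn (pullbackForm φ θ) e y v =
      θ (φ (e.symm y)) fun i => diffeoDeriv φ (e.symm y) (frameMap e y (v i)) := rfl
    rw [h1, ← h]
    rfl
  have hT : ContDiffAt ℝ ∞ T (e x) := by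
    rw [← contMDiffAt_iff_contDiffAt]
    refine ContMDiffAt.comp (e x) (contMDiffAt_of_mem_maximalAtlas he' ?_)
      (φ.contMDiff.contMDiffAt.comp (e x) (contMDiffAt_symm_of_mem_maximalAtlas he hy))
    rwa [e.left_inv hx]
  have hev : formIn (pullbackForm φ θ) e =ᶠ[𝓝 (e x)]
      fun y => (formIn θ e' (T y)).compContinuousLinearMap (fderiv ℝ T y) := by
    have hopen : IsOpen (φ ⁻¹' e'.source) := e'.open_source.preimage φ.continuous
    have := (e.symm.isOpen_inter_preimage hopen).mem_nhds
      (show e x ∈ _ from ⟨hy, show φ (e.symm (e x)) ∈ _ by rwa [e.left_inv hx]⟩)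
    filter_upwards [this] with y hy using hpt y hy.1 hy.2
  have hTx : T (e x) = e' (φ x) := by simp only [T, e.left_inv hx]
  have hd : DifferentiableAt ℝ (formIn θ e') (T (e x)) := by
    rw [hTx]
    exact (contDiffAt_formIn hθ he' (e'.map_source hx')).differentiableAt (by simp)
  rw [dForm_eq_comp, ← hee, hev.extDeriv_eq, extDeriv_pullback hd hT minSmoothness_two_le_infty,
    hTd (e x) hy (by rwa [e.left_inv hx]), e.left_inv hx, hTx]
  unfold pullbackForm
  rw [dForm_eq_comp, ← hee']
  ext v
  have h6 := frameMap_coframeMap he hx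
  change extDeriv (formIn θ e') (e' (φ x)) (fun i => coframeMap e' (φ x) (diffeoDeriv φ x
    (frameMap e (e x) (coframeMap e x (v i))))) = _
  simp only [h6]
  rfl

theorem contract_compContinuousLinearMap (T : Model n →L[ℝ] Model n) (v : Model n)
    (Θ : Model n [⋀^Fin (m + 1)]→L[ℝ] ℝ) :
    contract v (Θ.compContinuousLinearMap T) =
      (contract (T v) Θ).compContinuousLinearMap T := by
  ext w
  rw [contract_apply]
  simp only [ContinuousAlternatingMap.compContinuousLinearMap_apply, contract_apply]
  congr 1
  ext k : 1
  refine Fin.cases ?_ (fun k => ?_) k <;> rfl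

/-- The composition of a smooth function with a diffeomorphism. -/
def pullbackFun : SmoothFun n X' →+* SmoothFun n X where
  toFun f := f.comp ⟨φ, φ.contMDiff⟩
  map_one' := rfl
  map_mul' _ _ := rfl
  map_zero' := rfl
  map_add' _ _ := rfl

@[simp] theorem pullbackFun_apply (f : SmoothFun n X') (x : X) : pullbackFun φ f x = f (φ x) := rfl

theorem diffAt_pullbackFun (f : SmoothFun n X') (x : X) :
    diffAt n (pullbackFun φ f) x = (diffAt n f (φ x)).comp (diffeoDeriv φ x) :=
  ((hasMFDerivAt_smoothFun f (φ x)).comp x (hasMFDerivAt_diffeo φ x)).mfderiv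

theorem pullbackFun_mem_pow {f : SmoothFun n X'} {x : X} {k : ℕ}
    (hf : f ∈ vanishingIdeal n (φ x) ^ k) : pullbackFun φ f ∈ vanishingIdeal n x ^ k := by
  have h : vanishingIdeal n (φ x) ≤ (vanishingIdeal n x).comap (pullbackFun φ) := fun g hg => hg
  exact (Ideal.pow_right_mono h k).trans (Ideal.le_comap_pow _ _) hf

variable {M : Type*} [AddCommGroup M] [Module (SmoothFun n X) M] [Module ℝ M]
  [IsScalarTower ℝ (SmoothFun n X) M] {r : ℕ}
  {M' : Type*} [AddCommGroup M'] [Module (SmoothFun n X') M'] [Module ℝ M']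
  [IsScalarTower ℝ (SmoothFun n X') M']
  {P : jetHom (X := X) n (jetSections (X := X) n M r) 1 (n + 1)}
  {P' : jetHom (X := X') n (jetSections (X := X') n M' r) 1 (n + 1)}
  {A : jetSections (X := X) n M r} {A' : jetSections (X := X') n M' r}

variable {φ} in
-- The traction probes P on j¹(fA), so the hypothesis must cover all multiples of `A'`. Functions `c
-- i` dual to the standard frame at `φ x` pull back to functions dual to its preimage under the
-- differential; in these frames the two traction sums correspond term by term.
theorem traction_eq_pullbackForm
    (hP : ∀ (f : SmoothFun n X') (x : X), P.1 x (jet n 1 x (pullbackFun φ f • A)) =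
      pullbackForm φ (fun z => P'.1 z (jet n 1 z (f • A'))) x) :
    (fun x => (traction P).1 x (A.1 x)) =
      pullbackForm φ fun z => (traction P').1 z (A'.1 z) := by
  ext1 x
  have h := fun i : Fin (n + 1) =>
    (exists_smoothFun_mfderiv_eq n (φ x) (EuclideanSpace.proj i : Model n →L[ℝ] ℝ)).choose_spec
  set c := fun i : Fin (n + 1) =>
    (exists_smoothFun_mfderiv_eq n (φ x) (EuclideanSpace.proj i : Model n →L[ℝ] ℝ)).choose
  have hc0 : ∀ i, c i (φ x) = 0 := fun i => (h i).1
  have hc : ∀ i, diffAt n (c i) (φ x) = EuclideanSpace.proj i := fun i => (h i).2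
  obtain ⟨T, hT⟩ := exists_diffeoDeriv_rightInverse φ x
  have h1 := tractionPart_eq_sum P'.1 A' (E := fun i => EuclideanSpace.single i (1 : ℝ))
    (f := c) hc0 (fun i j => by rw [hc]; simp)
  have h2 := tractionPart_eq_sum P.1 A (x := x) (E := fun i => T (EuclideanSpace.single i (1 : ℝ)))
    (f := fun i => pullbackFun φ (c i)) hc0 (fun i j => by
      rw [diffAt_pullbackFun, ContinuousLinearMap.comp_apply, hT, hc]; simp)
  refine h2.trans ?_
  have h3 : ∀ η η' : Model n [⋀^Fin n]→L[ℝ] ℝ, η = η' →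
      η'.compContinuousLinearMap (diffeoDeriv φ x) = η.compContinuousLinearMap (diffeoDeriv φ x) :=
    fun _ _ h => by rw [h]
  refine Eq.trans ?_ (h3 _ _ h1)
  have h4 : ∀ η : Fin (n + 1) → Model n [⋀^Fin n]→L[ℝ] ℝ,
      (∑ i, η i).compContinuousLinearMap (diffeoDeriv φ x) =
        ∑ i, (η i).compContinuousLinearMap (diffeoDeriv φ x) := by
    intro η
    ext v
    simp [ContinuousAlternatingMap.sum_apply]
  refine Eq.trans ?_ (h4 _).symm
  refine Finset.sum_congr rfl fun i _ => ?_
  rw [hP (c i) x]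
  refine (contract_compContinuousLinearMap (diffeoDeriv φ x) _ _).trans ?_
  rw [hT]
  rfl

variable {φ} in
theorem divergence_eq_pullbackForm
    (hP : ∀ (f : SmoothFun n X') (x : X), P.1 x (jet n 1 x (pullbackFun φ f • A)) =
      pullbackForm φ (fun z => P'.1 z (jet n 1 z (f • A'))) x) (x : X) :
    (divergence n M r P).1 x (A.1 x) =
      pullbackForm φ (fun z => (divergence n M' r P').1 z (A'.1 z)) x := by
  have h := hP 1 x
  rw [map_one, one_smul, one_smul] at h
  simp only [divergence_apply]
  rw [h, traction_eq_pullbackForm hP, dForm_pullbackForm φ ((traction P').2 _ A'.2)]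
  rfl

end Pullback

/-! ### Bundle isomorphisms, related jets and naturality. -/

section Naturality

variable {n r : ℕ} {X : Type*} [TopologicalSpace X] [ChartedSpace (Model n) X]
  [IsManifold 𝓘(ℝ, Model n) ∞ X] [T2Space X]
  {F : Type*} [NormedAddCommGroup F] [NormedSpace ℝ F]
  {W : X → Type*} [∀ x, AddCommGroup (W x)] [∀ x, Module ℝ (W x)] [∀ x, TopologicalSpace (W x)]
  [TopologicalSpace (Bundle.TotalSpace F W)] [FiberBundle F W] [VectorBundle ℝ F W]
  {X' : Type*} [TopologicalSpace X'] [ChartedSpace (Model n) X']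
  [IsManifold 𝓘(ℝ, Model n) ∞ X'] [T2Space X']
  {F' : Type*} [NormedAddCommGroup F'] [NormedSpace ℝ F']
  {W' : X' → Type*} [∀ x, AddCommGroup (W' x)] [∀ x, Module ℝ (W' x)]
  [∀ x, TopologicalSpace (W' x)]
  [TopologicalSpace (Bundle.TotalSpace F' W')] [FiberBundle F' W'] [VectorBundle ℝ F' W']
  {φ : X ≃ₘ^∞⟮𝓘(ℝ, Model n), 𝓘(ℝ, Model n)⟯ X'} {Φ : ∀ x, W x ≃ₗ[ℝ] W' (φ x)}

theorem exists_relatedSections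
    (hΦ : ContMDiff (𝓘(ℝ, Model n).prod 𝓘(ℝ, F)) (𝓘(ℝ, Model n).prod 𝓘(ℝ, F')) ∞
      (fun p : Bundle.TotalSpace F W => (⟨φ p.1, Φ p.1 p.2⟩ : Bundle.TotalSpace F' W')))
    (s : Sections n F W) : ∃ s' : Sections n F' W', RelatedSections φ Φ s s' := by
  let G : X → Bundle.TotalSpace F' W' := fun x => ⟨φ x, Φ x (s x)⟩
  have hG : ContMDiff 𝓘(ℝ, Model n) (𝓘(ℝ, Model n).prod 𝓘(ℝ, F')) ∞ G := hΦ.comp s.contMDiff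
  have hT : ∀ z, (G (φ.symm z)).1 = z := fun z => φ.apply_symm_apply z
  -- The fibre over `φ (φ.symm z)` is the fibre over `z` only after transport. As points of the
  -- total space the transported and original values coincide, and smoothness is tested there.
  let t : ∀ z, W' z := fun z => hT z ▸ (G (φ.symm z)).2
  have ht : ∀ z, (⟨z, t z⟩ : Bundle.TotalSpace F' W') = G (φ.symm z) := by
    intro z
    have : ∀ (p : Bundle.TotalSpace F' W') (h : p.1 = z),
        (⟨z, h ▸ p.2⟩ : Bundle.TotalSpace F' W') = p := by
      rintro p rfl; rfl
    exact this _ _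
  refine ⟨⟨t, ?_⟩, fun x => ?_⟩
  · simp only [ht]
    exact hG.comp φ.symm.contMDiff
  · have h := ht (φ x)
    rw [φ.symm_apply_apply] at h
    exact eq_of_heq (Bundle.TotalSpace.mk.inj h).2

theorem RelatedSections.unique {s : Sections n F W} {s' t' : Sections n F' W'}
    (h : RelatedSections φ Φ s s') (h' : RelatedSections φ Φ s t') : s' = t' := by
  ext z
  obtain ⟨x, rfl⟩ := φ.surjective z
  exact (h x).trans (h' x).symm

theorem RelatedSections.sub_smul {s t : Sections n F W} {s' t' : Sections n F' W'}
    (h : RelatedSections φ Φ s s') (h' : RelatedSections φ Φ t t') (c : ℝ) :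
    RelatedSections φ Φ (s - c • t) (s' - c • t') := by
  intro x
  have h1 : (s' - c • t') (φ x) = s' (φ x) - c • t' (φ x) := rfl
  have h2 : (s - c • t) x = s x - c • t x := rfl
  rw [h1, h2, h x, h' x, map_sub, map_smul]

/-- The image of `f • t` is the image of `t` multiplied by `f ∘ φ⁻¹`, and composition with `φ⁻¹`
carries powers of the ideal at `x` into those of the ideal at `φ x`. Consequently the isomorphism
acts on jets. -/
theorem RelatedSections.mem_vanishing
    (hΦ : ContMDiff (𝓘(ℝ, Model n).prod 𝓘(ℝ, F)) (𝓘(ℝ, Model n).prod 𝓘(ℝ, F')) ∞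
      (fun p : Bundle.TotalSpace F W => (⟨φ p.1, Φ p.1 p.2⟩ : Bundle.TotalSpace F' W')))
    {s : Sections n F W} {s' : Sections n F' W'} (h : RelatedSections φ Φ s s') {x : X}
    (hs : s ∈ vanishing n (Sections n F W) r x) :
    s' ∈ vanishing n (Sections n F' W') r (φ x) := by
  rw [vanishing] at hs
  induction hs using Submodule.smul_induction_on' generalizing s' with
  | smul f hf t _ =>
    obtain ⟨t', ht'⟩ := exists_relatedSections hΦ t
    have h1 : RelatedSections φ Φ (f • t) (pullbackFun φ.symm f • t') := by
      intro y
      rw [sections_smul_apply, sections_smul_apply, pullbackFun_apply, φ.symm_apply_apply, ht' y,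
        map_smul]
    rw [h.unique h1]
    refine Submodule.smul_mem_smul (pullbackFun_mem_pow φ.symm ?_) trivial
    rwa [φ.symm_apply_apply]
  | add a _ b _ ha hb =>
    obtain ⟨a', ha'⟩ := exists_relatedSections hΦ a
    obtain ⟨b', hb'⟩ := exists_relatedSections hΦ b
    have h1 : RelatedSections φ Φ (a + b) (a' + b') := by
      intro y
      have h1 : (a' + b') (φ y) = a' (φ y) + b' (φ y) := rfl
      have h2 : (a + b) y = a y + b y := rfl
      rw [h1, h2, ha' y, hb' y, map_add]
    rw [h.unique h1]
    exact add_mem (ha ha') (hb hb')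

/-- If the jet of `t` at `x` is `A x`, any `s` representing the multiple at `x` differs from `f (φ
x) • t` by a section vanishing to order `r`, and the image of that difference vanishes to order `r`
as well. -/
theorem RelatedJetSections.smul
    (hΦ : ContMDiff (𝓘(ℝ, Model n).prod 𝓘(ℝ, F)) (𝓘(ℝ, Model n).prod 𝓘(ℝ, F')) ∞
      (fun p : Bundle.TotalSpace F W => (⟨φ p.1, Φ p.1 p.2⟩ : Bundle.TotalSpace F' W')))
    {A : jetSections (X := X) n (Sections n F W) r}
    {A' : jetSections (X := X') n (Sections n F' W') r} (h : RelatedJetSections φ Φ A A')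
    (f : SmoothFun n X') : RelatedJetSections φ Φ (pullbackFun φ f • A) (f • A') := by
  intro x s s' hss' hs
  obtain ⟨t, ht⟩ := jet_surjective x (A.1 x)
  obtain ⟨t', ht'⟩ := exists_relatedSections hΦ t
  rw [jetSections_smul_apply, h x t t' ht' ht.symm]
  have h1 : s - f (φ x) • t ∈ vanishing n (Sections n F W) r x := by
    rw [← jet_eq_zero_iff, map_sub, LinearMap.map_smul, ← hs, ht, jetSections_smul_apply,
      pullbackFun_apply, sub_self]
  have h2 := (jet_eq_zero_iff n r (φ x) _).2
    ((hss'.sub_smul ht' (f (φ x))).mem_vanishing hΦ h1)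
  rw [map_sub, LinearMap.map_smul, sub_eq_zero] at h2
  exact h2.symm

theorem divergence_natural
    (hΦ : ContMDiff (𝓘(ℝ, Model n).prod 𝓘(ℝ, F)) (𝓘(ℝ, Model n).prod 𝓘(ℝ, F')) ∞
      (fun p : Bundle.TotalSpace F W => (⟨φ p.1, Φ p.1 p.2⟩ : Bundle.TotalSpace F' W')))
    {P : NonHolonomicStress n F W r} {P' : NonHolonomicStress n F' W' r}
    (hP : RelatedStresses φ Φ P P') :
    RelatedForces φ Φ (divergence n (Sections n F W) r P) (divergence n (Sections n F' W') r P') :=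
  fun _ _ hA => divergence_eq_pullbackForm fun f => hP _ _ (hA.smul hΦ f)

end Naturality

end HyperStress
end

noncomputable section
namespace HyperStress

set_option linter.unusedSectionVars false

/-! ### The divergence theorem on an orthant. -/

section Orthant

variable {n : ℕ}

/-- The orthant in which the coordinates in `S` are nonnegative. -/
def orthant (S : Finset (Fin (n + 1))) : Set (Model n) := {y | ∀ i ∈ S, 0 ≤ y i}

theorem isClosed_orthant (S : Finset (Fin (n + 1))) : IsClosed (orthant S) := by
  have : orthant S = ⋂ i ∈ S, {y : Model n | 0 ≤ y i} := by
    ext y; simp [orthant]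
  rw [this]
  refine isClosed_biInter fun i _ => isClosed_le continuous_const ?_
  exact (EuclideanSpace.proj i : Model n →L[ℝ] ℝ).continuous

theorem continuous_faceIncl (j : Fin (n + 1)) : Continuous (faceIncl (n := n) j) := by
  refine (PiLp.continuous_toLp 2 _).comp ?_
  refine continuous_pi fun i => ?_
  refine Fin.succAboveCases j ?_ (fun i => ?_) i
  · simp only [Fin.insertNth_apply_same]
    exact continuous_const
  · simp only [Fin.insertNth_apply_succAbove]
    exact (EuclideanSpace.proj i : EuclideanSpace ℝ (Fin n) →L[ℝ] ℝ).continuous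

/-- The divergence theorem for a box, applied to the field whose only component is `g` in direction
`j`. The upper `j`-face lies where `g` vanishes; the lower one does too unless `j ∈ S`, in which
case it is the wall of the orthant, with outward normal in the negative direction. -/
theorem setIntegral_pi_partialDeriv {g : (Fin (n + 1) → ℝ) → ℝ} (hg : ContDiff ℝ 1 g)
    (hc : HasCompactSupport g) (S : Finset (Fin (n + 1))) (j : Fin (n + 1)) :
    ∫ y in {y : Fin (n + 1) → ℝ | ∀ i ∈ S, 0 ≤ y i}, fderiv ℝ g y (Pi.single j 1) =
      if j ∈ S then -∫ z in {z : Fin n → ℝ | ∀ i ∈ S, 0 ≤ j.insertNth (α := fun _ => ℝ) 0 z i},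
        g (j.insertNth 0 z) else 0 := by
  classical
  obtain ⟨K, hK⟩ := hc.isCompact.isBounded.subset_closedBall 0
  -- Strictly larger than `K`, so that `g` and its derivative vanish wherever some coordinate
  -- reaches `L` in absolute value; the maximum with `0` covers a negative `K`, possible for empty
  -- support.
  set L : ℝ := max K 0 + 1
  have hL : 0 < L := by positivity
  have hKL : K < L := lt_of_le_of_lt (le_max_left _ _) (lt_add_one _)
  have hzero : ∀ y : Fin (n + 1) → ℝ, (∃ i, L ≤ |y i|) → y ∉ tsupport g := by
    rintro y ⟨i, hi⟩ hy
    have h1 := hK hy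
    rw [mem_closedBall_zero_iff] at h1
    have h2 := norm_le_pi_norm y i
    rw [Real.norm_eq_abs] at h2
    linarith
  have hg0 : ∀ y : Fin (n + 1) → ℝ, (∃ i, L ≤ |y i|) → g y = 0 :=
    fun y hy => image_eq_zero_of_notMem_tsupport (hzero y hy)
  have hdg0 : ∀ y : Fin (n + 1) → ℝ, (∃ i, L ≤ |y i|) → fderiv ℝ g y = 0 := fun y hy =>
    image_eq_zero_of_notMem_tsupport fun h => hzero y hy (tsupport_fderiv_subset ℝ h)
  -- The box is the part of the orthant in the cube of half-width `L`: it starts at the wall in the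
  -- constrained directions and outside the support in the others.
  let a : Fin (n + 1) → ℝ := fun i => if i ∈ S then 0 else -L
  let b : Fin (n + 1) → ℝ := fun _ => L
  have hab : a ≤ b := by
    intro i
    simp only [a, b]
    split_ifs <;> linarith
  have ha : ∀ i, -L ≤ a i := by
    intro i
    simp only [a]
    split_ifs <;> linarith
  have hdiv := integral_divergence_of_hasFDerivAt_off_countable' a b hab
    (fun i => if i = j then g else 0) (fun i => if i = j then fderiv ℝ g else 0) ∅ countable_empty
    (by
      intro i
      by_cases h : i = j
      · simpa [h] using hg.continuous.continuousOn
      · simp only [h, if_false]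
        exact continuousOn_const (c := (0 : ℝ)))
    (by
      intro x _ i
      by_cases h : i = j
      · simpa [h] using (hg.differentiable (by simp) x).hasFDerivAt
      · simp only [h, if_false]
        exact hasFDerivAt_const (0 : ℝ) x)
    (by
      refine Continuous.integrableOn_Icc ?_
      refine continuous_finsetSum _ fun i _ => ?_
      by_cases h : i = j
      · simpa [h] using (hg.continuous_fderiv (by simp)).clm_apply continuous_const
      · simpa [h] using continuous_const)
  have hsum : ∀ x : Fin (n + 1) → ℝ, ∑ i, (if i = j then fderiv ℝ g else 0) x (Pi.single i 1) =
      fderiv ℝ g x (Pi.single j 1) := by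
    intro x
    rw [Finset.sum_eq_single j]
    · simp
    · intro i _ h
      simp [h]
    · simp
  simp only [hsum] at hdiv
  rw [Finset.sum_eq_single j (by intro i _ h; simp [h]) (by simp)] at hdiv
  simp only [if_true] at hdiv
  have hQ : ∫ y in {y : Fin (n + 1) → ℝ | ∀ i ∈ S, 0 ≤ y i}, fderiv ℝ g y (Pi.single j 1) =
      ∫ y in Icc a b, fderiv ℝ g y (Pi.single j 1) := by
    refine setIntegral_eq_of_subset_of_forall_sdiff_eq_zero ?_ ?_ ?_
    · have : {y : Fin (n + 1) → ℝ | ∀ i ∈ S, 0 ≤ y i} = ⋂ i ∈ S, {y | 0 ≤ y i} := by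
        ext y; simp
      rw [this]
      exact (isClosed_biInter fun i _ => isClosed_le continuous_const
        (continuous_apply i)).measurableSet
    · intro y hy i hi
      have := hy.1 i
      simpa [a, hi] using this
    · rintro y ⟨hy, hy'⟩
      rw [hdg0 y]
      · rfl
      by_contra! hlt
      refine hy' ⟨fun i => ?_, fun i => (le_abs_self _).trans (hlt i).le⟩
      by_cases hi : i ∈ S
      · simpa [a, hi] using hy i hi
      · simpa [a, hi] using (abs_lt.1 (hlt i)).1.le
  rw [hQ, hdiv]
  have hfront : ∀ x : Fin n → ℝ, g (j.insertNth (b j) x) = 0 := fun x =>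
    hg0 _ ⟨j, by simp [b, le_abs_self]⟩
  simp only [hfront, integral_zero, zero_sub]
  split_ifs with hj
  · congr 1
    have haj : a j = 0 := by simp [a, hj]
    rw [haj]
    symm
    refine setIntegral_eq_of_subset_of_forall_sdiff_eq_zero ?_ ?_ ?_
    · have : {z : Fin n → ℝ | ∀ i ∈ S, 0 ≤ j.insertNth (α := fun _ => ℝ) 0 z i} =
          ⋂ i ∈ S, {z | 0 ≤ j.insertNth (α := fun _ => ℝ) 0 z i} := by
        ext y; simp
      rw [this]
      refine (isClosed_biInter fun i _ => isClosed_le continuous_const ?_).measurableSet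
      refine Fin.succAboveCases j ?_ (fun i => ?_) i
      · simp only [Fin.insertNth_apply_same]
        exact continuous_const
      · simp only [Fin.insertNth_apply_succAbove]
        exact continuous_apply i
    · intro z hz i hi
      revert hi
      refine Fin.succAboveCases j ?_ (fun i => ?_) i
      · simp
      · intro hi
        have := hz.1 i
        simpa [a, hi] using this
    · rintro z ⟨hz, hz'⟩
      refine hg0 _ ?_
      by_contra! hlt
      have hlt' : ∀ i, |z i| < L := fun i => by simpa using hlt (j.succAbove i)
      refine hz' ⟨fun i => ?_, fun i => (le_abs_self _).trans (hlt' i).le⟩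
      by_cases hi : j.succAbove i ∈ S
      · simpa [a, hi] using hz _ hi
      · simpa [a, hi] using (abs_lt.1 (hlt' i)).1.le
  · have hback : ∀ x : Fin n → ℝ, g (j.insertNth (a j) x) = 0 := fun x =>
      hg0 _ ⟨j, by simp [a, hj, abs_of_pos hL]⟩
    simp only [hback, integral_zero, neg_zero]

theorem setIntegral_orthant_partialDeriv {g : Model n → ℝ} (hg : ContDiff ℝ 1 g)
    (hc : HasCompactSupport g) (S : Finset (Fin (n + 1))) (j : Fin (n + 1)) :
    ∫ y in orthant S, fderiv ℝ g y (EuclideanSpace.single j 1) =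
      if j ∈ S then -∫ z in faceIncl j ⁻¹' orthant S, g (faceIncl j z) else 0 := by
  let L := (EuclideanSpace.equiv (Fin (n + 1)) ℝ).symm
  have h := setIntegral_pi_partialDeriv (g := g ∘ L) (hg.comp L.contDiff)
    (hc.comp_homeomorph L.toHomeomorph) S j
  have h1 : ∫ y in orthant S, fderiv ℝ g y (EuclideanSpace.single j 1) =
      ∫ y in {y : Fin (n + 1) → ℝ | ∀ i ∈ S, 0 ≤ y i}, fderiv ℝ (g ∘ L) y (Pi.single j 1) := by
    have := (PiLp.volume_preserving_toLp (Fin (n + 1))).setIntegral_preimage_emb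
      (MeasurableEquiv.toLp 2 (Fin (n + 1) → ℝ)).measurableEmbedding
      (fun y => fderiv ℝ g y (EuclideanSpace.single j 1)) (orthant S)
    rw [← this]
    refine integral_congr_ae (Eventually.of_forall fun y => ?_)
    simp only
    rw [fderiv_comp y (hg.differentiable (by simp) _) L.differentiableAt,
      ContinuousLinearMap.comp_apply, L.fderiv]
    rfl
  have h2 : ∫ z in faceIncl j ⁻¹' orthant S, g (faceIncl j z) =
      ∫ z in {z : Fin n → ℝ | ∀ i ∈ S, 0 ≤ j.insertNth (α := fun _ => ℝ) 0 z i},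
        (g ∘ L) (j.insertNth 0 z) := by
    have := (PiLp.volume_preserving_toLp (Fin n)).setIntegral_preimage_emb
      (MeasurableEquiv.toLp 2 (Fin n → ℝ)).measurableEmbedding
      (fun z => g (faceIncl j z)) (faceIncl j ⁻¹' orthant S)
    rw [← this]
    rfl
  rw [h1, h2, h]

end Orthant

end HyperStress
end

noncomputable section
namespace HyperStress

set_option linter.unusedSectionVars false

/-! ### Forms of top degree on the model space. -/

section TopForms

variable {n : ℕ}

/-- The standard frame of the model space. -/
def stdFrame (n : ℕ) (i : Fin (n + 1)) : Model n := EuclideanSpace.single i 1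

theorem topForm_eq_smul (α : Model n [⋀^Fin (n + 1)]→L[ℝ] ℝ) (T : Model n →L[ℝ] Model n) :
    α.compContinuousLinearMap T (stdFrame n) = T.det * α (stdFrame n) := by
  let e := (EuclideanSpace.basisFun (Fin (n + 1)) ℝ).toBasis
  have he : ⇑e = stdFrame n := by ext i : 1; simp [e, stdFrame]
  have h := α.toAlternatingMap.eq_smul_basis_det e
  have h1 : ∀ v, α v = α (stdFrame n) * e.det v := fun v => by
    have := DFunLike.congr_fun h v
    rw [he] at this
    exact this
  rw [ContinuousAlternatingMap.compContinuousLinearMap_apply, h1]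
  have h2 : e.det (⇑T ∘ stdFrame n) = T.det := by
    have := e.det_comp (T : Model n →ₗ[ℝ] Model n) (stdFrame n)
    rw [← he, e.det_self, mul_one, he] at this
    exact this
  rw [h2, mul_comm]

theorem topForm_eq_zero {α : Model n [⋀^Fin (n + 1)]→L[ℝ] ℝ} (h : α (stdFrame n) = 0) : α = 0 := by
  let e := (EuclideanSpace.basisFun (Fin (n + 1)) ℝ).toBasis
  have he : ⇑e = stdFrame n := by ext i : 1; simp [e, stdFrame]
  apply ContinuousAlternatingMap.toAlternatingMap_injective
  by_contra h0
  refine (AlternatingMap.map_basis_ne_zero_iff e α.toAlternatingMap).2 h0 ?_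
  rw [he]
  exact h

end TopForms

/-! ### Oriented coefficients of forms in a chart. -/

section Coeff

variable {n m : ℕ} {X : Type*} [TopologicalSpace X] [ChartedSpace (Model n) X]

/-- The coefficient of a form in a chart with respect to constant vectors, multiplied by the sign of
the chart with respect to the orientation, and extended by zero. -/
def orientedCoeff (vol : ∀ x : X, FormFiber n (n + 1) x) (e : OpenPartialHomeomorph X (Model n))
    (θ : ∀ x : X, FormFiber n m x) (v : Fin m → Model n) (y : Model n) : ℝ :=
  open scoped Classical in
  if y ∈ e.target then SignType.sign (formIn vol e y (stdFrame n)) * formIn θ e y v else 0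

variable [T2Space X] [IsManifold 𝓘(ℝ, Model n) ∞ X] {vol : ∀ x : X, FormFiber n (n + 1) x}
  {e e' : OpenPartialHomeomorph X (Model n)}

theorem orientedCoeff_of_mem {y : Model n} (hy : y ∈ e.target) (θ : ∀ x : X, FormFiber n m x)
    (v : Fin m → Model n) : orientedCoeff vol e θ v y =
      SignType.sign (formIn vol e y (stdFrame n)) * formIn θ e y v := if_pos hy

theorem orientedCoeff_of_notMem {y : Model n} (hy : y ∉ e.target) (θ : ∀ x : X, FormFiber n m x)
    (v : Fin m → Model n) : orientedCoeff vol e θ v y = 0 := if_neg hy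

theorem orientedCoeff_eq_zero {y : Model n} {θ : ∀ x : X, FormFiber n m x} (h : θ (e.symm y) = 0)
    (v : Fin m → Model n) : orientedCoeff vol e θ v y = 0 := by
  by_cases hy : y ∈ e.target
  · rw [orientedCoeff_of_mem hy, show formIn θ e y v = 0 from
      congrArg (fun η : FormFiber n m (e.symm y) => η fun i => frameMap e y (v i)) h, mul_zero]
  · exact orientedCoeff_of_notMem hy _ _

theorem orientedCoeff_congr {y : Model n} {θ θ' : ∀ x : X, FormFiber n m x}
    (h : θ (e.symm y) = θ' (e.symm y)) (v : Fin m → Model n) :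
    orientedCoeff vol e θ v y = orientedCoeff vol e θ' v y := by
  unfold orientedCoeff
  simp only [formIn_apply, h]

theorem orientedCoeff_add (θ θ' : ∀ x : X, FormFiber n m x) (v : Fin m → Model n) (y : Model n) :
    orientedCoeff vol e (θ + θ') v y = orientedCoeff vol e θ v y + orientedCoeff vol e θ' v y := by
  unfold orientedCoeff
  split_ifs
  · rw [← mul_add]
    rfl
  · simp

theorem orientedCoeff_smul (f : X → ℝ) (θ : ∀ x : X, FormFiber n m x) (v : Fin m → Model n)
    (y : Model n) :
    orientedCoeff vol e (fun x => f x • θ x) v y = f (e.symm y) * orientedCoeff vol e θ v y := by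
  unfold orientedCoeff
  split_ifs
  · rw [mul_left_comm]
    rfl
  · simp

theorem formIn_stdFrame_ne_zero (hvol₀ : ∀ x, vol x ≠ 0)
    (he : e ∈ IsManifold.maximalAtlas 𝓘(ℝ, Model n) ∞ X) {y : Model n} (hy : y ∈ e.target) :
    formIn vol e y (stdFrame n) ≠ 0 := by
  intro h
  have h1 := formIn_comp_coframeMap vol he (e.map_target hy)
  rw [e.right_inv hy, topForm_eq_zero h] at h1
  exact hvol₀ _ h1.symm

/-- A continuous coefficient without zeros has locally constant sign, so the orientation factor acts
as a constant under differentiation. -/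
theorem eventually_sign_eq (hvol : vol ∈ smoothForms n X (n + 1)) (hvol₀ : ∀ x, vol x ≠ 0)
    (he : e ∈ IsManifold.maximalAtlas 𝓘(ℝ, Model n) ∞ X) {y : Model n} (hy : y ∈ e.target) :
    ∀ᶠ z in 𝓝 y, SignType.sign (formIn vol e z (stdFrame n)) =
      SignType.sign (formIn vol e y (stdFrame n)) := by
  have h1 : ContinuousAt (fun z => formIn vol e z (stdFrame n)) y :=
    (contDiffAt_form_apply (contDiffAt_formIn hvol he hy) _).continuousAt
  rcases (formIn_stdFrame_ne_zero hvol₀ he hy).lt_or_gt with h | h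
  · filter_upwards [h1.eventually_lt continuousAt_const h] with z hz
    rw [sign_neg hz, sign_neg h]
  · filter_upwards [continuousAt_const.eventually_lt h1 h] with z hz
    rw [sign_pos hz, sign_pos h]

theorem eventually_orientedCoeff_eq (hvol : vol ∈ smoothForms n X (n + 1)) (hvol₀ : ∀ x, vol x ≠ 0)
    (he : e ∈ IsManifold.maximalAtlas 𝓘(ℝ, Model n) ∞ X) {y : Model n} (hy : y ∈ e.target)
    (θ : ∀ x : X, FormFiber n m x) (v : Fin m → Model n) : orientedCoeff vol e θ v =ᶠ[𝓝 y]
      fun z => SignType.sign (formIn vol e y (stdFrame n)) * formIn θ e z v := by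
  filter_upwards [eventually_sign_eq hvol hvol₀ he hy, e.open_target.mem_nhds hy] with z hz hz'
  rw [orientedCoeff_of_mem hz', hz]

theorem tsupport_orientedCoeff_subset {θ : ∀ x : X, FormFiber n m x} {K : Set X} (hK : IsCompact K)
    (hKe : K ⊆ e.source) (hθK : ∀ x ∉ K, θ x = 0) (v : Fin m → Model n) :
    tsupport (orientedCoeff vol e θ v) ⊆ e '' K := by
  refine closure_minimal ?_ (hK.image_of_continuousOn (e.continuousOn.mono hKe)).isClosed
  intro y hy
  have h1 : y ∈ e.target := by
    by_contra h
    exact hy (orientedCoeff_of_notMem h _ _)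
  have h2 : e.symm y ∈ K := by
    by_contra h
    exact hy (orientedCoeff_eq_zero (hθK _ h) _)
  exact ⟨_, h2, e.right_inv h1⟩

theorem hasCompactSupport_orientedCoeff {θ : ∀ x : X, FormFiber n m x} {K : Set X} (hK : IsCompact K)
    (hKe : K ⊆ e.source) (hθK : ∀ x ∉ K, θ x = 0) (v : Fin m → Model n) :
    HasCompactSupport (orientedCoeff vol e θ v) :=
  (hK.image_of_continuousOn (e.continuousOn.mono hKe)).of_isClosed_subset (isClosed_tsupport _)
    (tsupport_orientedCoeff_subset hK hKe hθK v)

/-- Inside the chart the coefficient is smooth. The image of `K` is compact, hence closed, and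
contained in the target, so the extension by zero vanishes near every point outside the target. -/
theorem contDiff_orientedCoeff (hvol : vol ∈ smoothForms n X (n + 1)) (hvol₀ : ∀ x, vol x ≠ 0)
    (he : e ∈ IsManifold.maximalAtlas 𝓘(ℝ, Model n) ∞ X) {θ : ∀ x : X, FormFiber n m x}
    (hθ : θ ∈ smoothForms n X m) {K : Set X} (hK : IsCompact K) (hKe : K ⊆ e.source)
    (hθK : ∀ x ∉ K, θ x = 0) (v : Fin m → Model n) : ContDiff ℝ ∞ (orientedCoeff vol e θ v) := by
  rw [contDiff_iff_contDiffAt]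
  intro y
  by_cases hy : y ∈ e.target
  · refine ContDiffAt.congr_of_eventuallyEq ?_ (eventually_orientedCoeff_eq hvol hvol₀ he hy θ v)
    exact contDiffAt_const.mul (contDiffAt_form_apply (contDiffAt_formIn hθ he hy) v)
  · have h : y ∉ tsupport (orientedCoeff vol e θ v) := by
      intro h
      obtain ⟨x, hx, rfl⟩ := tsupport_orientedCoeff_subset hK hKe hθK v h
      exact hy (e.map_source (hKe hx))
    exact contDiffAt_const.congr_of_eventuallyEq (notMem_tsupport_iff_eventuallyEq.1 h)

theorem orientedCoeff_dForm (hvol : vol ∈ smoothForms n X (n + 1)) (hvol₀ : ∀ x, vol x ≠ 0)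
    (he : e ∈ IsManifold.maximalAtlas 𝓘(ℝ, Model n) ∞ X) {θ : ∀ x : X, FormFiber n n x}
    (hθ : θ ∈ smoothForms n X n) {y : Model n} (hy : y ∈ e.target) :
    orientedCoeff vol e (dForm n θ) (stdFrame n) y = ∑ j : Fin (n + 1), (-1) ^ (j : ℕ) *
      fderiv ℝ (orientedCoeff vol e θ (j.removeNth (stdFrame n))) y (stdFrame n j) := by
  have hd := (contDiffAt_formIn hθ he hy).differentiableAt (by simp)
  rw [orientedCoeff_of_mem hy, formIn_dForm hθ he hy, extDeriv,
    ContinuousAlternatingMap.alternatizeUncurryFin_apply, Finset.mul_sum]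
  refine Finset.sum_congr rfl fun j _ => ?_
  rw [(eventually_orientedCoeff_eq hvol hvol₀ he hy θ _).fderiv_eq]
  have h1 : DifferentiableAt ℝ (fun z => formIn θ e z (j.removeNth (stdFrame n))) y :=
    (contDiffAt_form_apply (contDiffAt_formIn hθ he hy) _).differentiableAt (by simp)
  have h2 : fderiv ℝ (fun z => formIn θ e z (j.removeNth (stdFrame n))) y (stdFrame n j) =
      fderiv ℝ (formIn θ e) y (stdFrame n j) (j.removeNth (stdFrame n)) := by
    let ev : (Model n [⋀^Fin n]→L[ℝ] ℝ) →L[ℝ] ℝ := LinearMap.toContinuousLinearMap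
      ({ toFun := fun α => α (j.removeNth (stdFrame n)), map_add' := fun _ _ => rfl,
         map_smul' := fun _ _ => rfl } : (Model n [⋀^Fin n]→L[ℝ] ℝ) →ₗ[ℝ] ℝ)
    have := (ev.hasFDerivAt.comp y hd.hasFDerivAt).fderiv
    exact DFunLike.congr_fun this (stdFrame n j)
  rw [fderiv_const_mul h1, smul_apply, smul_eq_mul, h2, zsmul_eq_mul]
  push_cast
  ring

/-- Both the form and `vol` acquire the Jacobian determinant. The sign contributed by `vol` turns
this determinant into its absolute value, as the change of variables formula for Lebesgue measure
demands. -/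
theorem orientedCoeff_transition (he : e ∈ IsManifold.maximalAtlas 𝓘(ℝ, Model n) ∞ X)
    (he' : e' ∈ IsManifold.maximalAtlas 𝓘(ℝ, Model n) ∞ X) (θ : ∀ x : X, FormFiber n (n + 1) x)
    {y : Model n} (hy : y ∈ e.target) (hy' : e.symm y ∈ e'.source) :
    orientedCoeff vol e θ (stdFrame n) y = |(fderiv ℝ (e' ∘ e.symm) y).det| *
      orientedCoeff vol e' θ (stdFrame n) ((e' ∘ e.symm) y) := by
  rw [orientedCoeff_of_mem hy,
    orientedCoeff_of_mem (show (e' ∘ e.symm) y ∈ e'.target from e'.map_source hy'),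
    formIn_transition he he' vol hy hy', formIn_transition he he' θ hy hy', topForm_eq_smul,
    topForm_eq_smul, sign_mul, SignType.coe_mul, ← sign_mul_self]
  ring

end Coeff

end HyperStress
end

noncomputable section
namespace HyperStress

set_option linter.unusedSectionVars false

/-! ### Integration and the divergence theorem in one adapted chart. -/

section Stokes

variable {n m : ℕ} {X : Type*} [TopologicalSpace X] [ChartedSpace (Model n) X]

namespace CornerChart

variable {R : Set X} (c : CornerChart n R)

theorem measurableSet_domain : MeasurableSet c.domain :=
  c.chart.open_target.measurableSet.inter (isClosed_orthant _).measurableSet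

theorem measurableSet_faceDomain (j : Fin (n + 1)) : MeasurableSet (c.faceDomain j) :=
  (continuous_faceIncl j).measurable c.measurableSet_domain

theorem symm_mem {y : Model n} (hy : y ∈ c.domain) : c.chart.symm y ∈ R := by
  rw [c.mem_iff _ (c.chart.map_target hy.1), c.chart.right_inv hy.1]
  exact hy.2

theorem apply_mem_domain {x : X} (hx : x ∈ c.chart.source) (hR : x ∈ R) : c.chart x ∈ c.domain :=
  ⟨c.chart.map_source hx, (c.mem_iff x hx).1 hR⟩

/-- The integral over the domain of a chart. -/
def chartIntegral (vol : ∀ x : X, FormFiber n (n + 1) x) (θ : ∀ x : X, FormFiber n (n + 1) x) : ℝ :=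
  ∫ y in c.domain, orientedCoeff vol c.chart θ (stdFrame n) y

variable {c} {c' : CornerChart n R} {vol : ∀ x : X, FormFiber n (n + 1) x}

theorem chartIntegral_congr [T2Space X] [IsManifold 𝓘(ℝ, Model n) ∞ X]
    {θ θ' : ∀ x : X, FormFiber n (n + 1) x} (h : ∀ x ∈ R, θ x = θ' x) :
    c.chartIntegral vol θ = c.chartIntegral vol θ' :=
  setIntegral_congr_fun c.measurableSet_domain fun _ hy => orientedCoeff_congr (h _ (c.symm_mem hy)) _

variable [T2Space X] [IsManifold 𝓘(ℝ, Model n) ∞ X]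

theorem integrableOn_orientedCoeff (hvol : vol ∈ smoothForms n X (n + 1)) (hvol₀ : ∀ x, vol x ≠ 0)
    {θ : ∀ x : X, FormFiber n (n + 1) x} (hθ : θ ∈ smoothForms n X (n + 1)) {K : Set X}
    (hK : IsCompact K) (hKe : K ⊆ c.chart.source) (hθK : ∀ x ∉ K, θ x = 0) :
    IntegrableOn (orientedCoeff vol c.chart θ (stdFrame n)) c.domain :=
  ((contDiff_orientedCoeff hvol hvol₀ c.mem_maximalAtlas hθ hK hKe hθK
    _).continuous.integrable_of_hasCompactSupport
    (hasCompactSupport_orientedCoeff hK hKe hθK _)).integrableOn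

theorem chartIntegral_sum (hvol : vol ∈ smoothForms n X (n + 1)) (hvol₀ : ∀ x, vol x ≠ 0)
    {ι : Type*} (s : Finset ι) {θ : ι → ∀ x : X, FormFiber n (n + 1) x}
    (hθ : ∀ i, θ i ∈ smoothForms n X (n + 1)) {K : Set X}
    (hK : IsCompact K) (hKe : K ⊆ c.chart.source) (hθK : ∀ i, ∀ x ∉ K, θ i x = 0) :
    c.chartIntegral vol (∑ i ∈ s, θ i) = ∑ i ∈ s, c.chartIntegral vol (θ i) := by
  unfold chartIntegral
  rw [← integral_finsetSum _ fun i _ =>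
    integrableOn_orientedCoeff hvol hvol₀ (hθ i) hK hKe (hθK i)]
  congr 1
  ext y
  classical
  induction s using Finset.induction_on with
  | empty => exact orientedCoeff_eq_zero rfl _
  | insert i s hi ih => rw [Finset.sum_insert hi, Finset.sum_insert hi, orientedCoeff_add, ih]

theorem chartIntegral_add (hvol : vol ∈ smoothForms n X (n + 1)) (hvol₀ : ∀ x, vol x ≠ 0)
    {θ θ' : ∀ x : X, FormFiber n (n + 1) x} (hθ : θ ∈ smoothForms n X (n + 1))
    (hθ' : θ' ∈ smoothForms n X (n + 1)) {K : Set X}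
    (hK : IsCompact K) (hKe : K ⊆ c.chart.source) (hθK : ∀ x ∉ K, θ x = 0)
    (hθK' : ∀ x ∉ K, θ' x = 0) :
    c.chartIntegral vol (θ + θ') = c.chartIntegral vol θ + c.chartIntegral vol θ' := by
  unfold chartIntegral
  rw [← integral_add (integrableOn_orientedCoeff hvol hvol₀ hθ hK hKe hθK)
    (integrableOn_orientedCoeff hvol hvol₀ hθ' hK hKe hθK')]
  simp only [orientedCoeff_add]

/-- The divergence theorem in a chart. -/
theorem chartIntegral_dForm (hvol : vol ∈ smoothForms n X (n + 1)) (hvol₀ : ∀ x, vol x ≠ 0)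
    {η : ∀ x : X, FormFiber n n x} (hη : η ∈ smoothForms n X n) {K : Set X}
    (hK : IsCompact K) (hKe : K ⊆ c.chart.source) (hηK : ∀ x ∉ K, η x = 0) :
    c.chartIntegral vol (dForm n η) = ∑ j ∈ c.faces, ∫ y in c.faceDomain j,
      -(-1) ^ (j : ℕ) * orientedCoeff vol c.chart η (j.removeNth (stdFrame n)) (faceIncl j y) := by
  have hG := fun j : Fin (n + 1) => contDiff_orientedCoeff hvol hvol₀ c.mem_maximalAtlas hη hK hKe hηK
    (j.removeNth (stdFrame n))
  have hGc := fun j : Fin (n + 1) => hasCompactSupport_orientedCoeff (vol := vol) hK hKe hηK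
    (j.removeNth (stdFrame n))
  -- The coefficients vanish outside the chart target, so the domain may be replaced by the full
  -- orthant.
  have h1 : c.chartIntegral vol (dForm n η) = ∫ y in orthant c.faces, ∑ j : Fin (n + 1),
      (-1) ^ (j : ℕ) * fderiv ℝ (orientedCoeff vol c.chart η (j.removeNth (stdFrame n))) y
        (stdFrame n j) := by
    have h2 : ∀ y, orientedCoeff vol c.chart (dForm n η) (stdFrame n) y = ∑ j : Fin (n + 1),
        (-1) ^ (j : ℕ) * fderiv ℝ (orientedCoeff vol c.chart η (j.removeNth (stdFrame n))) y
          (stdFrame n j) := by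
      intro y
      by_cases hy : y ∈ c.chart.target
      · exact orientedCoeff_dForm hvol hvol₀ c.mem_maximalAtlas hη hy
      · rw [orientedCoeff_of_notMem hy]
        refine (Finset.sum_eq_zero fun j _ => ?_).symm
        have h3 : y ∉ tsupport (orientedCoeff vol c.chart η (j.removeNth (stdFrame n))) := by
          intro h
          obtain ⟨x, hx, rfl⟩ := tsupport_orientedCoeff_subset hK hKe hηK _ h
          exact hy (c.chart.map_source (hKe hx))
        rw [(notMem_tsupport_iff_eventuallyEq.1 h3).fderiv_eq]
        simp
    simp only [← h2]
    unfold chartIntegral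
    symm
    refine setIntegral_eq_of_subset_of_forall_sdiff_eq_zero (isClosed_orthant _).measurableSet
      (fun _ h => h.2) ?_
    intro y hy
    exact orientedCoeff_of_notMem (fun h => hy.2 ⟨h, hy.1⟩) _ _
  rw [h1, integral_finsetSum]
  -- The sign `(-1) ^ j` of the coordinate expression of d and the minus sign of the wall combine to
  -- the boundary orientation of the face.
  · have h4 : ∀ j : Fin (n + 1), ∫ y in orthant c.faces, (-1) ^ (j : ℕ) *
        fderiv ℝ (orientedCoeff vol c.chart η (j.removeNth (stdFrame n))) y (stdFrame n j) =
        if j ∈ c.faces then ∫ y in c.faceDomain j, -(-1) ^ (j : ℕ) *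
          orientedCoeff vol c.chart η (j.removeNth (stdFrame n)) (faceIncl j y) else 0 := by
      intro j
      rw [integral_const_mul]
      have h5 := setIntegral_orthant_partialDeriv ((hG j).of_le (by simp)) (hGc j) c.faces j
      rw [show ∫ y in orthant c.faces, fderiv ℝ
        (orientedCoeff vol c.chart η (j.removeNth (stdFrame n))) y (stdFrame n j) = _ from h5]
      split_ifs with hj
      · rw [integral_const_mul, mul_neg, neg_mul]
        congr 2
        refine setIntegral_eq_of_subset_of_forall_sdiff_eq_zero
          ((continuous_faceIncl j).measurable (isClosed_orthant _).measurableSet) (fun _ h => h.2) ?_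
        intro y hy
        exact orientedCoeff_of_notMem (fun h => hy.2 ⟨h, hy.1⟩) _ _
      · rw [mul_zero]
    simp only [h4]
    rw [Finset.sum_ite_mem, Finset.univ_inter]
  · intro j _
    refine Integrable.integrableOn ?_
    refine Integrable.const_mul ?_ _
    refine Continuous.integrable_of_hasCompactSupport ?_ ?_
    · exact ((hG j).continuous_fderiv (by simp)).clm_apply continuous_const
    · exact (hGc j).fderiv_apply ℝ _

/-- Only the overlap of the two charts contributes, and there the change of variables formula with
`orientedCoeff_transition` applies. Both charts describe the same `R`, so the transition map carries
one part `A c c'` onto the other. -/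
theorem chartIntegral_eq_of_support {θ : ∀ x : X, FormFiber n (n + 1) x}
    (h : ∀ x ∈ R, θ x ≠ 0 → x ∈ c.chart.source ∧ x ∈ c'.chart.source) :
    c.chartIntegral vol θ = c'.chartIntegral vol θ := by
  let A : CornerChart n R → CornerChart n R → Set (Model n) := fun c c' =>
    c.domain ∩ (c.chart.symm.trans c'.chart).source
  have hA : ∀ c c' : CornerChart n R, MeasurableSet (A c c') := fun c c' =>
    c.measurableSet_domain.inter (OpenPartialHomeomorph.open_source _).measurableSet
  have h1 : ∀ c c' : CornerChart n R, (∀ x ∈ R, θ x ≠ 0 → x ∈ c'.chart.source) →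
      ∫ y in A c c', orientedCoeff vol c.chart θ (stdFrame n) y = c.chartIntegral vol θ := by
    intro c c' h
    symm
    refine setIntegral_eq_of_subset_of_forall_sdiff_eq_zero c.measurableSet_domain (fun _ h => h.1) ?_
    intro y hy
    refine orientedCoeff_eq_zero ?_ _
    by_contra h0
    refine hy.2 ⟨hy.1, ?_⟩
    rw [OpenPartialHomeomorph.trans_source]
    exact ⟨hy.1.1, h _ (c.symm_mem hy.1) h0⟩
  have hmaps : ∀ c c' : CornerChart n R, ∀ y ∈ A c c', (c'.chart ∘ c.chart.symm) y ∈ A c' c := by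
    intro c c' y hy
    have h2 : c.chart.symm y ∈ c'.chart.source := hy.2.2
    refine ⟨c'.apply_mem_domain h2 (c.symm_mem hy.1), ?_⟩
    rw [OpenPartialHomeomorph.trans_source]
    refine ⟨c'.chart.map_source h2, ?_⟩
    simp only [mem_preimage, Function.comp_apply]
    rw [c'.chart.left_inv h2]
    exact c.chart.map_target hy.1.1
  have hinv : ∀ c c' : CornerChart n R, ∀ y ∈ A c c',
      (c.chart ∘ c'.chart.symm) ((c'.chart ∘ c.chart.symm) y) = y := by
    intro c c' y hy
    have h2 : c.chart.symm y ∈ c'.chart.source := hy.2.2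
    simp only [Function.comp_apply]
    rw [c'.chart.left_inv h2, c.chart.right_inv hy.1.1]
  have himg : (c'.chart ∘ c.chart.symm) '' A c c' = A c' c := by
    refine Subset.antisymm (image_subset_iff.2 (hmaps c c')) fun z hz => ?_
    exact ⟨_, hmaps c' c z hz, hinv c' c z hz⟩
  rw [← h1 c c' fun x hx h0 => (h x hx h0).2, ← h1 c' c fun x hx h0 => (h x hx h0).1, ← himg,
    integral_image_eq_integral_abs_det_fderiv_smul volume (hA c c')
      (f' := fderiv ℝ (c'.chart ∘ c.chart.symm))]
  · refine setIntegral_congr_fun (hA c c') fun y hy => ?_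
    exact orientedCoeff_transition c.mem_maximalAtlas c'.mem_maximalAtlas θ hy.1.1 hy.2.2
  · intro y hy
    exact ((contDiffAt_transition c.mem_maximalAtlas c'.mem_maximalAtlas hy.1.1
      hy.2.2).differentiableAt (by simp)).hasFDerivAt.hasFDerivWithinAt
  · exact (show Set.LeftInvOn _ _ _ from hinv c c').injOn

end CornerChart

end Stokes

end HyperStress
end

noncomputable section
namespace HyperStress

set_option linter.unusedSectionVars false

/-! ### Stokes' theorem for a subbody. -/

section Global

variable {n m : ℕ} {X : Type*} [TopologicalSpace X] [ChartedSpace (Model n) X]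
  [IsManifold 𝓘(ℝ, Model n) ∞ X] [T2Space X] [SigmaCompactSpace X]

/-- The support of a weight is closed and inside its chart but need not be compact. Only germs along
`R` matter, so the weight is multiplied by a cutoff that equals 1 near the compact part of the
support lying in `R`. -/
theorem exists_smoothFun_compact_support {w : SmoothFun n X} {U R : Set X} (hU : IsOpen U)
    (hw : tsupport w ⊆ U) (hR : IsCompact R) : ∃ (v : SmoothFun n X) (K : Set X), IsCompact K ∧
      K ⊆ U ∧ (∀ x ∉ K, v x = 0) ∧ ∀ x ∈ R, ⇑v =ᶠ[𝓝 x] w := by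
  have : LocallyCompactSpace X := ChartedSpace.locallyCompactSpace (Model n) X
  have hC : IsCompact (tsupport w ∩ R) := hR.inter_left (isClosed_tsupport _)
  obtain ⟨K, hK, hCK, hKU⟩ := exists_compact_between hC hU (fun x hx => hw hx.1)
  obtain ⟨χ, h1, h0, -⟩ := exists_contMDiffMap_one_nhds_of_subset_interior 𝓘(ℝ, Model n) (n := (⊤ : ℕ∞))
    hC.isClosed hCK
  refine ⟨χ * w, K, hK, hKU, fun x hx => ?_, fun x hx => ?_⟩
  · rw [ContMDiffMap.coe_mul, Pi.mul_apply, h0 x hx, zero_mul]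
  · by_cases hx' : x ∈ tsupport w
    · have hx2 : x ∈ tsupport w ∩ R := ⟨hx', hx⟩
      filter_upwards [h1.filter_mono (nhds_le_nhdsSet hx2)] with y hy
      rw [ContMDiffMap.coe_mul, Pi.mul_apply, hy, one_mul]
    · filter_upwards [notMem_tsupport_iff_eventuallyEq.1 hx'] with y hy
      rw [ContMDiffMap.coe_mul, Pi.mul_apply, hy]
      exact mul_zero _

theorem diffAt_eq_zero_of_isLocalMax {f : SmoothFun n X} {x : X} (h : IsLocalMax f x) :
    diffAt n f x = 0 := by
  set e := chartAt (Model n) x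
  have he : e ∈ IsManifold.maximalAtlas 𝓘(ℝ, Model n) ∞ X := IsManifold.chart_mem_maximalAtlas _
  have hx : x ∈ e.source := mem_chart_source _ _
  have h1 : IsLocalMax (fun z => f (e.symm z)) (e x) := by
    have h2 : Tendsto e.symm (𝓝 (e x)) (𝓝 x) := by
      have := e.symm.continuousAt (e.map_source hx)
      rwa [ContinuousAt, e.left_inv hx] at this
    have h3 : ∀ᶠ z in 𝓝 (e x), f (e.symm z) ≤ f x := h2.eventually h
    rw [IsLocalMax, IsMaxFilter, e.left_inv hx]
    exact h3
  have h4 := h1.fderiv_eq_zero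
  rw [fderiv_smoothFun_chart_symm he f (e.map_source hx), e.left_inv hx] at h4
  ext v
  have h5 := DFunLike.congr_fun h4 (coframeMap e x v)
  rw [ContinuousLinearMap.comp_apply, frameMap_coframeMap he hx] at h5
  exact h5

theorem wedgeAt_sum_left {ι : Type*} (s : Finset ι) (x : X) (α : ι → Model n →L[ℝ] ℝ)
    (η : FormFiber n m x) : wedgeAt x (∑ i ∈ s, α i) η = ∑ i ∈ s, wedgeAt x (α i) η := by
  let L : (Model n →L[ℝ] ℝ) →+ FormFiber n (m + 1) x := AddMonoidHom.mk' (fun α => wedgeAt x α η) (by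
    intro α β
    refine ContinuousAlternatingMap.ext fun v => ?_
    refine (wedgeForm_apply (α + β) η v).trans ?_
    refine Eq.trans ?_ (congrArg₂ (· + ·) (wedgeForm_apply α η v) (wedgeForm_apply β η v)).symm
    rw [← Finset.sum_add_distrib]
    refine Finset.sum_congr rfl fun k _ => ?_
    rw [← mul_add, ← add_mul]
    rfl)
  exact map_sum L α s

/-- The weights sum to 1 only on `R`, and `x` may be a boundary point. Still, the sum is at most 1
everywhere, so each point of `R` is a maximum and the differential vanishes. -/
theorem sum_diffAt_weight_eq_zero {N : ℕ} {R : Set X}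
    (w : SmoothPartitionOfUnity (Fin N) 𝓘(ℝ, Model n) X R) {x : X} (hx : x ∈ R) :
    ∑ k, diffAt n (w k) x = 0 := by
  have h1 := diffAt_sum_smul (n := n) (fun _ => 1) (fun k => (w k : SmoothFun n X)) x
  simp only [one_smul] at h1
  rw [← h1]
  have h2 : ∀ y, (∑ k, (w k : SmoothFun n X)) y = ∑ᶠ k, w k y := by
    intro y
    have := smoothFun_sum_smul_eval (n := n) (fun _ => 1) (fun k => (w k : SmoothFun n X)) y
    simp only [one_smul, one_mul] at this
    rw [this, finsum_eq_sum_of_fintype]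
  refine diffAt_eq_zero_of_isLocalMax (Eventually.of_forall fun y => ?_)
  rw [h2, h2, w.sum_eq_one hx]
  exact w.sum_le_one y

namespace Subbody

variable (R : Subbody n X) (vol : ∀ x : X, FormFiber n (n + 1) x)

/-- A weight of the cover, cut off away from the subbody so that it has compact support in the
domain of its chart. -/
def cutoff (k : Fin R.cover.card) : SmoothFun n X :=
  (exists_smoothFun_compact_support (w := R.cover.weight k) (R.cover.chart k).chart.open_source
    (R.cover.subordinate k) R.isCompact).choose

/-- A compact set in the domain of the chart that contains the support of `cutoff`. -/
def cutoffSet (k : Fin R.cover.card) : Set X :=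
  (exists_smoothFun_compact_support (w := R.cover.weight k) (R.cover.chart k).chart.open_source
    (R.cover.subordinate k) R.isCompact).choose_spec.choose

variable (k : Fin R.cover.card)

theorem isCompact_cutoffSet : IsCompact (R.cutoffSet k) :=
  (exists_smoothFun_compact_support (w := R.cover.weight k) (R.cover.chart k).chart.open_source
    (R.cover.subordinate k) R.isCompact).choose_spec.choose_spec.1

theorem cutoffSet_subset : R.cutoffSet k ⊆ (R.cover.chart k).chart.source :=
  (exists_smoothFun_compact_support (w := R.cover.weight k) (R.cover.chart k).chart.open_source
    (R.cover.subordinate k) R.isCompact).choose_spec.choose_spec.2.1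

theorem cutoff_eq_zero {x : X} (hx : x ∉ R.cutoffSet k) : R.cutoff k x = 0 :=
  (exists_smoothFun_compact_support (w := R.cover.weight k) (R.cover.chart k).chart.open_source
    (R.cover.subordinate k) R.isCompact).choose_spec.choose_spec.2.2.1 x hx

theorem cutoff_eventuallyEq {x : X} (hx : x ∈ R.carrier) :
    ⇑(R.cutoff k) =ᶠ[𝓝 x] R.cover.weight k :=
  (exists_smoothFun_compact_support (w := R.cover.weight k) (R.cover.chart k).chart.open_source
    (R.cover.subordinate k) R.isCompact).choose_spec.choose_spec.2.2.2 x hx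

theorem sum_cutoff {x : X} (hx : x ∈ R.carrier) : ∑ k, R.cutoff k x = 1 := by
  rw [← R.cover.weight.sum_eq_one hx, finsum_eq_sum_of_fintype]
  exact Finset.sum_congr rfl fun k _ => (R.cutoff_eventuallyEq k hx).self_of_nhds

theorem sum_diffAt_cutoff {x : X} (hx : x ∈ R.carrier) : ∑ k, diffAt n (R.cutoff k) x = 0 := by
  rw [← sum_diffAt_weight_eq_zero R.cover.weight hx]
  exact Finset.sum_congr rfl fun k _ => (R.cutoff_eventuallyEq k hx).mfderiv_eq

theorem cutoff_smul_eq_zero (θ : ∀ x : X, FormFiber n m x) {x : X} (hx : x ∉ R.cutoffSet k) :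
    R.cutoff k x • θ x = 0 := by
  rw [R.cutoff_eq_zero k hx]
  exact zero_smul ℝ _

theorem integral_eq_sum (θ : ∀ x : X, FormFiber n (n + 1) x) : R.integral vol θ =
    ∑ k, (R.cover.chart k).chartIntegral vol (fun x => R.cutoff k x • θ x) := by
  refine Finset.sum_congr rfl fun k _ => ?_
  refine setIntegral_congr_fun (R.cover.chart k).measurableSet_domain fun y hy => ?_
  rw [orientedCoeff_smul, orientedCoeff_of_mem hy.1,
    (R.cutoff_eventuallyEq k ((R.cover.chart k).symm_mem hy)).self_of_nhds]
  rfl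

variable {vol}

theorem integral_add (hvol : vol ∈ smoothForms n X (n + 1)) (hvol₀ : ∀ x, vol x ≠ 0)
    {θ θ' : ∀ x : X, FormFiber n (n + 1) x} (hθ : θ ∈ smoothForms n X (n + 1))
    (hθ' : θ' ∈ smoothForms n X (n + 1)) :
    R.integral vol (fun x => θ x + θ' x) = R.integral vol θ + R.integral vol θ' := by
  simp only [integral_eq_sum]
  rw [← Finset.sum_add_distrib]
  refine Finset.sum_congr rfl fun k _ => ?_
  rw [← CornerChart.chartIntegral_add hvol hvol₀ (smul_mem_smoothForms n _ hθ)
    (smul_mem_smoothForms n _ hθ') (R.isCompact_cutoffSet k) (R.cutoffSet_subset k)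
    (fun x hx => R.cutoff_smul_eq_zero k θ hx) (fun x hx => R.cutoff_smul_eq_zero k θ' hx)]
  refine CornerChart.chartIntegral_congr fun x _ => ?_
  exact smul_add _ _ _

theorem integral_congr {θ θ' : ∀ x : X, FormFiber n (n + 1) x} (h : ∀ x, θ x = θ' x) :
    R.integral vol θ = R.integral vol θ' := by
  rw [show θ = θ' from funext h]

theorem integral_neg (θ : ∀ x : X, FormFiber n (n + 1) x) :
    R.integral vol (fun x => -θ x) = -R.integral vol θ := by
  unfold integral
  rw [← Finset.sum_neg_distrib]
  refine Finset.sum_congr rfl fun k _ => ?_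
  rw [← MeasureTheory.integral_neg]
  refine integral_congr_ae (Eventually.of_forall fun y => ?_)
  simp only [← mul_neg]
  rfl

theorem diffAt_cutoff_eq_zero {x : X} (hx : x ∉ R.cutoffSet k) : diffAt n (R.cutoff k) x = 0 := by
  have h : ⇑(R.cutoff k) =ᶠ[𝓝 x] fun _ => 0 :=
    mem_of_superset ((R.isCompact_cutoffSet k).isClosed.isOpen_compl.mem_nhds hx)
      fun y hy => R.cutoff_eq_zero k hy
  exact h.mfderiv_eq.trans mfderiv_const

/-- Stokes' theorem for a subbody. -/
theorem integral_dForm (hvol : vol ∈ smoothForms n X (n + 1)) (hvol₀ : ∀ x, vol x ≠ 0)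
    {η : ∀ x : X, FormFiber n n x} (hη : η ∈ smoothForms n X n) :
    R.integral vol (dForm n η) =
      R.boundaryIntegral vol fun x H => (η x).compContinuousLinearMap H.subtypeL := by
  set c := R.cover.chart
  set v := R.cutoff
  have hv : ∀ k, (fun x => v k x • η x) ∈ smoothForms n X n := fun k => smul_mem_smoothForms n _ hη
  have hvd : ∀ k, (fun x => v k x • dForm n η x) ∈ smoothForms n X (n + 1) := fun k =>
    smul_mem_smoothForms n _ (dForm_mem_smoothForms hη)
  -- The error terms dv_k ∧ η of the Leibniz rule, which add up to zero on the body.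
  let θ : Fin R.cover.card → ∀ x : X, FormFiber n (n + 1) x := fun k x =>
    wedgeAt x (diffAt n (v k) x) (η x)
  have hd : ∀ k, dForm n (fun x => v k x • η x) = (fun x => v k x • dForm n η x) + θ k := fun k =>
    funext fun x => dForm_smoothFun_smul (v k) hη x
  -- Smoothness of the error term follows from writing it as a difference of two smooth forms.
  have hθ : ∀ k, θ k ∈ smoothForms n X (n + 1) := fun k => by
    rw [← sub_eq_iff_eq_add'.2 (hd k)]
    exact Submodule.sub_mem _ (dForm_mem_smoothForms (hv k)) (hvd k)
  have hθK : ∀ k, ∀ x ∉ R.cutoffSet k, θ k x = 0 := by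
    intro k x hx
    change wedgeAt x (diffAt n (v k) x) (η x) = 0
    rw [R.diffAt_cutoff_eq_zero k hx]
    simpa using wedgeAt_sum_left (∅ : Finset ℕ) x (fun _ => 0) (η x)
  have hsum : ∀ x ∈ R.carrier, ∑ k, θ k x = 0 := by
    intro x hx
    rw [← wedgeAt_sum_left, R.sum_diffAt_cutoff hx]
    simpa using wedgeAt_sum_left (∅ : Finset ℕ) x (fun _ => 0) (η x)
  -- The error terms are integrated in different charts. Inserting Σ v_l = 1 cuts each into pieces
  -- supported in two chart domains; each piece moves from chart `k` to chart `l`, where the sum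
  -- over `k` is zero pointwise.
  have hzero : ∑ k, (c k).chartIntegral vol (θ k) = 0 := by
    have h1 : ∀ k, (c k).chartIntegral vol (θ k) =
        ∑ l, (c l).chartIntegral vol (fun x => v l x • θ k x) := by
      intro k
      have h2 : (c k).chartIntegral vol (θ k) =
          (c k).chartIntegral vol (∑ l, fun x => v l x • θ k x) := by
        refine CornerChart.chartIntegral_congr fun x hx => ?_
        rw [Finset.sum_apply, ← Finset.sum_smul, R.sum_cutoff hx]
        exact (one_smul ℝ _).symm
      rw [h2, CornerChart.chartIntegral_sum hvol hvol₀ _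
        (fun l => smul_mem_smoothForms n (v l) (hθ k)) (R.isCompact_cutoffSet k)
        (R.cutoffSet_subset k) fun l x hx => ?_]
      · refine Finset.sum_congr rfl fun l _ => ?_
        refine CornerChart.chartIntegral_eq_of_support fun x _ h => ⟨?_, ?_⟩
        · by_contra hx
          refine h ?_
          rw [hθK k x fun h' => hx (R.cutoffSet_subset k h')]
          exact smul_zero _
        · by_contra hx
          exact h (R.cutoff_smul_eq_zero l (θ k) fun h' => hx (R.cutoffSet_subset l h'))
      · rw [hθK k x hx]
        exact smul_zero _
    simp only [h1]
    rw [Finset.sum_comm]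
    refine Finset.sum_eq_zero fun l _ => ?_
    rw [← CornerChart.chartIntegral_sum hvol hvol₀ _
        (fun k => smul_mem_smoothForms n (v l) (hθ k)) (R.isCompact_cutoffSet l)
        (R.cutoffSet_subset l) fun k x hx => R.cutoff_smul_eq_zero l (θ k) hx]
    have h3 : (c l).chartIntegral vol (∑ k, fun x => v l x • θ k x) =
        (c l).chartIntegral vol 0 := by
      refine CornerChart.chartIntegral_congr fun x hx => ?_
      rw [Finset.sum_apply, ← Finset.smul_sum, hsum x hx]
      exact smul_zero _
    rw [h3]
    refine setIntegral_eq_zero_of_forall_eq_zero fun y _ => orientedCoeff_eq_zero rfl _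
  have hI : R.integral vol (dForm n η) =
      ∑ k, (c k).chartIntegral vol (dForm n fun x => v k x • η x) := by
    rw [integral_eq_sum, ← add_zero (∑ k, _), ← hzero, ← Finset.sum_add_distrib]
    refine Finset.sum_congr rfl fun k _ => ?_
    rw [hd, CornerChart.chartIntegral_add hvol hvol₀ (hvd k) (hθ k) (R.isCompact_cutoffSet k)
      (R.cutoffSet_subset k) (fun x hx => R.cutoff_smul_eq_zero k _ hx) (hθK k)]
  rw [hI]
  refine Finset.sum_congr rfl fun k _ => ?_
  rw [CornerChart.chartIntegral_dForm hvol hvol₀ (hv k) (R.isCompact_cutoffSet k)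
    (R.cutoffSet_subset k) fun x hx => R.cutoff_smul_eq_zero k η hx]
  refine Finset.sum_congr rfl fun j _ => ?_
  refine setIntegral_congr_fun ((c k).measurableSet_faceDomain j) fun y hy => ?_
  rw [orientedCoeff_smul, orientedCoeff_of_mem hy.1,
    (R.cutoff_eventuallyEq k ((c k).symm_mem hy)).self_of_nhds, mul_left_comm, ← mul_assoc (-_)]
  rfl

end Subbody

end Global

end HyperStress
end

noncomputable section
namespace HyperStress

set_option linter.unusedSectionVars false

/-! ### Positive forms have positive integrals. -/

section Positivity

variable {n : ℕ} {X : Type*} [TopologicalSpace X] [ChartedSpace (Model n) X]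
  [IsManifold 𝓘(ℝ, Model n) ∞ X] [T2Space X] [SigmaCompactSpace X]
  {vol : ∀ x : X, FormFiber n (n + 1) x}

/-- An `(n + 1)`-form that is positive at `x` with respect to the orientation. -/
def IsPositiveAt (vol θ : ∀ x : X, FormFiber n (n + 1) x) (x : X) : Prop :=
  ∃ e ∈ IsManifold.maximalAtlas 𝓘(ℝ, Model n) ∞ X, x ∈ e.source ∧
    0 < orientedCoeff vol e θ (stdFrame n) (e x)

theorem IsPositiveAt.orientedCoeff_pos {θ : ∀ x : X, FormFiber n (n + 1) x} {x : X}
    (h : IsPositiveAt vol θ x) {e : OpenPartialHomeomorph X (Model n)}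
    (he : e ∈ IsManifold.maximalAtlas 𝓘(ℝ, Model n) ∞ X) (hx : x ∈ e.source) :
    0 < orientedCoeff vol e θ (stdFrame n) (e x) := by
  obtain ⟨e', he', hx', h⟩ := h
  rw [orientedCoeff_transition he' he θ (e'.map_source hx')
    (by rwa [e'.left_inv hx']), Function.comp_apply, e'.left_inv hx'] at h
  exact pos_of_mul_pos_right h (abs_nonneg _)

/-- Every chart contributes a nonnegative amount. Some weight is positive at the interior point `x`,
and by continuity its integrand is positive on a neighbourhood, a set of positive measure. -/
theorem Subbody.integral_pos (hvol : vol ∈ smoothForms n X (n + 1)) (hvol₀ : ∀ x, vol x ≠ 0)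
    (R : Subbody n X) {θ : ∀ x : X, FormFiber n (n + 1) x} (hθ : θ ∈ smoothForms n X (n + 1))
    (hpos : ∀ x ∈ R.carrier, IsPositiveAt vol θ x) {x : X} (hx : R.carrier ∈ 𝓝 x) :
    0 < R.integral vol θ := by
  have hnn : ∀ k, ∀ y ∈ (R.cover.chart k).domain,
      0 ≤ orientedCoeff vol (R.cover.chart k).chart (fun x => R.cutoff k x • θ x) (stdFrame n) y := by
    intro k y hy
    rw [orientedCoeff_smul,
      (R.cutoff_eventuallyEq k ((R.cover.chart k).symm_mem hy)).self_of_nhds]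
    refine mul_nonneg (R.cover.weight.nonneg k _) ?_
    have := (hpos _ ((R.cover.chart k).symm_mem hy)).orientedCoeff_pos
      (R.cover.chart k).mem_maximalAtlas ((R.cover.chart k).chart.map_target hy.1)
    rw [(R.cover.chart k).chart.right_inv hy.1] at this
    exact this.le
  rw [R.integral_eq_sum]
  obtain ⟨k, hk⟩ := R.cover.weight.exists_pos_of_mem (mem_of_mem_nhds hx)
  refine Finset.sum_pos' (fun k _ => setIntegral_nonneg (R.cover.chart k).measurableSet_domain
    (hnn k)) ⟨k, Finset.mem_univ _, ?_⟩
  set c := R.cover.chart k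
  have hxs : x ∈ c.chart.source := R.cover.subordinate k (subset_tsupport _ hk.ne')
  have hθk := smul_mem_smoothForms n (R.cutoff k) hθ
  have hK : ∀ x ∉ R.cutoffSet k, R.cutoff k x • θ x = 0 := fun x hx => R.cutoff_smul_eq_zero k θ hx
  have hcont := (contDiff_orientedCoeff hvol hvol₀ c.mem_maximalAtlas hθk (R.isCompact_cutoffSet k)
    (R.cutoffSet_subset k) hK (stdFrame n)).continuous
  have hpos' : 0 < orientedCoeff vol c.chart (fun x => R.cutoff k x • θ x) (stdFrame n)
      (c.chart x) := by
    rw [orientedCoeff_smul, c.chart.left_inv hxs,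
      (R.cutoff_eventuallyEq k (mem_of_mem_nhds hx)).self_of_nhds]
    exact mul_pos hk ((hpos x (mem_of_mem_nhds hx)).orientedCoeff_pos c.mem_maximalAtlas hxs)
  have hdom : c.domain ∈ 𝓝 (c.chart x) := by
    have h1 := c.chart.symm.continuousAt (c.chart.map_source hxs)
    rw [ContinuousAt, c.chart.left_inv hxs] at h1
    filter_upwards [h1 hx, c.chart.open_target.mem_nhds (c.chart.map_source hxs)] with y hy hy'
    have := c.apply_mem_domain (c.chart.map_target hy') hy
    rwa [c.chart.right_inv hy'] at this
  refine (setIntegral_pos_iff_support_of_nonneg_ae ?_ (CornerChart.integrableOn_orientedCoeff hvol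
    hvol₀ hθk (R.isCompact_cutoffSet k) (R.cutoffSet_subset k) hK)).2 ?_
  · exact (ae_restrict_iff' c.measurableSet_domain).2 (Eventually.of_forall (hnn k))
  · refine Measure.measure_pos_of_mem_nhds volume (x := c.chart x) (inter_mem ?_ hdom)
    filter_upwards [hcont.continuousAt.eventually (lt_mem_nhds hpos')] with y hy
    exact ne_of_gt hy

end Positivity

/-! ### Coordinate cubes as subbodies. -/

section Cubes

variable {n : ℕ} {X : Type*} [TopologicalSpace X] [ChartedSpace (Model n) X]

/-- The closed cube with centre `c` and edges of length `2 * δ`. -/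
def cube (c : Model n) (δ : ℝ) : Set (Model n) := {w | ∀ i, |w i - c i| ≤ δ}

theorem isCompact_cube (c : Model n) (δ : ℝ) : IsCompact (cube c δ) := by
  have h : cube c δ = WithLp.toLp 2 '' Icc (fun i => c i - δ) (fun i => c i + δ) := by
    ext w
    constructor
    · intro hw
      refine ⟨w.ofLp, ⟨fun i => ?_, fun i => ?_⟩, rfl⟩ <;>
      · have := abs_le.1 (hw i)
        simp only
        linarith
    · rintro ⟨w, ⟨h1, h2⟩, rfl⟩ i
      have h1 := h1 i
      have h2 := h2 i
      simp only at h1 h2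
      rw [abs_le]
      constructor <;> simp only <;> linarith
  rw [h]
  exact isCompact_Icc.image (PiLp.continuous_toLp 2 _)

theorem cube_mem_nhds (c : Model n) {δ : ℝ} (hδ : 0 < δ) : cube c δ ∈ 𝓝 c := by
  have h : ∀ i, ∀ᶠ w : Model n in 𝓝 c, |w i - c i| ≤ δ := by
    intro i
    have h1 : Continuous fun w : Model n => |w i - c i| := by fun_prop
    have h2 : (fun w : Model n => |w i - c i|) c < δ := by simpa using hδ
    exact (h1.continuousAt.eventually_lt continuousAt_const h2).mono fun w hw => hw.le
  exact eventually_all.2 h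

theorem exists_cube_subset {c : Model n} {U : Set (Model n)} (hU : U ∈ 𝓝 c) :
    ∃ δ, 0 < δ ∧ cube c δ ⊆ U := by
  have h1 : WithLp.toLp 2 ⁻¹' U ∈ 𝓝 c.ofLp := (PiLp.continuous_toLp 2 _).continuousAt hU
  obtain ⟨δ, hδ, h⟩ := Metric.nhds_basis_closedBall.mem_iff.1 h1
  refine ⟨δ, hδ, fun w hw => ?_⟩
  have : w.ofLp ∈ Metric.closedBall c.ofLp δ := by
    rw [Metric.mem_closedBall, dist_pi_le_iff hδ.le]
    intro i
    rw [Real.dist_eq]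
    exact hw i
  exact h this

/-- The reflections and translations of the model space. -/
def reflection (s : Fin (n + 1) → ℝ) (hs : ∀ i, s i * s i = 1) (a b : Model n) :
    Model n ≃ₜ Model n where
  toFun w := WithLp.toLp 2 fun i => s i * (w i - a i) + b i
  invFun w := WithLp.toLp 2 fun i => s i * (w i - b i) + a i
  left_inv w := by ext i; simp [← mul_assoc, hs]
  right_inv w := by ext i; simp [← mul_assoc, hs]
  continuous_toFun := (PiLp.continuous_toLp 2 _).comp (by fun_prop)
  continuous_invFun := (PiLp.continuous_toLp 2 _).comp (by fun_prop)

theorem contDiff_reflection (s : Fin (n + 1) → ℝ) (hs : ∀ i, s i * s i = 1) (a b : Model n) :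
    ContDiff ℝ ∞ (reflection s hs a b) := by
  rw [contDiff_euclidean]
  intro i
  change ContDiff ℝ ∞ fun w : Model n => s i * (w i - a i) + b i
  fun_prop

theorem trans_mem_maximalAtlas [IsManifold 𝓘(ℝ, Model n) ∞ X] {e : OpenPartialHomeomorph X (Model n)}
    (he : e ∈ IsManifold.maximalAtlas 𝓘(ℝ, Model n) ∞ X) {f : OpenPartialHomeomorph (Model n) (Model n)}
    (hf : f ∈ contDiffGroupoid ∞ 𝓘(ℝ, Model n)) :
    e.trans f ∈ IsManifold.maximalAtlas 𝓘(ℝ, Model n) ∞ X := by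
  intro e' he'
  obtain ⟨h1, h2⟩ := he e' he'
  constructor
  · rw [OpenPartialHomeomorph.trans_symm_eq_symm_trans_symm, OpenPartialHomeomorph.trans_assoc]
    exact StructureGroupoid.trans _ (StructureGroupoid.symm _ hf) h1
  · rw [← OpenPartialHomeomorph.trans_assoc]
    exact StructureGroupoid.trans _ h2 hf

theorem restr_reflection_mem (s : Fin (n + 1) → ℝ) (hs : ∀ i, s i * s i = 1) (a b : Model n)
    {O : Set (Model n)} (hO : IsOpen O) :
    (reflection s hs a b).toOpenPartialHomeomorph.restrOpen O hO ∈
      contDiffGroupoid ∞ 𝓘(ℝ, Model n) := by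
  rw [contDiffGroupoid, mem_groupoid_of_pregroupoid]
  exact ⟨(contDiff_reflection s hs a b).contDiffOn, (contDiff_reflection s hs b a).contDiffOn⟩

theorem isOpen_signedHalfspaces (s : Fin (n + 1) → ℝ) (c : Model n) (δ : ℝ) :
    IsOpen {w : Model n | ∀ i, s i * (w i - c i) < δ} := by
  rw [ofPred_forall]
  exact isOpen_iInter_of_finite fun i => isOpen_lt (by fun_prop) continuous_const

/-- The preimage of a cube under a chart, as a subbody. -/
def cubeSubbody [IsManifold 𝓘(ℝ, Model n) ∞ X] {e : OpenPartialHomeomorph X (Model n)}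
    (he : e ∈ IsManifold.maximalAtlas 𝓘(ℝ, Model n) ∞ X) {c : Model n} {δ : ℝ} (hδ : 0 < δ)
    (h : cube c δ ⊆ e.target) : Subbody n X where
  carrier := e.symm '' cube c δ
  isCompact := (isCompact_cube c δ).image_of_continuousOn (e.symm.continuousOn.mono h)
  exists_chart := by
    rintro _ ⟨z, hz, rfl⟩
    -- In each coordinate the face on the same side of the centre as `z` is selected; the reflection
    -- moves the selected face to the coordinate hyperplane at `0`.
    let s : Fin (n + 1) → ℝ := fun i => if z i ≤ c i then 1 else -1
    have hs1 : ∀ i, s i = 1 ∨ s i = -1 := fun i => by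
      simp only [s]; split_ifs <;> simp
    have hs : ∀ i, s i * s i = 1 := fun i => by
      rcases hs1 i with h | h <;> simp [h]
    -- Restriction to this open set excludes the opposite faces. There one inequality per coordinate
    -- describes the cube, so all coordinates may serve as faces even if `z` lies on none of them.
    have hO := isOpen_signedHalfspaces s c δ
    let f := (reflection s hs c (WithLp.toLp 2 fun _ => δ)).toOpenPartialHomeomorph.restrOpen _ hO
    refine ⟨⟨e.trans f, trans_mem_maximalAtlas he (restr_reflection_mem _ _ _ _ hO), Finset.univ,
      ?_⟩, ?_⟩
    · intro x hx
      rw [OpenPartialHomeomorph.trans_source] at hx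
      have hx2 : ∀ i, s i * (e x i - c i) < δ := hx.2.2
      have h1 : x ∈ e.symm '' cube c δ ↔ e x ∈ cube c δ := by
        constructor
        · rintro ⟨w, hw, rfl⟩
          rwa [e.right_inv (h hw)]
        · exact fun hw => ⟨_, hw, e.left_inv hx.1⟩
      rw [h1]
      have h2 : ∀ i, |e x i - c i| ≤ δ ↔ 0 ≤ s i * (e x i - c i) + δ := by
        intro i
        have h3 := hx2 i
        rw [abs_le]
        rcases hs1 i with h | h <;> rw [h] at h3 ⊢ <;> constructor
        · intro h; linarith [h.1]
        · intro h; constructor <;> linarith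
        · intro h; linarith [h.2]
        · intro h; constructor <;> linarith
      exact ⟨fun hw i _ => (h2 i).1 (hw i), fun hw i => (h2 i).2 (hw i (Finset.mem_univ _))⟩
    · rw [OpenPartialHomeomorph.trans_source]
      refine ⟨e.map_target (h hz), mem_univ _, ?_⟩
      rw [e.right_inv (h hz)]
      intro i
      simp only [s]
      split_ifs with hi <;> linarith

end Cubes

/-! ### Localisation of integral identities. -/

section Vanishing

variable {n : ℕ} {X : Type*} [TopologicalSpace X] [ChartedSpace (Model n) X]
  [IsManifold 𝓘(ℝ, Model n) ∞ X] [T2Space X] [SigmaCompactSpace X]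
  {vol : ∀ x : X, FormFiber n (n + 1) x}

/-- By continuity the form stays positive on a small coordinate cube around the point. -/
theorem exists_subbody_integral_pos (hvol : vol ∈ smoothForms n X (n + 1)) (hvol₀ : ∀ x, vol x ≠ 0)
    {θ : ∀ x : X, FormFiber n (n + 1) x} (hθ : θ ∈ smoothForms n X (n + 1)) {x : X}
    (hx : 0 < orientedCoeff vol (chartAt (Model n) x) θ (stdFrame n) (chartAt (Model n) x x)) :
    ∃ R : Subbody n X, 0 < R.integral vol θ := by
  set e := chartAt (Model n) x
  have he : e ∈ IsManifold.maximalAtlas 𝓘(ℝ, Model n) ∞ X := IsManifold.chart_mem_maximalAtlas _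
  have hxs : x ∈ e.source := mem_chart_source _ _
  have hcont : ContinuousAt (orientedCoeff vol e θ (stdFrame n)) (e x) := by
    refine ContinuousAt.congr ?_
      (eventually_orientedCoeff_eq hvol hvol₀ he (e.map_source hxs) θ _).symm
    exact continuousAt_const.mul
      (contDiffAt_form_apply (contDiffAt_formIn hθ he (e.map_source hxs)) _).continuousAt
  obtain ⟨δ, hδ, hsub⟩ := exists_cube_subset
    (inter_mem (e.open_target.mem_nhds (e.map_source hxs)) (hcont.eventually (lt_mem_nhds hx)))
  refine ⟨cubeSubbody he hδ fun w hw => (hsub hw).1,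
    Subbody.integral_pos hvol hvol₀ _ hθ ?_ (x := x) ?_⟩
  · rintro _ ⟨w, hw, rfl⟩
    refine ⟨e, he, e.map_target (hsub hw).1, ?_⟩
    rw [e.right_inv (hsub hw).1]
    exact (hsub hw).2
  · filter_upwards [(e.continuousAt hxs) (cube_mem_nhds (e x) hδ), e.open_source.mem_nhds hxs]
      with y hy hy'
    exact ⟨_, hy, e.left_inv hy'⟩

/-- A smooth form is determined by its integrals over subbodies. -/
theorem eq_zero_of_integral_eq_zero (hvol : vol ∈ smoothForms n X (n + 1)) (hvol₀ : ∀ x, vol x ≠ 0)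
    {θ : ∀ x : X, FormFiber n (n + 1) x} (hθ : θ ∈ smoothForms n X (n + 1))
    (h : ∀ R : Subbody n X, R.integral vol θ = 0) (x : X) : θ x = 0 := by
  set e := chartAt (Model n) x with hee
  have he : e ∈ IsManifold.maximalAtlas 𝓘(ℝ, Model n) ∞ X := IsManifold.chart_mem_maximalAtlas _
  have hxs : x ∈ e.source := mem_chart_source _ _
  have h0 : orientedCoeff vol e θ (stdFrame n) (e x) = 0 := by
    rcases lt_trichotomy (orientedCoeff vol e θ (stdFrame n) (e x)) 0 with h1 | h1 | h1
    · have h2 : orientedCoeff vol e (fun x => -θ x) (stdFrame n) (e x) =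
          -orientedCoeff vol e θ (stdFrame n) (e x) := by
        rw [orientedCoeff_of_mem (e.map_source hxs), orientedCoeff_of_mem (e.map_source hxs),
          ← mul_neg]
        rfl
      obtain ⟨R, hR⟩ := exists_subbody_integral_pos hvol hvol₀ (Submodule.neg_mem _ hθ)
        (x := x) (lt_of_lt_of_eq (neg_pos.2 h1) h2.symm)
      have h3 := R.integral_neg (vol := vol) θ
      rw [h R, neg_zero] at h3
      exact absurd h3 hR.ne'
    · exact h1
    · obtain ⟨R, hR⟩ := exists_subbody_integral_pos hvol hvol₀ hθ h1
      exact absurd (h R) hR.ne'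
  rw [orientedCoeff_of_mem (e.map_source hxs)] at h0
  have h1 : formIn θ e (e x) (stdFrame n) = 0 := by
    refine (mul_eq_zero.1 h0).resolve_left fun h2 => ?_
    refine formIn_stdFrame_ne_zero hvol₀ he (e.map_source hxs) ?_
    rw [← sign_mul_abs (formIn vol e (e x) (stdFrame n)), h2, zero_mul]
  have h2 := formIn_comp_coframeMap θ he hxs
  rw [topForm_eq_zero h1] at h2
  exact h2.symm

end Vanishing

end HyperStress
end

noncomputable section
namespace HyperStress

set_option linter.unusedSectionVars false

/-- A tuple of `n` basis vectors misses some `e j` among the `n + 1`. The product of the dual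
covector of `e j` with η, evaluated on `e j` followed by the tuple, recovers the value of η on the
tuple. -/
theorem eq_of_wedgeForm_eq {n : ℕ} {η η' : Model n [⋀^Fin n]→L[ℝ] ℝ}
    (h : ∀ α : Model n →L[ℝ] ℝ, wedgeForm α η = wedgeForm α η') : η = η' := by
  apply ContinuousAlternatingMap.toAlternatingMap_injective
  refine Module.Basis.ext_alternating (EuclideanSpace.basisFun (Fin (n + 1)) ℝ).toBasis fun v _ => ?_
  have he : ⇑(EuclideanSpace.basisFun (Fin (n + 1)) ℝ).toBasis = stdFrame n := by
    ext i : 1; simp [stdFrame]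
  rw [he]
  obtain ⟨j, hj⟩ : ∃ j, j ∉ range v := by
    by_contra! h0
    have := Fintype.card_le_of_surjective v h0
    simp at this
  have h1 : ∀ ζ : Model n [⋀^Fin n]→L[ℝ] ℝ, wedgeForm (EuclideanSpace.proj j) ζ
      (Fin.cons (stdFrame n j) fun k => stdFrame n (v k) : Fin (n + 1) → Model n) =
      ζ fun k => stdFrame n (v k) := by
    intro ζ
    rw [wedgeForm_apply, Fin.sum_univ_succ, Finset.sum_eq_zero]
    · simp [stdFrame, Fin.removeNth_zero]
    · intro k _
      have : v k ≠ j := fun h => hj ⟨k, h⟩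
      simp [stdFrame, this.symm]
  have h2 := h (EuclideanSpace.proj j)
  have h3 := h1 η
  rw [h2, h1 η'] at h3
  exact h3.symm

/-! ### Equivalence of the global and the local balance of power. -/

section Representation

variable {n : ℕ} {X : Type*} [TopologicalSpace X] [ChartedSpace (Model n) X]
  [IsManifold 𝓘(ℝ, Model n) ∞ X] [T2Space X] [SigmaCompactSpace X]
  {vol : ∀ x : X, FormFiber n (n + 1) x}
variable {M : Type*} [AddCommGroup M] [Module (SmoothFun n X) M] [Module ℝ M]
  [IsScalarTower ℝ (SmoothFun n X) M] {r : ℕ}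

/-- Test with `f • A` where `f x = 0`: the body force drops out, the exterior derivative reduces to
df ∧ (σ·A), and the power of `P` is df ∧ (p_σ(P)·A). As df is an arbitrary covector, the two
tractions agree. -/
theorem traction_eq_of_power_eq
    {P : jetHom (X := X) n (jetSections (X := X) n M r) 1 (n + 1)} {b : jetHom (X := X) n M r (n + 1)}
    {σ : jetHom (X := X) n M r n}
    (h : ∀ (A : jetSections (X := X) n M r) (x : X),
      P.1 x (jet n 1 x A) = b.1 x (A.1 x) + dForm n (fun y => σ.1 y (A.1 y)) x) :
    traction P = σ := by
  refine Subtype.ext (jetHom_ext fun x A => eq_of_wedgeForm_eq fun α => ?_)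
  obtain ⟨f, hf, rfl⟩ := exists_smoothFun_mfderiv_eq n x α
  refine (wedgeForm_traction P hf A).trans ((h (f • A) x).trans ?_)
  have h1 : b.1 x ((f • A).1 x) = 0 := by
    rw [jetSections_smul_apply, LinearMap.map_smul, hf]
    exact zero_smul ℝ _
  have h2 : (fun y => σ.1 y ((f • A).1 y)) = fun y => f y • σ.1 y (A.1 y) := by
    ext y : 1
    rw [jetSections_smul_apply, LinearMap.map_smul]
  rw [h1, h2, zero_add, dForm_smoothFun_smul f (σ.2 _ A.2), hf]
  exact (congrArg (· + wedgeAt x (diffAt n f x) _) (zero_smul ℝ _)).trans (zero_add _)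

theorem power_eq_iff {P : jetHom (X := X) n (jetSections (X := X) n M r) 1 (n + 1)}
    {b : jetHom (X := X) n M r (n + 1)} {σ : jetHom (X := X) n M r n} :
    (∀ (A : jetSections (X := X) n M r) (x : X),
      P.1 x (jet n 1 x A) = b.1 x (A.1 x) + dForm n (fun y => σ.1 y (A.1 y)) x) ↔
    traction P = σ ∧ divergence n M r P + b = 0 := by
  constructor
  · intro h
    have hσ := traction_eq_of_power_eq h
    refine ⟨hσ, Subtype.ext (jetHom_ext fun x A => ?_)⟩
    change (divergence n M r P).1 x (A.1 x) + b.1 x (A.1 x) = 0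
    rw [divergence_apply, hσ, h A x]
    abel
  · rintro ⟨hσ, hb⟩ A x
    have h1 : (divergence n M r P).1 x (A.1 x) + b.1 x (A.1 x) = 0 :=
      congrArg (fun τ : jetHom (X := X) n M r (n + 1) => τ.1 x (A.1 x)) hb
    rw [divergence_apply, hσ] at h1
    rw [eq_neg_of_add_eq_zero_right h1]
    abel

/-- The global balance of power over all subbodies is equivalent to the local balance. -/
theorem forall_integral_eq_iff (hvol : vol ∈ smoothForms n X (n + 1)) (hvol₀ : ∀ x, vol x ≠ 0)
    (P : jetHom (X := X) n (jetSections (X := X) n M r) 1 (n + 1)) (b : jetHom (X := X) n M r (n + 1))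
    (σ : jetHom (X := X) n M r n) :
    (∀ (R : Subbody n X) (A : jetSections (X := X) n M r),
      R.integral vol (fun x => P.1 x (jet n 1 x A)) = R.integral vol (fun x => b.1 x (A.1 x)) +
        R.boundaryIntegral vol
          fun x H => (σ.1 x (A.1 x)).compContinuousLinearMap H.subtypeL) ↔
    tractionPart n M r P.1 = σ.1 ∧ divergence n M r P + b = 0 := by
  have htr : tractionPart n M r P.1 = σ.1 ↔ traction P = σ := ⟨fun h => Subtype.ext h, congrArg Subtype.val⟩
  rw [htr, ← power_eq_iff, forall_comm]
  refine forall_congr' fun A => ?_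
  have hP : (fun x => P.1 x (jet n 1 x A)) ∈ smoothForms n X (n + 1) := P.2 _ (prolong n 1 A).2
  have hb : (fun x => b.1 x (A.1 x)) ∈ smoothForms n X (n + 1) := b.2 _ A.2
  have hσ : (fun x => σ.1 x (A.1 x)) ∈ smoothForms n X n := σ.2 _ A.2
  have hd := dForm_mem_smoothForms hσ
  -- Stokes' theorem replaces the boundary power, so that the balance compares integrals of two
  -- smooth forms over the body.
  have hR : ∀ R : Subbody n X, R.integral vol (fun x => b.1 x (A.1 x)) + R.boundaryIntegral vol
      (fun x H => (σ.1 x (A.1 x)).compContinuousLinearMap H.subtypeL) =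
      R.integral vol (fun x => b.1 x (A.1 x) + dForm n (fun y => σ.1 y (A.1 y)) x) := fun R => by
    rw [R.integral_add hvol hvol₀ hb hd, R.integral_dForm hvol hvol₀ hσ]
  simp only [hR]
  constructor
  · intro h x
    have hbd : (fun x => b.1 x (A.1 x) + dForm n (fun y => σ.1 y (A.1 y)) x) ∈
      smoothForms n X (n + 1) := Submodule.add_mem _ hb hd
    refine sub_eq_zero.1 (eq_zero_of_integral_eq_zero hvol hvol₀ (Submodule.sub_mem _ hP hbd)
      (fun R => ?_) x)
    have h1 := R.integral_add hvol hvol₀ hP (Submodule.neg_mem _ hbd)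
    have h2 := R.integral_neg (vol := vol)
      fun x => b.1 x (A.1 x) + dForm n (fun y => σ.1 y (A.1 y)) x
    rw [← h R] at h2
    rw [sub_eq_add_neg]
    exact h1.trans ((congrArg (_ + ·) h2).trans (add_neg_cancel _))
  · intro h R
    exact R.integral_congr h

end Representation

/-! ### Hyper-force systems given by the Cauchy formula. -/

section Systems

variable {n r : ℕ} {X : Type*} [TopologicalSpace X] [ChartedSpace (Model n) X]
  [IsManifold 𝓘(ℝ, Model n) ∞ X] [T2Space X] [SigmaCompactSpace X]
  {F : Type*} [NormedAddCommGroup F] [NormedSpace ℝ F]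
  {W : X → Type*} [∀ x, AddCommGroup (W x)] [∀ x, Module ℝ (W x)] [∀ x, TopologicalSpace (W x)]
  [TopologicalSpace (Bundle.TotalSpace F W)] [FiberBundle F W] [VectorBundle ℝ F W]
  {vol : ∀ x : X, FormFiber n (n + 1) x}

/-- The boundary integral evaluates the tractions only at face points of adapted charts and on their
face tangent spaces, exactly where the Cauchy formula prescribes them. -/
theorem CauchyFormula.boundaryIntegral_eq {t : HyperTractionSystem n F W r}
    {σ : TractionHyperStress n F W r} (h : CauchyFormula t σ) (R : Subbody n X)
    (A : ∀ x : X, Jet n (Sections n F W) r x) :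
    R.boundaryIntegral vol (fun x H => t R x H (A x)) =
      R.boundaryIntegral vol fun x H => (σ.1 x (A x)).compContinuousLinearMap H.subtypeL := by
  refine Finset.sum_congr rfl fun k _ => Finset.sum_congr rfl fun j hj => ?_
  refine setIntegral_congr_fun ((R.cover.chart k).measurableSet_faceDomain j) fun y hy => ?_
  simp only
  rw [h R (R.cover.chart k) j hj y hy]

theorem represents_iff (hvol : vol ∈ smoothForms n X (n + 1)) (hvol₀ : ∀ x, vol x ≠ 0)
    {t : HyperTractionSystem n F W r} {σ : TractionHyperStress n F W r} (h : CauchyFormula t σ)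
    (P : NonHolonomicStress n F W r) (b : BodyHyperForce n F W r) :
    Represents vol P b t ↔ tractionPart n (Sections n F W) r P.1 = σ.1 ∧
      divergence n (Sections n F W) r P + b = 0 := by
  rw [← forall_integral_eq_iff hvol hvol₀]
  unfold Represents
  simp only [h.boundaryIntegral_eq]

end Systems

end HyperStress
end

theorem mainTheorem3 {n r : ℕ}
    {X : Type*} [TopologicalSpace X] [ChartedSpace (HyperStress.Model n) X]
    [IsManifold 𝓘(ℝ, HyperStress.Model n) ∞ X] [T2Space X] [SigmaCompactSpace X]
    {F : Type*} [NormedAddCommGroup F] [NormedSpace ℝ F] [FiniteDimensional ℝ F]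
    {W : X → Type*} [∀ x, AddCommGroup (W x)] [∀ x, Module ℝ (W x)]
    [∀ x, TopologicalSpace (W x)] [TopologicalSpace (Bundle.TotalSpace F W)]
    [FiberBundle F W] [VectorBundle ℝ F W]
    [ContMDiffVectorBundle ∞ F W 𝓘(ℝ, HyperStress.Model n)]
    -- `vol` is a volume form that gives the orientation of `X`
    (vol : ∀ x : X, HyperStress.FormFiber n (n + 1) x)
    (hvol : vol ∈ HyperStress.smoothForms n X (n + 1)) (hvol₀ : ∀ x, vol x ≠ 0) :
    -- the divergence exists and is unique
    (∃! div : HyperStress.NonHolonomicStress n F W r →ₗ[ℝ] HyperStress.BodyHyperForce n F W r,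
      HyperStress.IsDivergence div) ∧
    ∀ div : HyperStress.NonHolonomicStress n F W r →ₗ[ℝ] HyperStress.BodyHyperForce n F W r,
      HyperStress.IsDivergence div →
      -- it is a differential operator of the first order
      (∃ D : ∀ x : X, HyperStress.Jet n (HyperStress.NonHolonomicStress n F W r) 1 x →ₗ[ℝ]
          (HyperStress.Jet n (HyperStress.Sections n F W) r x →ₗ[ℝ]
            HyperStress.FormFiber n (n + 1) x),
        ∀ (P : HyperStress.NonHolonomicStress n F W r) (x : X),
          (div P).1 x = D x (HyperStress.jet n 1 x P)) ∧
      -- it is natural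
      (∀ {X' : Type*} [TopologicalSpace X'] [ChartedSpace (HyperStress.Model n) X']
        [IsManifold 𝓘(ℝ, HyperStress.Model n) ∞ X'] [T2Space X'] [SigmaCompactSpace X']
        {F' : Type*} [NormedAddCommGroup F'] [NormedSpace ℝ F'] [FiniteDimensional ℝ F']
        {W' : X' → Type*} [∀ x, AddCommGroup (W' x)] [∀ x, Module ℝ (W' x)]
        [∀ x, TopologicalSpace (W' x)] [TopologicalSpace (Bundle.TotalSpace F' W')]
        [FiberBundle F' W'] [VectorBundle ℝ F' W']
        [ContMDiffVectorBundle ∞ F' W' 𝓘(ℝ, HyperStress.Model n)]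
        (φ : X ≃ₘ^∞⟮𝓘(ℝ, HyperStress.Model n), 𝓘(ℝ, HyperStress.Model n)⟯ X')
        (Φ : ∀ x, W x ≃ₗ[ℝ] W' (φ x)),
        ContMDiff (𝓘(ℝ, HyperStress.Model n).prod 𝓘(ℝ, F))
          (𝓘(ℝ, HyperStress.Model n).prod 𝓘(ℝ, F')) ∞
          (fun p : Bundle.TotalSpace F W =>
            (⟨φ p.1, Φ p.1 p.2⟩ : Bundle.TotalSpace F' W')) →
        ∀ div' : HyperStress.NonHolonomicStress n F' W' r →ₗ[ℝ]
            HyperStress.BodyHyperForce n F' W' r, HyperStress.IsDivergence div' →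
          ∀ (P : HyperStress.NonHolonomicStress n F W r)
            (P' : HyperStress.NonHolonomicStress n F' W' r),
            HyperStress.RelatedStresses φ Φ P P' →
              HyperStress.RelatedForces φ Φ (div P) (div' P')) ∧
      -- the representation of force systems
      (∀ (b : HyperStress.BodyHyperForce n F W r) (t : HyperStress.HyperTractionSystem n F W r)
        (σ : HyperStress.TractionHyperStress n F W r), HyperStress.CauchyFormula t σ →
        ∀ P : HyperStress.NonHolonomicStress n F W r,
          HyperStress.Represents vol P b t ↔
            HyperStress.tractionPart n (HyperStress.Sections n F W) r P.1 = σ.1 ∧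
              div P + b = 0) := by
  refine ⟨⟨_, HyperStress.isDivergence_divergence, fun _ h => h.eq_divergence⟩,
    fun div hdiv => ⟨?_, ?_, ?_⟩⟩
  · rw [hdiv.eq_divergence]
    exact ⟨HyperStress.divergenceSymbol n (HyperStress.Sections n F W) r,
      HyperStress.divergence_eq_symbol⟩
  · intro X' _ _ _ _ _ F' _ _ _ W' _ _ _ _ _ _ _ φ Φ hΦ div' hdiv' P P' hP
    rw [hdiv.eq_divergence, hdiv'.eq_divergence]
    exact HyperStress.divergence_natural hΦ hP
  · intro b t σ h P
    rw [hdiv.eq_divergence]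
    exact HyperStress.represents_iff hvol hvol₀ h P b
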